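/- **Setting.** Let $I\subset\mathbb{R}$ be open (for instance an open interval) and let $f:I\to\mathbb{R}^2$ be a $C^\infty$ parameterization of a plane curve $C$ with at most cusp singularities: each singular point ($f'(t)=0$) is a *cusp*, i.e. near $t$ the map $f$ is locally diffeomorphic, in source and target, to $u\mapsto(u^2,u^3)$ at $u=0$. At regular points let $\mathbf t=f'/|f'|$, let $\mathbf n$ be $\mathbf t$ rotated by $+\pi/2$, $\kappa=\det(f',f'')/|f'|^3$, $\rho=1/\kappa$, and let $\rho',\rho'',\rho'''$ be derivatives of $\rho$ with respect to arc length; at a cusp put $\rho=0$. A *flat* point is a regular point with $\kappa=0$. For a plane curve, an *inflexion* point is a regular point at which the curvature changes sign (from one strict sign to the other); it is *non-degenerate* if $\det(\gamma',\gamma''')\neq0$ there. An *undulation* point is a regular point at which the curvature vanishes without changing sign. We say that $C$ has *finite contact* at $t$ if $\det(f'(t),f^{(k)}(t))\ne0$ for some $k\ge2$. For $\alpha\in[0,\pi]$ the $\alpha$-evolutoid of $C$ is parameterized, at non-flat points, by $\gamma_\alpha=f+\rho\sin\alpha\,(\cos\alpha\,\mathbf t+\sin\alpha\,\mathbf n)$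 (which is $f$ at cusps), and $\mathrm{SES}(C)$ is the set of all points $\gamma_\alpha(t)$ with $\alpha\in[0,\pi]$, $t$ not flat and $\gamma_\alpha'(t)=0$. Put $$\gamma_{\mathrm{SES}}=f+\frac{-\rho\rho'\,\mathbf t+\rho\,\mathbf n}{1+\rho'^2}$$ at regular non-flat points, and $\gamma_{\mathrm{SES}}=f$ at cusps and at flat points. **Theorem.** (i) $\mathrm{SES}(C)=\{\gamma_{\mathrm{SES}}(t): t\in I \text{ not flat}\}$. If $C$ has finite contact at every regular point (so that no point of $C$ looks like a straight line to infinite order), then $\gamma_{\mathrm{SES}}$ is $C^\infty$ on all of $I$. (ii) At a regular non-flat point $t$, $\gamma_{\mathrm{SES}}$ is singular if and only if $\rho''(t)=0$, and such a singular point is a cusp of $\gamma_{\mathrm{SES}}$ if and only if $\rho'''(t)\ne0$. At a flat point with finite contact, $\gamma_{\mathrm{SES}}$ is regular. (iii) If $C$ has a cusp at $t$, then $\gamma_{\mathrm{SES}}(t)=f(t)$ and $\gamma_{\mathrm{SES}}$ has a cusp at $t$. (iv) At a regular non-flat point $t$, $\gamma_{\mathrm{SES}}$ has an inflexion or undulation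 point if and only if $1+\rho'^2+2\rho\rho''=0$ at $t$; and an inflexion point of $\gamma_{\mathrm{SES}}$ at $t$ is non-degenerate if and only if $\rho'+\rho'^3-\rho^2\rho'''\neq0$ at $t$. (v) The set of closed curves $f\in C^\infty(S^1,\mathbb{R}^2)$ with at most cusp singularities, for which $\gamma_{\mathrm{SES}}$ is smooth and has at most cusp singularities, no undulation points and only non-degenerate inflexion points, is dense in $C^\infty(S^1,\mathbb{R}^2)$ with the Whitney $C^\infty$ topology. -/

import Mathlib

open Set Filter Topology Manifold
open scoped ContDiff

noncomputable section

namespace Evolutoid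

/-- The Euclidean plane. -/
abbrev Plane : Type := EuclideanSpace ℝ (Fin 2)

/-- The determinant of the matrix with columns `v`, `w`. -/
def det2 (v w : Plane) : ℝ := v 0 * w 1 - v 1 * w 0

/-- Counterclockwise rotation by a right angle. -/
def rot90 (v : Plane) : Plane := !₂[-v 1, v 0]

/-- Counterclockwise rotation by the angle `α`. -/
def rotate (α : ℝ) (v : Plane) : Plane := Real.cos α • v + Real.sin α • rot90 v

/-! ### Singularities of parameterized plane curves -/

/-- `γ` has a cusp at the parameter `t`: near `t` it is diffeomorphic, in the source and in the
target, to the curve `u ↦ (u², u³)` near `u = 0`. -/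
def IsCusp (γ : ℝ → Plane) (t : ℝ) : Prop :=
  ∃ (φ : ℝ → ℝ) (Φ : Plane → Plane),
    IsLocalDiffeomorphAt 𝓘(ℝ, ℝ) 𝓘(ℝ, ℝ) ∞ φ 0 ∧ φ 0 = t ∧
    IsLocalDiffeomorphAt 𝓘(ℝ, Plane) 𝓘(ℝ, Plane) ∞ Φ (γ t) ∧
    ∀ᶠ u in 𝓝 (0 : ℝ), Φ (γ (φ u)) = !₂[u ^ 2, u ^ 3]

/-- Every singular point of `γ` with parameter in `I` is a cusp. -/
def AtMostCusps (γ : ℝ → Plane) (I : Set ℝ) : Prop :=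
  ∀ t ∈ I, deriv γ t = 0 → IsCusp γ t

/-- The signed curvature `det (γ', γ'') / |γ'|³` (meaningful at regular points). -/
def curvature (γ : ℝ → Plane) (t : ℝ) : ℝ :=
  det2 (deriv γ t) (deriv (deriv γ) t) / ‖deriv γ t‖ ^ 3

/-- The function `g` changes sign at `t`. -/
def ChangesSignAt (g : ℝ → ℝ) (t : ℝ) : Prop :=
  ((∀ᶠ s in 𝓝[<] t, g s < 0) ∧ (∀ᶠ s in 𝓝[>] t, 0 < g s)) ∨
  ((∀ᶠ s in 𝓝[<] t, 0 < g s) ∧ (∀ᶠ s in 𝓝[>] t, g s < 0))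

/-- An inflexion point: a regular point at which the curvature changes sign. -/
def IsInflexion (γ : ℝ → Plane) (t : ℝ) : Prop :=
  deriv γ t ≠ 0 ∧ ChangesSignAt (curvature γ) t

/-- An undulation point: a regular point at which the curvature vanishes without changing sign. -/
def IsUndulation (γ : ℝ → Plane) (t : ℝ) : Prop :=
  deriv γ t ≠ 0 ∧ curvature γ t = 0 ∧ ¬ ChangesSignAt (curvature γ) t

/-- The condition `det (γ', γ''') ≠ 0`, by which an inflexion point is non-degenerate. -/
def IsNondegenerate (γ : ℝ → Plane) (t : ℝ) : Prop :=
  det2 (deriv γ t) (iteratedDeriv 3 γ t) ≠ 0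

/-- A flat point: a regular point at which the curvature vanishes. -/
def IsFlat (γ : ℝ → Plane) (t : ℝ) : Prop :=
  deriv γ t ≠ 0 ∧ curvature γ t = 0

/-- At the parameter `t` the curve `γ` has finite order of contact with its tangent line, that is,
some Taylor coefficient of `γ` at `t` of order at least two is not parallel to `γ'(t)`. -/
def HasFiniteContact (γ : ℝ → Plane) (t : ℝ) : Prop :=
  ∃ k : ℕ, det2 (deriv γ t) (iteratedDeriv (k + 2) γ t) ≠ 0

/-! ### Arc length, moving frame, radius of curvature -/

/-- The derivative of `g` with respect to the arc length of `f`; it is `g'` if `|f'| = 1`. -/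
def arcDeriv (f : ℝ → Plane) (g : ℝ → ℝ) (t : ℝ) : ℝ := deriv g t / ‖deriv f t‖

/-- The unit tangent vector (at a regular point). -/
def unitTangent (f : ℝ → Plane) (t : ℝ) : Plane := ‖deriv f t‖⁻¹ • deriv f t

/-- The unit normal vector; (tangent, normal) is a positively oriented frame. -/
def unitNormal (f : ℝ → Plane) (t : ℝ) : Plane := rot90 (unitTangent f t)

open Classical in
/-- The (signed) radius of curvature; its value at a cusp is the limiting value `0`.
It is infinite, hence used nowhere, at a flat point. -/
def radius (f : ℝ → Plane) (t : ℝ) : ℝ :=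
  if deriv f t = 0 then 0 else 1 / curvature f t

/-- The first derivative of the radius of curvature with respect to arc length
(at a regular point which is not flat). -/
def radius₁ (f : ℝ → Plane) : ℝ → ℝ := arcDeriv f (radius f)

/-- The second derivative of the radius of curvature with respect to arc length. -/
def radius₂ (f : ℝ → Plane) : ℝ → ℝ := arcDeriv f (radius₁ f)

/-- The third derivative of the radius of curvature with respect to arc length. -/
def radius₃ (f : ℝ → Plane) : ℝ → ℝ := arcDeriv f (radius₂ f)

/-! ### Evolutoids and the singular evolutoids set -/

/-- The `α`-evolutoid `f + ρ sin α · e^{iα} t` of `f`, at a point which is not flat.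
At a cusp `ρ = 0`, so the value is that of `f`. -/
def evolutoid (f : ℝ → Plane) (α : ℝ) (t : ℝ) : Plane :=
  f t + (radius f t * Real.sin α) • rotate α (unitTangent f t)

/-- The singular evolutoids set: all singular points of all `α`-evolutoids, `α ∈ [0, π]`. -/
def SES (f : ℝ → Plane) (I : Set ℝ) : Set Plane :=
  {x | ∃ α ∈ Icc (0 : ℝ) Real.pi, ∃ t ∈ I,
    ¬ IsFlat f t ∧ deriv (evolutoid f α) t = 0 ∧ evolutoid f α t = x}

open Classical in
/-- The parameterization `f + (-ρ ρ' t + ρ n) / (1 + ρ'²)` of the singular evolutoids set, extended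
by its limiting value `f` to the cusps (where `ρ = 0`) and to the flat points (where `ρ = ∞`). -/
def sesCurve (f : ℝ → Plane) (t : ℝ) : Plane :=
  if deriv f t = 0 ∨ curvature f t = 0 then f t
  else f t + (1 + radius₁ f t ^ 2)⁻¹ •
    (-(radius f t * radius₁ f t) • unitTangent f t + radius f t • unitNormal f t)

/-! ### Closed curves and the Whitney topology -/

/-- Smooth closed curves: the set `C^∞(S¹, ℝ²)`. -/
abbrev ClosedCurve : Type := C^∞⟮𝓡 1, Circle; 𝓘(ℝ, Plane), Plane⟯

/-- The `2π`-periodic parameterization of a closed curve by the angle. -/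
def ClosedCurve.lift (f : ClosedCurve) (θ : ℝ) : Plane := f (Circle.exp θ)

/-- The `k`-jet of a closed curve at the point with angle `θ`, in the bundle of `k`-jets
`J^k(S¹, ℝ²) = S¹ × (ℝ²)^(k+1)`, trivialized by the angular coordinate. -/
def ClosedCurve.jet (k : ℕ) (f : ClosedCurve) (θ : ℝ) : Circle × (Fin (k + 1) → Plane) :=
  (Circle.exp θ, fun i => iteratedDeriv (i : ℕ) (ClosedCurve.lift f) θ)

/-- The Whitney `C^∞` topology on `C^∞(S¹, ℝ²)`: its basic open sets consist of the maps whose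
`k`-jets all lie in a given open subset of `J^k(S¹, ℝ²)`. -/
@[reducible]
def whitneyTopology : TopologicalSpace ClosedCurve :=
  TopologicalSpace.generateFrom
    {M | ∃ (k : ℕ) (U : Set (Circle × (Fin (k + 1) → Plane))), IsOpen U ∧
      M = {f : ClosedCurve | ∀ θ : ℝ, ClosedCurve.jet k f θ ∈ U}}

end Evolutoid

end

open Set Filter Topology Manifold
open scoped ContDiff

noncomputable section

namespace Evolutoid

/-! ### Smooth functions of one variable -/

section OneVariable

variable {E : Type*} [NormedAddCommGroup E] [NormedSpace ℝ E]

/-! Everything rests on one closed formula. Write the velocity of `f` as `l • g` and put p = det(g,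
g') (`turning`), q = |g|², N = `radiusNum l g`, E = `radiusNum₂ l g` and D = l²p⁴ + N² (`sesDenom`);
these letters are used in the comments below. Clearing denominators in the definition of γ_SES gives
`sesFormula`, which is smooth wherever D ≠ 0, whether or not the radius of curvature is finite and
nonzero there. Where moreover g ≠ 0, its velocity is (l q E / D²) V with V = `sesDirection l g`, and
|V|² = q D², det(V, V') = D p (D + 2qE). So the singular points are the zeros of l E, and at the
other points the curvature vanishes exactly where p (D + 2qE) does.

For l = 1 and g = f' one has ρ' = N/p², ρ'' = E/(p³|f'|) and D + 2qE = p⁴(1 + ρ'² + 2ρρ''), which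
yields (ii) and (iv) at regular non-flat points. At a cusp l has a simple zero and p ≠ 0, so N ≠ 0,
hence D ≠ 0 and the same formula applies (`sesCurve_of_hasCuspForm`). At a flat point of finite
contact p and N vanish to orders i + 1 and i, and a common power cancels (`sesCurve_of_flat`). The
description of SES(C) follows because the α-evolutoid moves with the scalar speed |f'|(cos α + ρ'
sin α) along the rotated tangent.

Cusps are handled through the criterion `HasCuspForm`: the velocity is l g with a simple zero of l
and det(g, g') ≠ 0. That this produces the diffeomorphisms required by `IsCusp` uses a parameter u
whose square is one coordinate of the curve, and the fact that smooth even functions of u are smooth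
functions of u². The latter comes from Borel's lemma and a smooth square-root substitution for
functions that vanish to infinite order.

For (v), Whitney open sets are used only through finite-dimensional perturbations (`Stable`). A
dimension count makes the curve an immersion. Then p, E and D + 2qE are given only simple zeros, one
after the other; each condition survives small perturbations. Locally this is a pigeonhole argument
in a one-parameter family (`frequently_simple_zeros`), in place of Sard's theorem, and compactness
makes it global. Simple zeros of p keep D away from 0 and keep the zeros of E and D + 2qE away from
flat points, so the local analysis gives the generic picture (`sesCurve_generic`). -/

/-- The germ of a smooth function is the germ of a smooth function on the whole line. -/
theorem exists_contDiff_eventuallyEq {f : ℝ → E} {s : Set ℝ} {t : ℝ} (hs : IsOpen s) (ht : t ∈ s)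
    (hf : ContDiffOn ℝ ∞ f s) : ∃ F : ℝ → E, ContDiff ℝ ∞ F ∧ F =ᶠ[𝓝 t] f := by
  obtain ⟨ε, hε, hεs⟩ := Metric.isOpen_iff.1 hs t ht
  let χ : ContDiffBump t := ⟨ε / 4, ε / 2, by positivity, by linarith⟩
  refine ⟨fun x => χ x • f x, ?_, ?_⟩
  · rw [contDiff_iff_contDiffAt]
    intro x
    by_cases hx : x ∈ s
    · exact χ.contDiff.contDiffAt.smul (hf.contDiffAt (hs.mem_nhds hx))
    · have hx' : x ∈ (Metric.closedBall t (ε / 2))ᶜ := by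
        intro h
        exact hx (hεs (lt_of_le_of_lt (Metric.mem_closedBall.1 h) (by linarith)))
      have : (fun x => χ x • f x) =ᶠ[𝓝 x] fun _ => 0 := by
        filter_upwards [Metric.isClosed_closedBall.isOpen_compl.mem_nhds hx'] with y hy
        have : χ y = 0 := χ.zero_of_le_dist (by
          simp only [mem_compl_iff, Metric.mem_closedBall, not_le] at hy
          exact hy.le)
        simp [this]
      exact contDiffAt_const.congr_of_eventuallyEq this
  · filter_upwards [χ.eventuallyEq_one] with x hx
    simp [hx]

/-- Differentiating under the integral only raises the weight from `r ^ n` to `r ^ (n + 1)` and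
replaces `g` by its derivative. The family over all weights is therefore closed under
differentiation, which is why Hadamard's quotient is studied with an arbitrary weight. -/
theorem hasDerivAt_integral_pow_smul [CompleteSpace E] {g : ℝ → E} (hg : ContDiff ℝ ∞ g) (t : ℝ)
    (n : ℕ) (s : ℝ) :
    HasDerivAt (fun s => ∫ r in (0 : ℝ)..1, r ^ n • g (t + r * (s - t)))
      (∫ r in (0 : ℝ)..1, r ^ (n + 1) • deriv g (t + r * (s - t))) s := by
  have hg' : Continuous (deriv g) := hg.continuous_deriv (by simp)
  have hc : Continuous (fun p : ℝ × ℝ => p.2 ^ (n + 1) • deriv g (t + p.2 * (p.1 - t))) := by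
    fun_prop
  obtain ⟨C, hC⟩ := ((isCompact_closedBall s 1).prod
    (isCompact_Icc (a := (0 : ℝ)) (b := 1))).exists_bound_of_continuousOn hc.continuousOn
  refine (intervalIntegral.hasDerivAt_integral_of_dominated_loc_of_deriv_le
    (F := fun s r => r ^ n • g (t + r * (s - t)))
    (F' := fun s r => r ^ (n + 1) • deriv g (t + r * (s - t)))
    (bound := fun _ => C) (Metric.ball_mem_nhds s one_pos) ?_ ?_ ?_ ?_ ?_ ?_).2
  · refine Eventually.of_forall fun x => Continuous.aestronglyMeasurable ?_
    have := hg.continuous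
    fun_prop
  · have := hg.continuous
    exact Continuous.intervalIntegrable (by fun_prop) _ _
  · exact Continuous.aestronglyMeasurable (by fun_prop)
  · refine Eventually.of_forall fun r hr x hx => ?_
    rw [uIoc_of_le zero_le_one] at hr
    exact hC (x, r) ⟨Metric.ball_subset_closedBall hx, hr.1.le, hr.2⟩
  · exact intervalIntegrable_const
  · refine Eventually.of_forall fun r hr x hx => ?_
    have h1 : HasDerivAt (fun x => t + r * (x - t)) r x := by
      simpa using (((hasDerivAt_id x).sub_const t).const_mul r).const_add t
    have h2 := ((hg.differentiable (by simp) _).hasDerivAt.scomp x h1).const_smul (r ^ n)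
    rw [pow_succ, mul_smul]
    exact h2

theorem contDiff_integral_pow_smul [CompleteSpace E] {g : ℝ → E} (hg : ContDiff ℝ ∞ g) (t : ℝ)
    (n : ℕ) : ContDiff ℝ ∞ (fun s => ∫ r in (0 : ℝ)..1, r ^ n • g (t + r * (s - t))) := by
  rw [contDiff_infty]
  intro k
  induction k generalizing n g with
  | zero =>
    exact contDiff_zero.2 (continuous_iff_continuousAt.2 fun s =>
      (hasDerivAt_integral_pow_smul hg t n s).continuousAt)
  | succ k ih =>
    rw [show ((k + 1 : ℕ) : WithTop ℕ∞) = k + 1 from by norm_cast, contDiff_succ_iff_deriv]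
    refine ⟨fun s => (hasDerivAt_integral_pow_smul hg t n s).differentiableAt, by simp, ?_⟩
    have : deriv (fun s => ∫ r in (0 : ℝ)..1, r ^ n • g (t + r * (s - t))) =
        fun s => ∫ r in (0 : ℝ)..1, r ^ (n + 1) • deriv g (t + r * (s - t)) :=
      funext fun s => (hasDerivAt_integral_pow_smul hg t n s).deriv
    rw [this]
    exact ih (contDiff_infty_iff_deriv.1 hg).2 (n + 1)

/-- Hadamard's lemma on the line. -/
theorem exists_eq_add_sub_smul [CompleteSpace E] {g : ℝ → E} (hg : ContDiff ℝ ∞ g) (t : ℝ) :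
    ∃ h : ℝ → E, ContDiff ℝ ∞ h ∧ ∀ s, g s = g t + (s - t) • h s := by
  refine ⟨_, contDiff_integral_pow_smul (contDiff_infty_iff_deriv.1 hg).2 t 0, fun s => ?_⟩
  have h1 : ∀ r ∈ uIcc (0 : ℝ) 1, HasDerivAt (fun r => g (t + r * (s - t)))
      ((s - t) • deriv g (t + r * (s - t))) r := fun r _ => by
    have h1 : HasDerivAt (fun r => t + r * (s - t)) (s - t) r := by
      simpa using ((hasDerivAt_id r).mul_const (s - t)).const_add t
    exact (hg.differentiable (by simp) _).hasDerivAt.scomp r h1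
  have hg' : Continuous (deriv g) := hg.continuous_deriv (by simp)
  have h2 := intervalIntegral.integral_eq_sub_of_hasDerivAt h1
    (Continuous.intervalIntegrable (by fun_prop) _ _)
  rw [intervalIntegral.integral_smul] at h2
  simp only [pow_zero, one_smul, h2]
  simp

theorem iteratedDeriv_succ_sub_mul {h : ℝ → ℝ} (hh : ContDiff ℝ ∞ h) (t : ℝ) (k : ℕ) (s : ℝ) :
    iteratedDeriv (k + 1) (fun s => (s - t) * h s) s =
      (s - t) * iteratedDeriv (k + 1) h s + (k + 1) * iteratedDeriv k h s := by
  have hd : ∀ k s, HasDerivAt (iteratedDeriv k h) (iteratedDeriv (k + 1) h s) s := fun k s => by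
    rw [iteratedDeriv_succ]
    exact (hh.differentiable_iteratedDeriv k (by exact_mod_cast WithTop.coe_lt_top _)
      s).hasDerivAt
  induction k generalizing s with
  | zero =>
    have h1 := ((hasDerivAt_id s).sub_const t).mul (hd 0 s)
    rw [iteratedDeriv_one]
    simp only [iteratedDeriv_zero, zero_add] at h1 ⊢
    rw [show (fun s => (s - t) * h s) = (fun x => id x - t) * h from rfl, h1.deriv]
    simp
    ring
  | succ k ih =>
    rw [iteratedDeriv_succ, funext ih]
    have h1 := (((hasDerivAt_id s).sub_const t).mul (hd (k + 1) s)).add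
      ((hd k s).const_mul ((k : ℝ) + 1))
    refine (h1.deriv).trans ?_
    push_cast
    simp
    ring

theorem iteratedDeriv_succ_sub_mul_self {h : ℝ → ℝ} (hh : ContDiff ℝ ∞ h) (t : ℝ) (k : ℕ) :
    iteratedDeriv (k + 1) (fun s => (s - t) * h s) t = (k + 1) * iteratedDeriv k h t := by
  simp [iteratedDeriv_succ_sub_mul hh]

/-- A smooth function with a nonzero Taylor coefficient is a power times a nonvanishing smooth
factor. -/
theorem exists_eq_pow_mul {b : ℝ → ℝ} (hb : ContDiff ℝ ∞ b) {t : ℝ} {k : ℕ}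
    (hk : iteratedDeriv k b t ≠ 0) :
    ∃ (j : ℕ) (m : ℝ → ℝ), ContDiff ℝ ∞ m ∧ m t ≠ 0 ∧ ∀ s, b s = (s - t) ^ j * m s := by
  induction k generalizing b with
  | zero => exact ⟨0, b, hb, by simpa using hk, by simp⟩
  | succ k ih =>
    by_cases h0 : b t = 0
    · obtain ⟨h, hh, hbh⟩ := exists_eq_add_sub_smul hb t
      have hbh' : b = fun s => (s - t) * h s := funext fun s => by simp [hbh s, h0]
      rw [hbh', iteratedDeriv_succ_sub_mul_self hh] at hk
      obtain ⟨j, m, hm, hmt, hj⟩ := ih hh (right_ne_zero_of_mul hk)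
      refine ⟨j + 1, m, hm, hmt, fun s => ?_⟩
      rw [hbh', pow_succ']
      simp only [hj s]
      ring
    · exact ⟨0, b, hb, h0, by simp⟩

end OneVariable

/-! ### Borel's lemma -/

theorem iteratedDeriv_const_mul_pow_zero (c : ℝ) (n k : ℕ) :
    iteratedDeriv k (fun x : ℝ => c * x ^ n) 0 = if k = n then c * n.factorial else 0 := by
  rw [iteratedDeriv_const_mul_field, iteratedDeriv_pow]
  rcases lt_trichotomy k n with h | rfl | h
  · simp [h.ne, Nat.sub_ne_zero_of_lt h]
  · simp [Nat.descFactorial_self]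
  · simp [h.ne', Nat.descFactorial_of_lt h]

/-- **Borel's lemma**: every real sequence is the sequence of derivatives of a smooth function. -/
theorem exists_contDiff_iteratedDeriv_eq (a : ℕ → ℝ) :
    ∃ b : ℝ → ℝ, ContDiff ℝ ∞ b ∧ ∀ n, iteratedDeriv n b 0 = a n := by
  let χ : ContDiffBump (0 : ℝ) := ⟨1, 2, one_pos, one_lt_two⟩
  let ψ : ℕ → ℝ → ℝ := fun n x => x ^ n * χ x
  have hψ : ∀ n, ContDiff ℝ ∞ (ψ n) := fun n => (contDiff_id.pow n).mul χ.contDiff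
  have hM : ∀ n k, ∃ M : ℝ, ∀ x, ‖iteratedFDeriv ℝ k (ψ n) x‖ ≤ M := fun n k =>
    (((hψ n).continuous_iteratedFDeriv (by exact_mod_cast le_top))).bounded_above_of_compact_support
      ((χ.hasCompactSupport.mul_left (f := fun x : ℝ => x ^ n)).iteratedFDeriv k)
  choose M hM using hM
  have hM0 : ∀ n k, 0 ≤ M n k := fun n k => (norm_nonneg _).trans (hM n k 0)
  let S : ℕ → ℝ := fun n => 1 + |a n| * ∑ k ∈ Finset.range n, M n k
  have hS : ∀ n, 1 ≤ S n := fun n => by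
    have : 0 ≤ |a n| * ∑ k ∈ Finset.range n, M n k :=
      mul_nonneg (abs_nonneg _) (Finset.sum_nonneg fun k _ => hM0 n k)
    simp only [S]; linarith
  -- the scale on which the `n`-th monomial is cut off
  let R : ℕ → ℝ := fun n => 2 ^ n * S n
  have hR : ∀ n, 1 ≤ R n := fun n => one_le_mul_of_one_le_of_one_le
    (one_le_pow₀ one_le_two) (hS n)
  let c : ℕ → ℝ := fun n => a n / n.factorial / R n ^ n
  let F : ℕ → ℝ → ℝ := fun n x => c n * ψ n (R n * x)
  have hF : ∀ n, ContDiff ℝ ∞ (F n) := fun n =>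
    contDiff_const.mul ((hψ n).comp (contDiff_const.mul contDiff_id))
  let v : ℕ → ℕ → ℝ := fun k n => |c n| * (R n ^ k * M n k)
  have hFv : ∀ k n x, ‖iteratedFDeriv ℝ k (F n) x‖ ≤ v k n := by
    intro k n x
    have hk : iteratedDeriv k (F n) x = c n * (R n ^ k * iteratedDeriv k (ψ n) (R n * x)) := by
      have h1 := iteratedDeriv_comp_const_mul (n := k) ((hψ n).of_le (by exact_mod_cast le_top)) (R n)
      simp only [F]
      rw [iteratedDeriv_const_mul_field, congrFun h1 x]
    rw [norm_iteratedFDeriv_eq_norm_iteratedDeriv, hk, norm_mul, norm_mul, norm_pow,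
      Real.norm_eq_abs, Real.norm_eq_abs, abs_of_pos (one_pos.trans_le (hR n))]
    have := hM n k (R n * x)
    rw [norm_iteratedFDeriv_eq_norm_iteratedDeriv] at this
    have := one_pos.trans_le (hR n)
    exact mul_le_mul_of_nonneg_left (mul_le_mul_of_nonneg_left ‹_› (by positivity))
      (abs_nonneg _)
  have hv : ∀ k, Summable (v k) := by
    intro k
    refine Summable.of_norm_bounded_eventually_nat (g := fun n => (1 / 2 : ℝ) ^ n)
      (summable_geometric_of_lt_one (by norm_num) (by norm_num)) ?_
    filter_upwards [eventually_gt_atTop k] with n hn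
    have hRn := one_pos.trans_le (hR n)
    have hSn := one_pos.trans_le (hS n)
    -- As `k < n`, the factor `R n ^ n` in the denominator of `c n` leaves one power of `R n` beyond
    -- the `k` lost in differentiating. This spare power absorbs the bound `M n k` and yields the
    -- factor `(1 / 2) ^ n`.
    have h1 : |c n| * R n ^ (k + 1) ≤ |a n| := by
      simp only [c, abs_div, abs_pow, abs_of_pos hRn, Nat.abs_cast]
      rw [div_mul_eq_mul_div, div_le_iff₀ (by positivity)]
      have : |a n| / n.factorial ≤ |a n| := div_le_self (abs_nonneg _)
        (by exact_mod_cast Nat.one_le_iff_ne_zero.2 n.factorial_ne_zero)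
      gcongr
      · exact hR n
      · exact hn
    have h2 : |a n| * M n k ≤ S n := by
      have : M n k ≤ ∑ k ∈ Finset.range n, M n k :=
        Finset.single_le_sum (f := M n) (fun k _ => hM0 n k) (Finset.mem_range.2 hn)
      have := mul_le_mul_of_nonneg_left this (abs_nonneg (a n))
      simp only [S]; linarith
    have h3 : v k n * R n ≤ S n := by
      calc v k n * R n = |c n| * R n ^ (k + 1) * M n k := by simp only [v]; ring
        _ ≤ |a n| * M n k := mul_le_mul_of_nonneg_right h1 (hM0 n k)
        _ ≤ S n := h2
    have h0 : 0 ≤ v k n := by have := hM0 n k; positivity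
    rw [Real.norm_of_nonneg h0, one_div, inv_pow, ← one_div, le_div_iff₀ (by positivity)]
    have : v k n * 2 ^ n * S n ≤ 1 * S n := by
      calc v k n * 2 ^ n * S n = v k n * R n := by simp only [R]; ring
        _ ≤ 1 * S n := by linarith
    exact le_of_mul_le_mul_right this hSn
  refine ⟨fun x => ∑' n, F n x, contDiff_tsum hF (fun k _ => hv k) fun k n x _ => hFv k n x, ?_⟩
  intro k
  have hk := iteratedFDeriv_tsum_apply (N := ⊤) hF (fun k _ => hv k)
    (fun k n x _ => hFv k n x) (k := k) (by exact_mod_cast le_top) 0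
  have hsum : Summable fun n => iteratedFDeriv ℝ k (F n) 0 :=
    Summable.of_norm_bounded (hv k) fun n => hFv k n 0
  rw [iteratedDeriv, hk, ContinuousMultilinearMap.tsum_eval hsum]
  change ∑' n, iteratedDeriv k (F n) 0 = a k
  have h0 : ∀ n, iteratedDeriv k (F n) 0 = if k = n then a n else 0 := by
    intro n
    have hRn := one_pos.trans_le (hR n)
    have : F n =ᶠ[𝓝 0] fun x => (a n / n.factorial) * x ^ n := by
      have hc : Tendsto (fun x => R n * x) (𝓝 0) (𝓝 0) := by
        have h : Continuous fun x => R n * x := by fun_prop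
        have h' := h.tendsto 0
        rwa [mul_zero] at h'
      filter_upwards [hc.eventually χ.eventuallyEq_one] with x hx
      simp only [F, ψ, c, hx, Pi.one_apply, mul_one, mul_pow]
      field_simp
    rw [this.iteratedDeriv_eq, iteratedDeriv_const_mul_pow_zero]
    split_ifs
    · field_simp
    · rfl
  simp only [h0]
  exact (tsum_congr fun n => by simp only [eq_comm]).trans (tsum_ite_eq k a)

/-! ### Smooth even functions -/

/-- The function vanishes to infinite order at the origin. -/
def IsFlatAtZero (r : ℝ → ℝ) : Prop := ContDiff ℝ ∞ r ∧ ∀ n, iteratedDeriv n r 0 = 0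

theorem IsFlatAtZero.exists_eq_mul {r : ℝ → ℝ} (hr : IsFlatAtZero r) :
    ∃ h, IsFlatAtZero h ∧ ∀ x, r x = x * h x := by
  obtain ⟨h, hh, hrh⟩ := exists_eq_add_sub_smul hr.1 0
  have h0 : r 0 = 0 := by simpa using hr.2 0
  have hrh' : r = fun s => (s - 0) * h s := funext fun s => by rw [hrh s, h0]; simp
  refine ⟨h, ⟨hh, fun n => ?_⟩, fun x => by simp [hrh x, h0]⟩
  have := hr.2 (n + 1)
  rw [hrh', iteratedDeriv_succ_sub_mul_self hh] at this
  have h1 : ((n : ℝ) + 1) ≠ 0 := by positivity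
  exact (mul_eq_zero.1 this).resolve_left h1

theorem IsFlatAtZero.deriv {r : ℝ → ℝ} (hr : IsFlatAtZero r) : IsFlatAtZero (_root_.deriv r) :=
  ⟨(contDiff_infty_iff_deriv.1 hr.1).2, fun n => by
    rw [← iteratedDeriv_succ']; exact hr.2 (n + 1)⟩

open Classical in
/-- The function `x ↦ r (√x)` for `x > 0`, extended by zero. -/
def flatSqrt (r : ℝ → ℝ) (x : ℝ) : ℝ := if 0 < x then r (√x) else 0

/-- By the chain rule the derivative is r'(√x)/(2√x) = r₁(√x)/2, and r₁ is flat again, so induction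
gives smoothness. At the origin, `r` is divided twice by `x`, so that `flatSqrt r` is `x` times a
continuous function vanishing there. -/
theorem IsFlatAtZero.hasDerivAt_flatSqrt {r r₁ : ℝ → ℝ} (hr : IsFlatAtZero r)
    (hr₁ : ∀ x, _root_.deriv r x = x * r₁ x) (x : ℝ) :
    HasDerivAt (flatSqrt r) (flatSqrt r₁ x / 2) x := by
  rcases lt_trichotomy x 0 with hx | rfl | hx
  · have : flatSqrt r =ᶠ[𝓝 x] fun _ => 0 := by
      filter_upwards [Iio_mem_nhds hx] with y hy
      simp [flatSqrt, not_lt.2 (le_of_lt (mem_Iio.1 hy))]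
    simpa [flatSqrt, not_lt.2 hx.le] using (hasDerivAt_const x (0 : ℝ)).congr_of_eventuallyEq this
  · obtain ⟨h₁, hh₁, e₁⟩ := hr.exists_eq_mul
    obtain ⟨h₂, hh₂, e₂⟩ := hh₁.exists_eq_mul
    obtain ⟨h₃, hh₃, e₃⟩ := hh₂.exists_eq_mul
    have e : flatSqrt r = fun x => x * flatSqrt h₂ x := by
      funext x
      by_cases hx : 0 < x
      · have := Real.mul_self_sqrt hx.le
        simp only [flatSqrt, hx, if_true, e₁, e₂]
        rw [← mul_assoc, this]
      · simp [flatSqrt, hx]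
    have hc : ContinuousAt (flatSqrt h₂) 0 := by
      have h0 : flatSqrt h₂ 0 = 0 := by simp [flatSqrt]
      rw [ContinuousAt, h0]
      refine squeeze_zero_norm (a := fun x => ‖h₂ (√x)‖) (fun x => ?_) ?_
      · unfold flatSqrt; split_ifs <;> simp
      · have : Continuous fun x => ‖h₂ (√x)‖ := (hh₂.1.continuous.comp Real.continuous_sqrt).norm
        simpa [show h₂ 0 = 0 by simpa using hh₂.2 0] using this.tendsto 0
    have h0 : flatSqrt h₂ 0 = 0 := by simp [flatSqrt]
    rw [hasDerivAt_iff_tendsto_slope, e]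
    have : flatSqrt r₁ 0 / 2 = flatSqrt h₂ 0 := by simp [flatSqrt]
    rw [this]
    refine (hc.tendsto.mono_left nhdsWithin_le_nhds).congr' ?_
    filter_upwards [self_mem_nhdsWithin] with x hx
    simp [slope_def_field]
    field_simp [show x ≠ 0 from hx]
  · have h1 : flatSqrt r =ᶠ[𝓝 x] fun y => r (√y) := by
      filter_upwards [Ioi_mem_nhds hx] with y hy
      simp [flatSqrt, mem_Ioi.1 hy]
    have h2 := ((hr.1.differentiable (by simp) (√x)).hasDerivAt.comp x
      (Real.hasDerivAt_sqrt hx.ne')).congr_of_eventuallyEq h1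
    refine h2.congr_deriv ?_
    have := Real.sqrt_pos.2 hx
    simp only [flatSqrt, hx, if_true, hr₁]
    field_simp

theorem IsFlatAtZero.contDiff_flatSqrt {r : ℝ → ℝ} (hr : IsFlatAtZero r) :
    ContDiff ℝ ∞ (flatSqrt r) := by
  rw [contDiff_infty]
  intro k
  induction k generalizing r with
  | zero =>
    obtain ⟨r₁, -, e⟩ := hr.deriv.exists_eq_mul
    exact contDiff_zero.2 (continuous_iff_continuousAt.2 fun s =>
      (hr.hasDerivAt_flatSqrt e s).continuousAt)
  | succ k ih =>
    obtain ⟨r₁, hr₁, e⟩ := hr.deriv.exists_eq_mul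
    rw [show ((k + 1 : ℕ) : WithTop ℕ∞) = k + 1 from by norm_cast, contDiff_succ_iff_deriv]
    refine ⟨fun s => (hr.hasDerivAt_flatSqrt e s).differentiableAt, by simp, ?_⟩
    rw [show _root_.deriv (flatSqrt r) = fun x => flatSqrt r₁ x / 2 from
      funext fun x => (hr.hasDerivAt_flatSqrt e x).deriv]
    exact (ih hr₁).div_const 2

/-- The derivative of an even function is odd, hence `u` times an even function. The map g ↦ g₁ is
differentiation with respect to u². -/
theorem exists_even_deriv_eq {g : ℝ → ℝ} (hg : ContDiff ℝ ∞ g) (he : ∀ u, g (-u) = g u) :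
    ∃ g₁ : ℝ → ℝ, (ContDiff ℝ ∞ g₁ ∧ ∀ u, g₁ (-u) = g₁ u) ∧ ∀ u, deriv g u = 2 * u * g₁ u := by
  have hodd : ∀ u, deriv g (-u) = - deriv g u := fun u => by
    have h1 : deriv (fun x => g (-x)) u = - deriv g (-u) := deriv_comp_neg g u
    rw [show (fun x => g (-x)) = g from funext he] at h1
    rw [h1, neg_neg]
  obtain ⟨h, hh, e⟩ := exists_eq_add_sub_smul (contDiff_infty_iff_deriv.1 hg).2 0
  have h0 : deriv g 0 = 0 := by
    have := hodd 0
    rw [neg_zero] at this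
    linarith
  simp only [h0, zero_add, sub_zero, smul_eq_mul] at e
  refine ⟨fun u => h u / 2, ⟨hh.div_const 2, ?_⟩, fun u => by rw [e u]; ring⟩
  have hc1 : Continuous fun u => h (-u) / 2 := (hh.continuous.comp continuous_neg).div_const 2
  have hc2 : Continuous fun u => h u / 2 := hh.continuous.div_const 2
  have hd : Dense ({0}ᶜ : Set ℝ) := dense_compl_singleton 0
  refine congrFun (Continuous.ext_on hd hc1 hc2 fun u hu => ?_)
  have := hodd u
  rw [e, e] at this
  have hu' : u ≠ 0 := hu
  have : u * h (-u) = u * h u := by linarith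
  simp only [mul_left_cancel₀ hu' this]

/-- A smooth even function is a smooth function of the square. -/
theorem exists_eq_comp_sq {g : ℝ → ℝ} (hg : ContDiff ℝ ∞ g) (he : ∀ u, g (-u) = g u) :
    ∃ h : ℝ → ℝ, ContDiff ℝ ∞ h ∧ ∀ u, g u = h (u ^ 2) := by
  choose! T hT hT' using fun (p : {g : ℝ → ℝ // ContDiff ℝ ∞ g ∧ ∀ u, g (-u) = g u}) =>
    exists_even_deriv_eq p.2.1 p.2.2
  let D : {g : ℝ → ℝ // ContDiff ℝ ∞ g ∧ ∀ u, g (-u) = g u} →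
    {g : ℝ → ℝ // ContDiff ℝ ∞ g ∧ ∀ u, g (-u) = g u} := fun p => ⟨T p, hT p⟩
  -- If g(u) = h(u²), then `D^[n] g` at 0 is the n-th derivative of h at 0. Borel's lemma supplies a
  -- function with these derivatives, correct up to a flat error.
  obtain ⟨b, hb, hbD⟩ := exists_contDiff_iteratedDeriv_eq fun n => (D^[n] ⟨g, hg, he⟩).1 0
  -- One differentiation brings out a factor `u`, and the remaining factor is the same difference
  -- for `D p` and `deriv b`. Since the factor `u` costs a further derivative at 0, order n + 2
  -- reduces to order n, whence the strong induction.
  have key : ∀ (n : ℕ) (p : {g : ℝ → ℝ // ContDiff ℝ ∞ g ∧ ∀ u, g (-u) = g u}) (b : ℝ → ℝ),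
      ContDiff ℝ ∞ b → (∀ n, iteratedDeriv n b 0 = (D^[n] p).1 0) →
      iteratedDeriv n (fun u => p.1 u - b (u ^ 2)) 0 = 0 := by
    intro n
    induction n using Nat.strong_induction_on with
    | _ n ih =>
      intro p b hb hbp
      obtain _ | n := n
      · simpa [sub_eq_zero] using (hbp 0).symm
      · have hder : deriv (fun u => p.1 u - b (u ^ 2)) =
            fun u => (u - 0) * (2 * ((D p).1 u - deriv b (u ^ 2))) := by
          funext u
          have h1 := (p.2.1.differentiable (by simp) u).hasDerivAt
          have h2 := (hb.differentiable (by simp) (u ^ 2)).hasDerivAt.comp u (hasDerivAt_pow 2 u)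
          refine (h1.sub h2).deriv.trans ?_
          rw [hT' p u]
          simp [D]
          ring
        have hb' := (contDiff_infty_iff_deriv.1 hb).2
        rw [iteratedDeriv_succ', hder]
        obtain _ | n := n
        · simp
        · have hR : ContDiff ℝ ∞ fun u => 2 * ((D p).1 u - deriv b (u ^ 2)) :=
            contDiff_const.mul ((D p).2.1.sub (hb'.comp (contDiff_id.pow 2)))
          rw [iteratedDeriv_succ_sub_mul_self hR,
            iteratedDeriv_const_mul_field, ih n (by omega) (D p) _ hb']
          · simp
          · intro m
            rw [← iteratedDeriv_succ', hbp (m + 1), Function.iterate_succ_apply]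
  have hr : IsFlatAtZero fun u => g u - b (u ^ 2) :=
    ⟨hg.sub (hb.comp (contDiff_id.pow 2)), fun n => key n ⟨g, hg, he⟩ b hb hbD⟩
  refine ⟨fun x => b x + flatSqrt (fun u => g u - b (u ^ 2)) x, hb.add hr.contDiff_flatSqrt, ?_⟩
  intro u
  by_cases hu : 0 < u ^ 2
  · have : g (√(u ^ 2)) = g u := by
      rw [Real.sqrt_sq_eq_abs]
      rcases abs_choice u with h | h <;> rw [h]
      exact he u
    simp [flatSqrt, hu, this, Real.sq_sqrt hu.le]
  · have hu0 : u = 0 := by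
      by_contra h
      exact hu (by positivity)
    have := hr.2 0
    simp [flatSqrt, hu0] at this ⊢
    linarith

/-! ### Calculus in the plane -/

/-- The Euclidean inner product in coordinates. -/
def dot2 (v w : Plane) : ℝ := v 0 * w 0 + v 1 * w 1

theorem norm_sq_eq_dot2 (v : Plane) : ‖v‖ ^ 2 = dot2 v v := by
  rw [EuclideanSpace.norm_sq_eq, Fin.sum_univ_two]
  simp [dot2, sq]

@[simp] theorem rot90_apply_zero (v : Plane) : rot90 v 0 = -v 1 := rfl

@[simp] theorem rot90_apply_one (v : Plane) : rot90 v 1 = v 0 := rfl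

theorem plane_ext {v w : Plane} (h0 : v 0 = w 0) (h1 : v 1 = w 1) : v = w := by
  ext i; fin_cases i <;> assumption

theorem dot2_self_pos {v : Plane} (hv : v ≠ 0) : 0 < dot2 v v := by
  rw [← norm_sq_eq_dot2]; positivity

theorem dot2_self_ne_zero {v : Plane} (hv : v ≠ 0) : dot2 v v ≠ 0 := (dot2_self_pos hv).ne'

theorem exists_eq_smul_of_det2_eq_zero {v w : Plane} (hv : v ≠ 0) (h : det2 v w = 0) :
    ∃ k : ℝ, w = k • v := by
  have hq := dot2_self_ne_zero hv
  refine ⟨dot2 v w / dot2 v v, plane_ext ?_ ?_⟩ <;>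
    simp only [PiLp.smul_apply, smul_eq_mul, dot2, det2] at * <;>
    rw [div_mul_eq_mul_div, eq_div_iff hq]
  · linear_combination (-v 1) * h
  · linear_combination (v 0) * h

@[simp] theorem det2_self (v : Plane) : det2 v v = 0 := by simp [det2]; ring

theorem det2_smul_left (c : ℝ) (v w : Plane) : det2 (c • v) w = c * det2 v w := by
  simp [det2]; ring

theorem det2_smul_right (c : ℝ) (v w : Plane) : det2 v (c • w) = c * det2 v w := by
  simp [det2]; ring

theorem det2_add_right (v w x : Plane) : det2 v (w + x) = det2 v w + det2 v x := by
  simp [det2]; ring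

theorem dot2_smul_right (c : ℝ) (v w : Plane) : dot2 v (c • w) = c * dot2 v w := by
  simp [dot2]; ring

theorem _root_.HasDerivAt.plane_apply {f : ℝ → Plane} {f' : Plane} {t : ℝ} (h : HasDerivAt f f' t)
    (i : Fin 2) : HasDerivAt (fun s => f s i) (f' i) t :=
  (EuclideanSpace.proj (𝕜 := ℝ) i).hasFDerivAt.comp_hasDerivAt t h

theorem _root_.HasDerivAt.of_plane_apply {f : ℝ → Plane} {f' : Plane} {t : ℝ}
    (h0 : HasDerivAt (fun s => f s 0) (f' 0) t) (h1 : HasDerivAt (fun s => f s 1) (f' 1) t) :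
    HasDerivAt f f' t := by
  rw [hasDerivAt_iff_hasFDerivAt, ← hasFDerivWithinAt_univ, hasFDerivWithinAt_euclidean]
  intro i
  rw [hasFDerivWithinAt_univ]
  fin_cases i
  · exact h0.hasFDerivAt.congr_fderiv (by ext; simp)
  · exact h1.hasFDerivAt.congr_fderiv (by ext; simp)

theorem _root_.HasDerivAt.det2 {v w : ℝ → Plane} {v' w' : Plane} {t : ℝ} (hv : HasDerivAt v v' t)
    (hw : HasDerivAt w w' t) :
    HasDerivAt (fun s => Evolutoid.det2 (v s) (w s)) (Evolutoid.det2 v' (w t) + Evolutoid.det2 (v t) w') t := by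
  refine (((hv.plane_apply 0).mul (hw.plane_apply 1)).sub ((hv.plane_apply 1).mul (hw.plane_apply 0))).congr_deriv ?_
  simp only [Evolutoid.det2]; ring

theorem _root_.HasDerivAt.dot2 {v w : ℝ → Plane} {v' w' : Plane} {t : ℝ} (hv : HasDerivAt v v' t)
    (hw : HasDerivAt w w' t) :
    HasDerivAt (fun s => Evolutoid.dot2 (v s) (w s)) (Evolutoid.dot2 v' (w t) + Evolutoid.dot2 (v t) w') t := by
  refine (((hv.plane_apply 0).mul (hw.plane_apply 0)).add ((hv.plane_apply 1).mul (hw.plane_apply 1))).congr_deriv ?_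
  simp only [Evolutoid.dot2]; ring

theorem _root_.HasDerivAt.rot90 {v : ℝ → Plane} {v' : Plane} {t : ℝ} (hv : HasDerivAt v v' t) :
    HasDerivAt (fun s => Evolutoid.rot90 (v s)) (Evolutoid.rot90 v') t :=
  HasDerivAt.of_plane_apply (hv.plane_apply 1).neg (hv.plane_apply 0)

section

variable {X : Type*} [NormedAddCommGroup X] [NormedSpace ℝ X] {n : WithTop ℕ∞} {v w : X → Plane}

theorem _root_.ContDiff.plane_apply (hv : ContDiff ℝ n v) (i : Fin 2) : ContDiff ℝ n fun s => v s i :=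
  (EuclideanSpace.proj (𝕜 := ℝ) i).contDiff.comp hv

theorem _root_.ContDiff.det2 (hv : ContDiff ℝ n v) (hw : ContDiff ℝ n w) :
    ContDiff ℝ n fun s => Evolutoid.det2 (v s) (w s) :=
  ((hv.plane_apply 0).mul (hw.plane_apply 1)).sub
    ((hv.plane_apply 1).mul (hw.plane_apply 0))

theorem _root_.ContDiff.dot2 (hv : ContDiff ℝ n v) (hw : ContDiff ℝ n w) :
    ContDiff ℝ n fun s => Evolutoid.dot2 (v s) (w s) :=
  ((hv.plane_apply 0).mul (hw.plane_apply 0)).add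
    ((hv.plane_apply 1).mul (hw.plane_apply 1))

theorem _root_.ContDiff.rot90 (hv : ContDiff ℝ n v) : ContDiff ℝ n fun s => Evolutoid.rot90 (v s) := by
  rw [contDiff_euclidean]
  intro i
  fin_cases i
  · exact (hv.plane_apply 1).neg
  · exact hv.plane_apply 0

end

/-- The factor cancels off `t`, and continuity fills in the value at `t`. -/
theorem eventuallyEq_of_sub_mul_eq {F G : ℝ → ℝ} {t : ℝ}
    (h : ∀ᶠ s in 𝓝 t, (s - t) * F s = (s - t) * G s) (hF : ContinuousAt F t)
    (hG : ContinuousAt G t) : F =ᶠ[𝓝 t] G := by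
  have h1 : F =ᶠ[𝓝[≠] t] G := by
    filter_upwards [h.filter_mono nhdsWithin_le_nhds, self_mem_nhdsWithin] with s hs hst
    exact mul_left_cancel₀ (sub_ne_zero.2 hst) hs
  have h2 : F t = G t := tendsto_nhds_unique
    ((hF.tendsto.mono_left nhdsWithin_le_nhds).congr' h1) (hG.tendsto.mono_left nhdsWithin_le_nhds)
  rw [EventuallyEq, eventually_nhdsWithin_iff] at h1
  filter_upwards [h1] with s hs
  by_cases hst : s = t
  · rw [hst, h2]
  · exact hs hst

/-! ### Local diffeomorphisms -/

/-- The inverse function theorem for smooth maps. -/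
theorem isLocalDiffeomorphAt_of_hasFDerivAt {E F : Type*} [NormedAddCommGroup E] [NormedSpace ℝ E]
    [CompleteSpace E] [NormedAddCommGroup F] [NormedSpace ℝ F] {f : E → F} {s : Set E} {x : E}
    (hs : IsOpen s) (hx : x ∈ s) (hf : ContDiffOn ℝ ∞ f s) {f' : E ≃L[ℝ] F}
    (h : HasFDerivAt f (f' : E →L[ℝ] F) x) : IsLocalDiffeomorphAt 𝓘(ℝ, E) 𝓘(ℝ, F) ∞ f x := by
  have hfx : ContDiffAt ℝ ∞ f x := hf.contDiffAt (hs.mem_nhds hx)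
  -- The inverse is smooth at the image of each point with invertible derivative. Restricting to the
  -- open set of such points makes it smooth on its whole domain, as a partial diffeomorphism
  -- requires.
  let U : Set E := s ∩ fderiv ℝ f ⁻¹' range ((↑) : (E ≃L[ℝ] F) → E →L[ℝ] F)
  have hU : IsOpen U := (hf.continuousOn_fderiv_of_isOpen hs (by simp)).isOpen_inter_preimage hs
    ContinuousLinearEquiv.isOpen
  have hxU : x ∈ U := ⟨hx, f', h.fderiv.symm⟩
  let e := (hfx.toOpenPartialHomeomorph f h (by simp)).restrOpen U hU
  have he : ∀ y, e y = f y := fun y => rfl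
  have hsU : e.source ⊆ U := fun y hy => hy.2
  refine ⟨⟨e.toPartialEquiv, e.open_source, e.open_target, ?_, ?_⟩, ?_, fun y _ => rfl⟩
  · rw [contMDiffOn_iff_contDiffOn]
    exact hf.mono fun y hy => (hsU hy).1
  · rw [contMDiffOn_iff_contDiffOn]
    intro y hy
    have hy' := hsU (e.map_target hy)
    obtain ⟨g', hg'⟩ := hy'.2
    have hfy := hf.contDiffAt (hs.mem_nhds hy'.1)
    refine (e.contDiffAt_symm (f₀' := g') hy ?_ hfy).contDiffWithinAt
    rw [hg']
    exact (hfy.differentiableAt (by simp)).hasFDerivAt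
  · exact ⟨hfx.mem_toOpenPartialHomeomorph_source h (by simp), hxU⟩

/-! ### Recognition of cusps -/

/-- Near `t` the velocity is `ℓ • g`, where `ℓ` has a simple zero at `t` and where the direction `g`
turns with nonzero speed at `t`. -/
def HasCuspForm (γ : ℝ → Plane) (t : ℝ) : Prop :=
  ∃ (l : ℝ → ℝ) (g : ℝ → Plane), ContDiff ℝ ∞ l ∧ ContDiff ℝ ∞ g ∧
    (∀ᶠ s in 𝓝 t, HasDerivAt γ (l s • g s) s) ∧ l t = 0 ∧ deriv l t ≠ 0 ∧
    det2 (g t) (deriv g t) ≠ 0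

theorem hasDerivAt_semicubical (u : ℝ) :
    HasDerivAt (fun u : ℝ => (!₂[u ^ 2, u ^ 3] : Plane)) (u • !₂[2, 3 * u]) u := by
  refine HasDerivAt.of_plane_apply ?_ ?_
  · refine (hasDerivAt_pow 2 u).congr_deriv ?_
    simp; ring
  · refine (hasDerivAt_pow 3 u).congr_deriv ?_
    simp; ring

theorem contDiff_semicubical : ContDiff ℝ ∞ (fun u : ℝ => (!₂[u ^ 2, u ^ 3] : Plane)) := by
  rw [contDiff_euclidean]
  intro i
  fin_cases i
  · exact contDiff_id.pow 2
  · exact contDiff_id.pow 3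

theorem det2_map_ne_zero {L : Plane →L[ℝ] Plane} (hL : Function.Injective L) {v w : Plane}
    (h : det2 v w ≠ 0) : det2 (L v) (L w) ≠ 0 := by
  intro h0
  have hv : v ≠ 0 := by rintro rfl; simp [det2] at h
  have hLv : L v ≠ 0 := fun h1 => hv (hL (by rw [h1, map_zero]))
  obtain ⟨k, hk⟩ := exists_eq_smul_of_det2_eq_zero hLv h0
  have : w = k • v := hL (by rw [hk, map_smul])
  rw [this, det2_smul_right, det2_self, mul_zero] at h
  exact h rfl

/-- With local inverses ψ of φ and Ψ of Φ and the model c(u) = (u², u³), the germ of γ is Ψ ∘ c ∘ ψ.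
Since c'(u) = u (2, 3u), its velocity is ψψ' times DΨ(c(ψ))(2, 3ψ). The scalar has derivative ψ'(t)²
≠ 0 at t. -/
theorem IsCusp.hasCuspForm {γ : ℝ → Plane} {t : ℝ} (h : IsCusp γ t) (hγ : ContinuousAt γ t) :
    HasCuspForm γ t := by
  obtain ⟨φ, Φ, ⟨a, ha0, haφ⟩, hφ0, ⟨b, hb0, hbΦ⟩, hev⟩ := h
  set ψ : ℝ → ℝ := a.invFun with hψdef
  set Ψ : Plane → Plane := b.invFun with hΨdef
  have hψ : ContDiffOn ℝ ∞ ψ a.target := contMDiffOn_iff_contDiffOn.1 a.contMDiffOn_invFun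
  have hΨ : ContDiffOn ℝ ∞ Ψ b.target := contMDiffOn_iff_contDiffOn.1 b.contMDiffOn_invFun
  have ha : ContDiffOn ℝ ∞ a.toFun a.source := contMDiffOn_iff_contDiffOn.1 a.contMDiffOn_toFun
  have hb : ContDiffOn ℝ ∞ b.toFun b.source := contMDiffOn_iff_contDiffOn.1 b.contMDiffOn_toFun
  have hat : a.toFun 0 = t := by rw [← hφ0]; exact (haφ ha0).symm
  have htT : t ∈ a.target := by rw [← hat]; exact a.map_source ha0
  have hψt : ψ t = 0 := by rw [← hat]; exact a.left_inv ha0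
  let c : ℝ → Plane := fun u => !₂[u ^ 2, u ^ 3]
  have hbt : b.toFun (γ t) = c 0 := by
    have := hev.self_of_nhds
    rw [hφ0] at this
    rw [← show Φ (γ t) = b.toFun (γ t) from hbΦ hb0, this]
  have h0T : c 0 ∈ b.target := by rw [← hbt]; exact b.map_source hb0
  have hΨ0 : Ψ (c 0) = γ t := by rw [← hbt]; exact b.left_inv hb0
  have hψc : ContinuousAt ψ t := (hψ.continuousOn.continuousAt (a.open_target.mem_nhds htT))
  -- the open set on which everything is smooth
  have hcψ : ContDiffOn ℝ ∞ (fun s => c (ψ s)) a.target := contDiff_semicubical.comp_contDiffOn hψ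
  let S : Set ℝ := a.target ∩ (fun s => c (ψ s)) ⁻¹' b.target
  have hS : IsOpen S := hcψ.continuousOn.isOpen_inter_preimage a.open_target b.open_target
  have htS : t ∈ S := ⟨htT, by simpa only [mem_preimage, hψt] using h0T⟩
  have heq : γ =ᶠ[𝓝 t] fun s => Ψ (c (ψ s)) := by
    have h1 : ∀ᶠ s in 𝓝 t, Φ (γ (φ (ψ s))) = c (ψ s) :=
      (by simpa only [hψt] using hψc.tendsto : Tendsto ψ (𝓝 t) (𝓝 0)).eventually hev
    filter_upwards [h1, a.open_target.mem_nhds htT, hγ.eventually (b.open_source.mem_nhds hb0)]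
      with s hs hsT hsb
    rw [show φ (ψ s) = s from (haφ (a.map_target hsT)).trans (a.right_inv hsT)] at hs
    rw [← hs, hbΦ hsb]
    exact (b.left_inv hsb).symm
  have hdψ : ContDiffOn ℝ ∞ (deriv ψ) a.target :=
    ((contDiffOn_infty_iff_deriv_of_isOpen a.open_target).1 hψ).2
  have hdΨ : ContDiffOn ℝ ∞ (fderiv ℝ Ψ) b.target :=
    hΨ.fderiv_of_isOpen b.open_target (by simp)
  have hL : ContDiffOn ℝ ∞ (fun s => fderiv ℝ Ψ (c (ψ s))) S :=
    hdΨ.comp (hcψ.mono inter_subset_left) fun s hs => hs.2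
  let w : ℝ → Plane := fun u => !₂[2, 3 * u]
  have hw' : ∀ u, HasDerivAt w !₂[0, 3] u := fun u => by
    refine HasDerivAt.of_plane_apply (hasDerivAt_const u 2) ?_
    exact ((hasDerivAt_id u).const_mul (3 : ℝ)).congr_deriv (mul_one 3)
  have hw : ContDiff ℝ ∞ w := by
    rw [contDiff_euclidean]
    intro i
    fin_cases i
    · exact contDiff_const
    · exact contDiff_const.mul contDiff_id
  have hl0 : ContDiffOn ℝ ∞ (fun s => ψ s * deriv ψ s) S := (hψ.mul hdψ).mono inter_subset_left
  have hg0 : ContDiffOn ℝ ∞ (fun s => fderiv ℝ Ψ (c (ψ s)) (w (ψ s))) S :=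
    hL.clm_apply (hw.comp_contDiffOn (hψ.mono inter_subset_left))
  obtain ⟨l, hl, hle⟩ := exists_contDiff_eventuallyEq hS htS hl0
  obtain ⟨g, hg, hge⟩ := exists_contDiff_eventuallyEq hS htS hg0
  have hψd : ∀ s ∈ a.target, HasDerivAt ψ (deriv ψ s) s := fun s hs =>
    ((hψ.contDiffAt (a.open_target.mem_nhds hs)).differentiableAt (by simp)).hasDerivAt
  have hcd : ∀ s ∈ a.target, HasDerivAt (fun s => c (ψ s)) ((ψ s * deriv ψ s) • w (ψ s)) s :=
    fun s hs => by
      refine ((hasDerivAt_semicubical (ψ s)).scomp s (hψd s hs)).congr_deriv ?_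
      rw [smul_smul, mul_comm]
  have hψ' : deriv ψ t ≠ 0 := by
    intro h0
    have h1 : HasDerivAt a.toFun (deriv a.toFun 0) (ψ t) := by
      rw [hψt]
      exact ((ha.contDiffAt (a.open_source.mem_nhds ha0)).differentiableAt (by simp)).hasDerivAt
    have h2 := h1.comp t (hψd t htT)
    have h3 : a.toFun ∘ ψ =ᶠ[𝓝 t] id := by
      filter_upwards [a.open_target.mem_nhds htT] with s hs
      exact a.right_inv hs
    have h4 := h2.unique ((hasDerivAt_id t).congr_of_eventuallyEq h3)
    simp [h0] at h4
  have hinj : Function.Injective (fderiv ℝ Ψ (c 0)) := by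
    have h1 : HasFDerivAt b.toFun (fderiv ℝ b.toFun (γ t)) (Ψ (c 0)) := by
      rw [hΨ0]
      exact ((hb.contDiffAt (b.open_source.mem_nhds hb0)).differentiableAt (by simp)).hasFDerivAt
    have h2 := h1.comp (c 0)
      ((hΨ.contDiffAt (b.open_target.mem_nhds h0T)).differentiableAt (by simp)).hasFDerivAt
    have h3 : b.toFun ∘ Ψ =ᶠ[𝓝 (c 0)] id := by
      filter_upwards [b.open_target.mem_nhds h0T] with s hs
      exact b.right_inv hs
    have h4 := h2.unique ((hasFDerivAt_id (c 0)).congr_of_eventuallyEq h3)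
    exact Function.LeftInverse.injective (g := fderiv ℝ b.toFun (γ t))
      fun x => congrArg (fun L : Plane →L[ℝ] Plane => L x) h4
  refine ⟨l, g, hl, hg, ?_, ?_, ?_, ?_⟩
  · filter_upwards [hS.mem_nhds htS, heq.eventuallyEq_nhds, hle, hge] with s hs hes hls hgs
    have h1 := ((hΨ.contDiffAt (b.open_target.mem_nhds hs.2)).differentiableAt
      (by simp)).hasFDerivAt.comp_hasDerivAt s (hcd s hs.1)
    refine (h1.congr_of_eventuallyEq hes).congr_deriv ?_
    rw [hls, hgs, map_smul]
  · rw [hle.eq_of_nhds, hψt, zero_mul]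
  · have h1 : HasDerivAt (fun s => ψ s * deriv ψ s) _ t := (hψd t htT).mul
      ((hdψ.contDiffAt (a.open_target.mem_nhds htT)).differentiableAt (by simp)).hasDerivAt
    rw [hle.deriv_eq, h1.deriv, hψt, zero_mul, add_zero]
    exact mul_ne_zero hψ' hψ'
  -- The curve c ∘ ψ has zero velocity at `t`, so DΨ is stationary along it. Only the vector (2, 3ψ)
  -- turns to first order, and the injective linear map keeps the two vectors independent.
  · have h1 : HasDerivAt (fun s => fderiv ℝ Ψ (c (ψ s))) 0 t := by
      have h2 : HasFDerivAt (fderiv ℝ Ψ) (fderiv ℝ (fderiv ℝ Ψ) (c (ψ t))) (c (ψ t)) := by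
        rw [hψt]
        exact ((hdΨ.contDiffAt (b.open_target.mem_nhds h0T)).differentiableAt
          (by simp)).hasFDerivAt
      refine (h2.comp_hasDerivAt t (hcd t htT)).congr_deriv ?_
      rw [hψt, zero_mul, zero_smul, map_zero]
    have h2 : HasDerivAt (fun s => fderiv ℝ Ψ (c (ψ s)) (w (ψ s))) _ t :=
      h1.clm_apply ((hw' (ψ t)).scomp t (hψd t htT))
    rw [hge.deriv_eq, hge.eq_of_nhds, h2.deriv, hψt]
    simp only [zero_apply, zero_add]
    apply det2_map_ne_zero hinj
    rw [det2_smul_right]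
    refine mul_ne_zero hψ' ?_
    simp [det2, w]

theorem IsCusp.congr {γ γ' : ℝ → Plane} {t : ℝ} (h : IsCusp γ t) (e : γ =ᶠ[𝓝 t] γ') :
    IsCusp γ' t := by
  obtain ⟨φ, Φ, hφ, hφ0, hΦ, hev⟩ := h
  refine ⟨φ, Φ, hφ, hφ0, by rwa [← e.eq_of_nhds], ?_⟩
  have hc : Tendsto φ (𝓝 0) (𝓝 t) := by
    rw [← hφ0]
    exact (contMDiffAt_iff_contDiffAt.1 hφ.contMDiffAt).continuousAt
  filter_upwards [hev, hc.eventually e] with u hu hu'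
  rw [← hu', hu]


theorem hasDerivAt_sub_mul_of_continuousAt {R : ℝ → ℝ} {t : ℝ} (hR : ContinuousAt R t) :
    HasDerivAt (fun s => (s - t) * R s) (R t) t := by
  rw [hasDerivAt_iff_tendsto_slope]
  refine (hR.tendsto.mono_left nhdsWithin_le_nhds).congr' ?_
  filter_upwards [self_mem_nhdsWithin] with s hs
  have : s - t ≠ 0 := sub_ne_zero.2 hs
  simp [slope_def_field]
  field_simp

/-- In coordinates X along e = G(t) and Z across it, X has a nondegenerate minimum at t, so X = u²
for a new parameter u. Splitting Z into even and odd parts in u gives Z = A(u²) + u³ B(u²). The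
determinant condition amounts to B(0) ≠ 0, and then a shear and a rescaling of Z turn the curve into
(u², u³). -/
theorem isCusp_of_hasDerivAt_sub_smul {γ G : ℝ → Plane} {t : ℝ} (hγ : ContDiff ℝ ∞ γ)
    (hG : ContDiff ℝ ∞ G) (hd : ∀ᶠ s in 𝓝 t, HasDerivAt γ ((s - t) • G s) s)
    (hdet : det2 (G t) (deriv G t) ≠ 0) : IsCusp γ t := by
  set e : Plane := G t with he
  have he0 : e ≠ 0 := fun h => hdet (by rw [h]; simp [det2])
  have hq := dot2_self_pos he0
  have hec : ∀ {n : WithTop ℕ∞}, ContDiff ℝ n fun _ : ℝ => e := contDiff_const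
  have hγt : ContDiff ℝ ∞ fun s => γ s - γ t := hγ.sub contDiff_const
  -- coordinates along and across the cuspidal tangent
  set X : ℝ → ℝ := fun s => dot2 e (γ s - γ t) with hX
  set Z : ℝ → ℝ := fun s => det2 e (γ s - γ t) with hZ
  have hXc : ContDiff ℝ ∞ X := hec.dot2 hγt
  have hZc : ContDiff ℝ ∞ Z := hec.det2 hγt
  have hX' : ∀ᶠ s in 𝓝 t, HasDerivAt X ((s - t) * dot2 e (G s)) s := hd.mono fun s hs =>
    ((hasDerivAt_const s e).dot2 (hs.sub_const (γ t))).congr_deriv (by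
      rw [dot2_smul_right]; simp [dot2])
  have hZ' : ∀ᶠ s in 𝓝 t, HasDerivAt Z ((s - t) * det2 e (G s)) s := hd.mono fun s hs =>
    ((hasDerivAt_const s e).det2 (hs.sub_const (γ t))).congr_deriv (by
      rw [det2_smul_right]; simp [det2])
  have hX0 : X t = 0 := by simp [X, dot2]
  have hZ0 : Z t = 0 := by simp [Z, det2]
  obtain ⟨a₁, ha₁, e₁⟩ := exists_eq_add_sub_smul hXc t
  have ha₁d : ∀ s, HasDerivAt a₁ (deriv a₁ s) s := fun s =>
    (ha₁.differentiable (by simp) s).hasDerivAt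
  have ha₁t : a₁ t = 0 := by
    have h1 : HasDerivAt X (a₁ t) t := by
      have h2 := (((hasDerivAt_id t).sub_const t).mul (ha₁d t)).const_add (X t)
      rw [show X = fun s => X t + (s - t) • a₁ s from funext e₁]
      refine h2.congr_deriv ?_
      simp
    rw [h1.unique hX'.self_of_nhds, sub_self, zero_mul]
  obtain ⟨a, ha, e₂⟩ := exists_eq_add_sub_smul ha₁ t
  have had : ∀ s, HasDerivAt a (deriv a s) s := fun s =>
    (ha.differentiable (by simp) s).hasDerivAt
  have hXa : ∀ s, X s = (s - t) ^ 2 * a s := fun s => by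
    rw [e₁, e₂, hX0, ha₁t]; simp; ring
  have hat : 2 * a t = dot2 e e := by
    have h1 : (fun s => 2 * a s + (s - t) * deriv a s) =ᶠ[𝓝 t] fun s => dot2 e (G s) := by
      refine eventuallyEq_of_sub_mul_eq (hX'.mono fun s hs => ?_) ?_ ?_
      · have h2 := ((((hasDerivAt_id s).sub_const t).pow 2).mul (had s))
        rw [show X = ((fun s => id s - t) ^ 2) * a from funext hXa] at hs
        have := h2.unique hs
        simp at this
        linear_combination this
      · have := ha.continuous
        have := ha.continuous_deriv (by simp)
        exact Continuous.continuousAt (by fun_prop)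
      · exact ((hec (n := ∞)).dot2 hG).continuous.continuousAt
    simpa using h1.eq_of_nhds
  have hat0 : 0 < a t := by linarith
  -- the new parameter, whose square is the first coordinate
  let S : Set ℝ := {s | 0 < a s}
  have hS : IsOpen S := isOpen_lt continuous_const ha.continuous
  have htS : t ∈ S := hat0
  let m : ℝ → ℝ := fun s => √(a s)
  have hm : ContDiffOn ℝ ∞ m S := fun s hs =>
    (ha.contDiffAt.sqrt (ne_of_gt hs)).contDiffWithinAt
  have hmt : 0 < m t := Real.sqrt_pos.2 hat0
  let u : ℝ → ℝ := fun s => (s - t) * m s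
  have hu : ContDiffOn ℝ ∞ u S := (contDiff_id.sub contDiff_const).contDiffOn.mul hm
  have hmd : ∀ s ∈ S, HasDerivAt m (deriv m s) s := fun s hs =>
    ((hm.contDiffAt (hS.mem_nhds hs)).differentiableAt (by simp)).hasDerivAt
  have hud : ∀ s ∈ S, HasDerivAt u (m s + (s - t) * deriv m s) s := fun s hs =>
    (((hasDerivAt_id s).sub_const t).mul (hmd s hs)).congr_deriv (by simp)
  have huX : ∀ s ∈ S, u s ^ 2 = X s := fun s hs => by
    rw [hXa, mul_pow, Real.sq_sqrt (le_of_lt hs)]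
  have hut : u t = 0 := by simp [u]
  have hloc : IsLocalDiffeomorphAt 𝓘(ℝ, ℝ) 𝓘(ℝ, ℝ) ∞ u t := by
    refine isLocalDiffeomorphAt_of_hasFDerivAt hS htS hu
      (f' := ContinuousLinearEquiv.unitsEquivAut ℝ (Units.mk0 (m t) hmt.ne')) ?_
    refine (hud t htS).hasFDerivAt.congr_fderiv ?_
    ext
    simp
  obtain ⟨p, htp, hp⟩ := hloc
  set φ : ℝ → ℝ := p.invFun with hφdef
  have hφ : ContDiffOn ℝ ∞ φ p.target := contMDiffOn_iff_contDiffOn.1 p.contMDiffOn_invFun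
  have hpt : p.toFun t = 0 := by rw [← hut]; exact (hp htp).symm
  have h0p : (0 : ℝ) ∈ p.target := by rw [← hpt]; exact p.map_source htp
  have hφ0 : φ 0 = t := by rw [← hpt]; exact p.left_inv htp
  have hφc : Tendsto φ (𝓝 0) (𝓝 t) := by
    have := hφ.continuousOn.continuousAt (p.open_target.mem_nhds h0p)
    rwa [ContinuousAt, hφ0] at this
  have huφ : ∀ᶠ x in 𝓝 0, u (φ x) = x := by
    filter_upwards [p.open_target.mem_nhds h0p] with x hx
    exact (hp (p.map_target hx)).trans (p.right_inv hx)
  have huc : Tendsto u (𝓝 t) (𝓝 0) := by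
    have := (hud t htS).continuousAt.tendsto
    rwa [hut] at this
  have hφu : ∀ᶠ s in 𝓝 t, φ (u s) = s := by
    filter_upwards [p.open_source.mem_nhds htp] with s hs
    rw [show u s = p.toFun s from hp hs]
    exact p.left_inv hs
  obtain ⟨Y, hY, hYe⟩ := exists_contDiff_eventuallyEq p.open_target h0p (hZc.comp_contDiffOn hφ)
  have hYn : ContDiff ℝ ∞ fun x => Y (-x) := hY.comp contDiff_neg
  -- even and odd parts of the second coordinate
  obtain ⟨A, hA, eA⟩ := exists_eq_comp_sq ((hY.add hYn).div_const 2) (fun x => by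
    simp only [neg_neg]; ring)
  obtain ⟨O, hO, eO⟩ := exists_eq_add_sub_smul ((hY.sub hYn).div_const 2) 0
  simp only [sub_zero, neg_zero, sub_self, zero_div, zero_add, smul_eq_mul] at eO
  have hOeven : ∀ x, O (-x) = O x := by
    have h1 : Continuous fun x => O (-x) := hO.continuous.comp continuous_neg
    refine congrFun (Continuous.ext_on (dense_compl_singleton 0) h1 hO.continuous fun x hx => ?_)
    have h2 := eO (-x)
    rw [neg_neg] at h2
    refine mul_left_cancel₀ (show x ≠ 0 from hx) ?_
    have h3 := eO x
    linarith
  obtain ⟨C, hC, eC⟩ := exists_eq_comp_sq hO hOeven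
  have eY : ∀ x, Y x = A (x ^ 2) + x * C (x ^ 2) := fun x => by
    rw [← eA, ← eC, ← eO]; ring
  have hZs : ∀ᶠ s in 𝓝 t, Z s = A (X s) + u s * C (X s) := by
    filter_upwards [hφu, huc.eventually hYe, hS.mem_nhds htS] with s h1 h2 h3
    rw [← huX s h3, ← eY, h2, Function.comp_apply, h1]
  have hA0 : A 0 = 0 := by simpa [hX0, hut, hZ0] using hZs.self_of_nhds.symm
  have hAd : ∀ s, HasDerivAt A (deriv A s) s := fun s =>
    (hA.differentiable (by simp) s).hasDerivAt
  have hCd : ∀ s, HasDerivAt C (deriv C s) s := fun s =>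
    (hC.differentiable (by simp) s).hasDerivAt
  -- The term linear in u would give Z a nonzero velocity at t. Hence the odd part starts with u³.
  have hC0 : C 0 = 0 := by
    have h1 := (((hAd _).comp t hX'.self_of_nhds).add ((hud t htS).mul ((hCd _).comp t
      hX'.self_of_nhds))).congr_of_eventuallyEq hZs
    have h2 := h1.unique hZ'.self_of_nhds
    simp [hX0, hut] at h2
    exact h2.resolve_left hmt.ne'
  obtain ⟨B, hB, eB⟩ := exists_eq_add_sub_smul hC 0
  simp only [sub_zero, hC0, zero_add, smul_eq_mul] at eB
  have hBd : ∀ s, HasDerivAt B (deriv B s) s := fun s =>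
    (hB.differentiable (by simp) s).hasDerivAt
  have eY' : ∀ x, Y x = A (x ^ 2) + x ^ 3 * B (x ^ 2) := fun x => by rw [eY, eB]; ring
  have hZs' : ∀ᶠ s in 𝓝 t, Z s = A (X s) + u s ^ 3 * B (X s) := by
    filter_upwards [hZs, hS.mem_nhds htS] with s h1 h3
    rw [h1, eB, ← huX s h3]; ring
  have hdG : HasDerivAt (fun s => dot2 e (G s)) (dot2 e (deriv G t)) t :=
    ((hasDerivAt_const t e).dot2 (hG.differentiable (by simp) t).hasDerivAt).congr_deriv
      (by simp [dot2])
  -- Differentiating Z = A(X) + u³ B(X) and cancelling s − t gives det(e, G) = A'(X) e·G + (s − t) R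
  -- with R(t) = 3 m(t)³ B(0). The value at t shows A'(0) = 0. The derivative at t then shows det(e,
  -- G'(t)) = R(t), so B(0) = 0 would contradict `hdet`.
  have hB0 : B 0 ≠ 0 := by
    -- the second factor of the remainder in the slope
    set R : ℝ → ℝ := fun s => 3 * m s ^ 2 * (m s + (s - t) * deriv m s) * B (X s) +
      (s - t) ^ 2 * (m s ^ 3 * deriv B (X s) * dot2 e (G s)) with hRdef
    have c2 : ContinuousAt (fun s => dot2 e (G s)) t := hdG.continuousAt
    have hR : ContinuousAt R t := by
      have c1 := hXc.continuous.continuousAt (x := t)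
      have c6 := (hmd t htS).continuousAt
      have c7 : ContinuousAt (deriv m) t :=
        (((contDiffOn_infty_iff_deriv_of_isOpen hS).1 hm).2.continuousOn).continuousAt
          (hS.mem_nhds htS)
      have c9 : ContinuousAt (fun s => deriv B (X s)) t :=
        ((hB.continuous_deriv (by simp)).continuousAt (x := X t)).comp c1
      have c10 : ContinuousAt (fun s => B (X s)) t := (hB.continuous.continuousAt (x := X t)).comp c1
      have c11 : ContinuousAt (fun s : ℝ => s - t) t := by fun_prop
      exact (((continuousAt_const.mul (c6.pow 2)).mul
        (c6.add (c11.mul c7))).mul c10).add ((c11.pow 2).mul (((c6.pow 3).mul c9).mul c2))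
    have hA' : ContDiff ℝ ∞ (deriv A) := (contDiff_infty_iff_deriv.1 hA).2
    have hAX : HasDerivAt (fun s => deriv A (X s)) (deriv (deriv A) (X t) * ((t - t) * _)) t :=
      ((hA'.differentiable (by simp) (X t)).hasDerivAt).comp t hX'.self_of_nhds
    have hslope : (fun s => det2 e (G s)) =ᶠ[𝓝 t]
        fun s => deriv A (X s) * dot2 e (G s) + (s - t) * R s := by
      refine eventuallyEq_of_sub_mul_eq ?_ ((hec (n := ∞)).det2 hG).continuous.continuousAt
        ((hAX.continuousAt.mul c2).add (ContinuousAt.mul (by fun_prop) hR))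
      filter_upwards [hZs'.eventually_nhds, hX', hZ', hS.mem_nhds htS] with s h1 h2 h3 h4
      have h5 := (((hAd _).comp s h2).add (((hud s h4).pow 3).mul ((hBd _).comp s
        h2))).congr_of_eventuallyEq h1
      rw [h3.unique h5]
      simp [u, R]
      ring
    have hA1 : deriv A 0 = 0 := by
      have := hslope.eq_of_nhds
      simp [hX0, ← he] at this
      exact this.resolve_right hq.ne'
    have h1 := (((hAX.mul hdG).add
      (hasDerivAt_sub_mul_of_continuousAt hR)).congr_of_eventuallyEq hslope).unique
      ((hasDerivAt_const t e).det2 (hG.differentiable (by simp) t).hasDerivAt)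
    intro hB0
    apply hdet
    simp [hX0, hA1, R, hB0] at h1
    have h2 : det2 0 (G t) = 0 := by simp [det2]
    rw [h2, zero_add] at h1
    exact h1.symm
  have hBc : Continuous B := hB.continuous
  -- The map (X, Z) ↦ (X, (Z − A(X)) / B(X)), with its explicit inverse, on the region where B(X) ≠
  -- 0.
  let Φ : PartialDiffeomorph 𝓘(ℝ, Plane) 𝓘(ℝ, Plane) Plane Plane ∞ :=
    { toFun := fun x => !₂[dot2 e (x - γ t),
        (det2 e (x - γ t) - A (dot2 e (x - γ t))) / B (dot2 e (x - γ t))]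
      invFun := fun y => γ t + (dot2 e e)⁻¹ • (y 0 • e + (y 1 * B (y 0) + A (y 0)) • rot90 e)
      source := {x | B (dot2 e (x - γ t)) ≠ 0}
      target := {y | B (y 0) ≠ 0}
      map_source' := fun x hx => hx
      map_target' := fun y hy => by
        have : dot2 e (γ t + (dot2 e e)⁻¹ • (y 0 • e + (y 1 * B (y 0) + A (y 0)) • rot90 e)
            - γ t) = y 0 := by
          have := hq.ne'
          rw [add_sub_cancel_left, dot2_smul_right, inv_mul_eq_iff_eq_mul₀ this]
          simp [dot2]; ring
        exact (congrArg B this).trans_ne hy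
      left_inv' := fun x hx => by
        have hx' : B (dot2 e (x - γ t)) ≠ 0 := hx
        have := hq.ne'
        simp only [Matrix.cons_val_zero, Matrix.cons_val_one]
        rw [div_mul_cancel₀ _ hx', sub_add_cancel, ← eq_sub_iff_add_eq', inv_smul_eq_iff₀ this]
        apply plane_ext <;> simp [dot2, det2] <;> ring
      right_inv' := fun y hy => by
        have hy' : B (y 0) ≠ 0 := hy
        have h0 := hq.ne'
        have h1 : dot2 e (γ t + (dot2 e e)⁻¹ • (y 0 • e + (y 1 * B (y 0) + A (y 0)) • rot90 e)
            - γ t) = y 0 := by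
          rw [add_sub_cancel_left, dot2_smul_right, inv_mul_eq_iff_eq_mul₀ h0]
          simp [dot2]; ring
        have h2 : det2 e (γ t + (dot2 e e)⁻¹ • (y 0 • e + (y 1 * B (y 0) + A (y 0)) • rot90 e)
            - γ t) = y 1 * B (y 0) + A (y 0) := by
          rw [add_sub_cancel_left, det2_smul_right, inv_mul_eq_iff_eq_mul₀ h0]
          simp [dot2, det2]; ring
        simp only [h1, h2]
        apply plane_ext <;> simp
        field_simp
      open_source := by
        refine isOpen_ne_fun (hBc.comp ?_) continuous_const
        exact ((contDiff_const (n := 0)).dot2 (contDiff_id.sub contDiff_const)).continuous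
      open_target := isOpen_ne_fun (hBc.comp (contDiff_id (n := 0).plane_apply 0).continuous)
        continuous_const
      contMDiffOn_toFun := by
        rw [contMDiffOn_iff_contDiffOn]
        have h1 : ContDiff ℝ ∞ fun x : Plane => dot2 e (x - γ t) :=
          contDiff_const.dot2 (contDiff_id.sub contDiff_const)
        have h2 : ContDiff ℝ ∞ fun x : Plane => det2 e (x - γ t) :=
          contDiff_const.det2 (contDiff_id.sub contDiff_const)
        rw [contDiffOn_euclidean]
        intro i
        fin_cases i
        · exact h1.contDiffOn
        · exact ((h2.sub (hA.comp h1)).contDiffOn).div (hB.comp h1).contDiffOn fun x hx => hx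
      contMDiffOn_invFun := by
        rw [contMDiffOn_iff_contDiffOn]
        have h1 : ContDiff ℝ ∞ fun y : Plane => y 0 := contDiff_id.plane_apply 0
        have h2 : ContDiff ℝ ∞ fun y : Plane => y 1 := contDiff_id.plane_apply 1
        have h3 : ContDiff ℝ ∞ fun y : Plane => y 1 * B (y 0) + A (y 0) :=
          (h2.mul (hB.comp h1)).add (hA.comp h1)
        exact ContDiff.contDiffOn (by fun_prop) }
  have hγt0 : dot2 e (γ t - γ t) = 0 := by simp [dot2]
  refine ⟨φ, Φ, p.symm.isLocalDiffeomorphAt _ _ _ h0p, hφ0, Φ.isLocalDiffeomorphAt _ _ _ ?_, ?_⟩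
  · change B (dot2 e (γ t - γ t)) ≠ 0
    rwa [hγt0]
  · have hBev : ∀ᶠ x in 𝓝 (0 : ℝ), B (x ^ 2) ≠ 0 := by
      have : Continuous fun x : ℝ => B (x ^ 2) := hBc.comp (continuous_pow 2)
      exact this.continuousAt.eventually_ne (by simpa using hB0)
    filter_upwards [hBev, huφ, hYe, hφc.eventually (hS.mem_nhds htS)] with x h1 h2 h3 h4
    have h5 : dot2 e (γ (φ x) - γ t) = x ^ 2 := by
      have := huX _ h4
      rw [h2] at this
      exact this.symm
    have h6 : det2 e (γ (φ x) - γ t) = A (x ^ 2) + x ^ 3 * B (x ^ 2) := by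
      rw [← eY', h3]; rfl
    change !₂[dot2 e (γ (φ x) - γ t), (det2 e (γ (φ x) - γ t) - A (dot2 e (γ (φ x) - γ t))) /
      B (dot2 e (γ (φ x) - γ t))] = _
    rw [h5, h6, add_sub_cancel_left, mul_div_cancel_right₀ _ h1]

/-- Hadamard's lemma gives l = (s − t) k with k(t) ≠ 0, and k is absorbed into the direction:
det(kg, (kg)') = k² det(g, g'). -/
theorem HasCuspForm.isCusp {γ : ℝ → Plane} {t : ℝ} (h : HasCuspForm γ t) (hγ : ContDiff ℝ ∞ γ) :
    IsCusp γ t := by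
  obtain ⟨l, g, hl, hg, hd, hl0, hl', hdet⟩ := h
  obtain ⟨k, hk, ek⟩ := exists_eq_add_sub_smul hl t
  have hkd := (hk.differentiable (by simp) t).hasDerivAt
  have hgd := (hg.differentiable (by simp) t).hasDerivAt
  have hkt : k t ≠ 0 := by
    have h1 := hasDerivAt_sub_mul_of_continuousAt hk.continuous.continuousAt (R := k) (t := t)
    rw [show l = fun s => (s - t) * k s from funext fun s => by rw [ek, hl0]; simp, h1.deriv] at hl'
    exact hl'
  refine isCusp_of_hasDerivAt_sub_smul (G := fun s => k s • g s) hγ (hk.smul hg)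
    (hd.mono fun s hs => hs.congr_deriv ?_) ?_
  · rw [ek, hl0, smul_smul]; simp
  · have h1 : HasDerivAt (fun s => k s • g s) _ t := hkd.smul hgd
    rw [h1.deriv, det2_add_right, det2_smul_left, det2_smul_left, det2_smul_right,
      det2_smul_right, det2_self, mul_zero, mul_zero, add_zero]
    exact mul_ne_zero hkt (mul_ne_zero hkt hdet)

/-! ### Curves with velocity `l • g` -/

/-- `det (g, g')`. -/
def turning (g : ℝ → Plane) (s : ℝ) : ℝ := det2 (g s) (deriv g s)

/-- For a curve with velocity `l • g`, the numerator of the derivative of the radius of curvature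
with respect to arc length, divided by `l ^ 3`; the denominator is `l ^ 4 * turning g ^ 2`. -/
def radiusNum (l : ℝ → ℝ) (g : ℝ → Plane) (s : ℝ) : ℝ :=
  deriv l s * (dot2 (g s) (g s) * turning g s) +
    l s * (3 * dot2 (g s) (deriv g s) * turning g s - dot2 (g s) (g s) * deriv (turning g) s)

/-- The denominator of the parameterization of the singular evolutoids set. -/
def sesDenom (l : ℝ → ℝ) (g : ℝ → Plane) (s : ℝ) : ℝ :=
  l s ^ 2 * turning g s ^ 4 + radiusNum l g s ^ 2

/-- The singular evolutoids set of a curve with velocity `l • g`. -/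
def sesFormula (f : ℝ → Plane) (l : ℝ → ℝ) (g : ℝ → Plane) (s : ℝ) : Plane :=
  f s + (l s ^ 2 * dot2 (g s) (g s) * turning g s / sesDenom l g s) •
    ((l s * turning g s ^ 2) • rot90 (g s) - radiusNum l g s • g s)

/-- The numerator of the second derivative of the radius of curvature. -/
def radiusNum₂ (l : ℝ → ℝ) (g : ℝ → Plane) (s : ℝ) : ℝ :=
  -(deriv l s * radiusNum l g s * turning g s) +
    l s * (deriv (radiusNum l g) s * turning g s - 2 * radiusNum l g s * deriv (turning g) s)

/-- A vector along the tangent of the singular evolutoids set. -/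
def sesDirection (l : ℝ → ℝ) (g : ℝ → Plane) (s : ℝ) : Plane :=
  (radiusNum l g s ^ 2 - l s ^ 2 * turning g s ^ 4) • g s -
    (2 * l s * radiusNum l g s * turning g s ^ 2) • rot90 (g s)

section

variable {l : ℝ → ℝ} {g f : ℝ → Plane}

theorem contDiff_turning (hg : ContDiff ℝ ∞ g) : ContDiff ℝ ∞ (turning g) :=
  hg.det2 (contDiff_infty_iff_deriv.1 hg).2

theorem contDiff_radiusNum (hl : ContDiff ℝ ∞ l) (hg : ContDiff ℝ ∞ g) :
    ContDiff ℝ ∞ (radiusNum l g) := by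
  have h1 := contDiff_turning hg
  have h2 := (contDiff_infty_iff_deriv.1 h1).2
  have h3 := (contDiff_infty_iff_deriv.1 hl).2
  have h4 := (contDiff_infty_iff_deriv.1 hg).2
  exact (h3.mul ((hg.dot2 hg).mul h1)).add
    (hl.mul (((contDiff_const.mul (hg.dot2 h4)).mul h1).sub ((hg.dot2 hg).mul h2)))

theorem contDiff_sesDenom (hl : ContDiff ℝ ∞ l) (hg : ContDiff ℝ ∞ g) :
    ContDiff ℝ ∞ (sesDenom l g) :=
  ((hl.pow 2).mul ((contDiff_turning hg).pow 4)).add ((contDiff_radiusNum hl hg).pow 2)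

theorem contDiff_radiusNum₂ (hl : ContDiff ℝ ∞ l) (hg : ContDiff ℝ ∞ g) :
    ContDiff ℝ ∞ (radiusNum₂ l g) := by
  have h1 := contDiff_turning hg
  have h2 := (contDiff_infty_iff_deriv.1 h1).2
  have h3 := (contDiff_infty_iff_deriv.1 hl).2
  have h5 := contDiff_radiusNum hl hg
  have h6 := (contDiff_infty_iff_deriv.1 h5).2
  exact ((h3.mul h5).mul h1).neg.add (hl.mul ((h6.mul h1).sub ((contDiff_const.mul h5).mul h2)))

theorem contDiff_sesDirection (hl : ContDiff ℝ ∞ l) (hg : ContDiff ℝ ∞ g) :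
    ContDiff ℝ ∞ (sesDirection l g) := by
  have h1 := contDiff_turning hg
  have h5 := contDiff_radiusNum hl hg
  exact (((h5.pow 2).sub ((hl.pow 2).mul (h1.pow 4))).smul hg).sub
    ((((contDiff_const.mul hl).mul h5).mul (h1.pow 2)).smul hg.rot90)

theorem contDiffAt_sesFormula (hf : ContDiff ℝ ∞ f) (hl : ContDiff ℝ ∞ l) (hg : ContDiff ℝ ∞ g)
    {s : ℝ} (hs : sesDenom l g s ≠ 0) : ContDiffAt ℝ ∞ (sesFormula f l g) s := by
  have h1 := contDiff_turning hg
  have h5 := contDiff_radiusNum hl hg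
  exact hf.contDiffAt.add (ContDiffAt.smul ((((hl.pow 2).mul (hg.dot2 hg)).mul h1).contDiffAt.div
    (contDiff_sesDenom hl hg).contDiffAt hs)
    (((hl.mul (h1.pow 2)).smul hg.rot90).sub (h5.smul hg)).contDiffAt)

theorem rot90_add (v w : Plane) : rot90 (v + w) = rot90 v + rot90 w :=
  plane_ext (by simp; ring) (by simp)

theorem rot90_smul (c : ℝ) (v : Plane) : rot90 (c • v) = c • rot90 v :=
  plane_ext (by simp) (by simp)

theorem rot90_rot90 (v : Plane) : rot90 (rot90 v) = -v := plane_ext (by simp) (by simp)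

theorem eq_frame {v w : Plane} (hv : v ≠ 0) :
    w = (dot2 v w / dot2 v v) • v + (det2 v w / dot2 v v) • rot90 v := by
  have := dot2_self_ne_zero hv
  have key : dot2 v v • w = dot2 v w • v + det2 v w • rot90 v := by
    apply plane_ext <;> simp [dot2, det2] <;> ring
  rw [div_eq_inv_mul, div_eq_inv_mul, mul_smul, mul_smul, ← smul_add, ← key, smul_smul,
    inv_mul_cancel₀ this, one_smul]

/-- The components along `g` and `rot90 g` of the derivative of `sesFormula`, as a polynomial
identity in independent scalars. The names `l1`, `p1`, `n1`, `c1` stand for derivatives of `l`, `p`,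
`n`, `c`, and `b` for g·g'. -/
theorem sesFormula_deriv_identity {l l1 q p p1 b n1 : ℝ} (hq : q ≠ 0) (n d : ℝ)
    (hn : n = l1 * (q * p) + l * (3 * b * p - q * p1)) (hd : d = l ^ 2 * p ^ 4 + n ^ 2)
    (hd0 : d ≠ 0) (c c1 e : ℝ) (hc : c = l ^ 2 * q * p / d)
    (hc1 : c1 = ((2 * l * l1 * q * p + l ^ 2 * (2 * b) * p + l ^ 2 * q * p1) * d -
      l ^ 2 * q * p * (2 * l * l1 * p ^ 4 + l ^ 2 * (4 * p ^ 3 * p1) + 2 * n * n1)) / d ^ 2)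
    (he : e = -(l1 * n * p) + l * (n1 * p - 2 * n * p1)) :
    l - c1 * n - c * (l * p ^ 2 * (p / q) + n1 + n * (b / q)) =
        l * q * e / d ^ 2 * (n ^ 2 - l ^ 2 * p ^ 4) ∧
      c1 * (l * p ^ 2) + c * (l1 * p ^ 2 + l * (2 * p * p1) + l * p ^ 2 * (b / q) - n * (p / q)) =
        -(l * q * e / d ^ 2 * (2 * l * n * p ^ 2)) := by
  rw [hc, hc1]
  constructor
  · field_simp
    subst he hd hn
    ring
  · field_simp
    subst he hd hn
    ring

/-- Expressing g' in the frame (g, `rot90 g`) reduces the claim to two scalar identities. The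
outcome separates a scalar factor, whose zeros are the singular points, from a direction that stays
nonzero at them. -/
theorem hasDerivAt_sesFormula (hl : ContDiff ℝ ∞ l) (hg : ContDiff ℝ ∞ g) {s : ℝ}
    (hf : HasDerivAt f (l s • g s) s) (hgs : g s ≠ 0) (hs : sesDenom l g s ≠ 0) :
    HasDerivAt (sesFormula f l g) ((l s * dot2 (g s) (g s) * radiusNum₂ l g s / sesDenom l g s ^ 2) •
      sesDirection l g s) s := by
  have hq := dot2_self_ne_zero hgs
  have dl := (hl.differentiable (by simp) s).hasDerivAt
  have dg := (hg.differentiable (by simp) s).hasDerivAt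
  have dp := ((contDiff_turning hg).differentiable (by simp) s).hasDerivAt
  have dn := ((contDiff_radiusNum hl hg).differentiable (by simp) s).hasDerivAt
  set q := dot2 (g s) (g s) with hqdef
  set p := turning g s with hpdef
  set b := dot2 (g s) (deriv g s) with hbdef
  set n := radiusNum l g s with hndef
  set d := sesDenom l g s with hddef
  have hframe : deriv g s = (b / q) • g s + (p / q) • rot90 (g s) := eq_frame hgs
  have dd : HasDerivAt (sesDenom l g) (2 * l s * deriv l s * p ^ 4 +
      l s ^ 2 * (4 * p ^ 3 * deriv (turning g) s) + 2 * n * deriv (radiusNum l g) s) s :=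
    (((dl.pow 2).mul (dp.pow 4)).add (dn.pow 2)).congr_deriv (by simp [← hpdef, ← hndef])
  have dq : HasDerivAt (fun s => dot2 (g s) (g s)) (2 * b) s :=
    (dg.dot2 dg).congr_deriv (by simp only [hbdef, dot2]; ring)
  have dc : HasDerivAt (fun s => l s ^ 2 * dot2 (g s) (g s) * turning g s / sesDenom l g s) _ s :=
    (((dl.pow 2).mul dq).mul dp).div dd hs
  have dV : HasDerivAt
      (fun s => (l s * turning g s ^ 2) • rot90 (g s) - radiusNum l g s • g s) _ s :=
    ((dl.mul (dp.pow 2)).smul dg.rot90).sub (dn.smul dg)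
  refine (hf.add (dc.smul dV)).congr_deriv ?_
  obtain ⟨h1, h2⟩ := sesFormula_deriv_identity (n1 := deriv (radiusNum l g) s) hq
    n d (rfl : n = _) rfl hs _ _ (radiusNum₂ l g s) rfl rfl rfl
  simp only [Pi.mul_apply, Pi.pow_apply, ← hqdef, ← hpdef, ← hndef, ← hddef,
    sesDirection, hframe, rot90_add, rot90_smul, rot90_rot90]
  apply plane_ext
  · simp
    linear_combination (g s 0) * h1 - (g s 1) * h2
  · simp
    linear_combination (g s 1) * h1 + (g s 0) * h2

end

variable {l : ℝ → ℝ} {g f γ : ℝ → Plane} {s t : ℝ}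

theorem ContDiff.hasDerivAt_deriv {E : Type*} [NormedAddCommGroup E] [NormedSpace ℝ E] {f : ℝ → E}
    (hf : ContDiff ℝ ∞ f) (s : ℝ) : HasDerivAt f (deriv f s) s :=
  (hf.differentiable (by simp) s).hasDerivAt

theorem ContDiff.deriv_top {E : Type*} [NormedAddCommGroup E] [NormedSpace ℝ E] {f : ℝ → E}
    (hf : ContDiff ℝ ∞ f) : ContDiff ℝ ∞ (deriv f) := (contDiff_infty_iff_deriv.1 hf).2

theorem turning_smul (hl : DifferentiableAt ℝ l s) (hg : DifferentiableAt ℝ g s) :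
    turning (fun s => l s • g s) s = l s ^ 2 * turning g s := by
  have h : HasDerivAt (fun s => l s • g s) _ s := hl.hasDerivAt.smul hg.hasDerivAt
  rw [turning, h.deriv, turning, det2_smul_left, det2_add_right, det2_smul_right, det2_smul_right,
    det2_self]
  ring

theorem turning_congr {g g' : ℝ → Plane} (h : g =ᶠ[𝓝 s] g') : turning g s = turning g' s := by
  rw [turning, turning, h.eq_of_nhds, h.deriv_eq]

theorem turning_smul_eventuallyEq {v : ℝ → Plane} (h : v =ᶠ[𝓝 s] fun s => l s • g s)
    (hl : ∀ᶠ s in 𝓝 s, DifferentiableAt ℝ l s) (hg : ContDiff ℝ ∞ g) :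
    turning v =ᶠ[𝓝 s] fun s => l s ^ 2 * turning g s := by
  filter_upwards [h.eventuallyEq_nhds, hl] with x hx hlx
  rw [turning_congr hx, turning_smul hlx (hg.differentiable (by simp) x)]

theorem radiusNum_one (g : ℝ → Plane) (s : ℝ) : radiusNum (fun _ => 1) g s =
    3 * dot2 (g s) (deriv g s) * turning g s - dot2 (g s) (g s) * deriv (turning g) s := by
  simp [radiusNum]

theorem radiusNum₂_one (g : ℝ → Plane) (s : ℝ) : radiusNum₂ (fun _ => 1) g s =
    deriv (radiusNum (fun _ => 1) g) s * turning g s -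
      2 * radiusNum (fun _ => 1) g s * deriv (turning g) s := by
  simp [radiusNum₂]

theorem sesDenom_one (g : ℝ → Plane) (s : ℝ) : sesDenom (fun _ => 1) g s =
    turning g s ^ 4 + radiusNum (fun _ => 1) g s ^ 2 := by
  simp [sesDenom]

/-- The parameterization of the singular evolutoids set does not depend on how the velocity is
factored. -/
theorem sesFormula_one_eq (hl : ContDiff ℝ ∞ l) (hg : ContDiff ℝ ∞ g)
    (h : deriv f =ᶠ[𝓝 s] fun s => l s • g s) (hs : l s ≠ 0) :
    sesFormula f (fun _ => 1) (deriv f) s = sesFormula f l g s := by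
  have hld := ContDiff.hasDerivAt_deriv hl s
  have hgd := ContDiff.hasDerivAt_deriv hg s
  have ht := turning_smul_eventuallyEq h
    (Eventually.of_forall fun x => hl.differentiable (by simp) x) hg
  have e1 : turning (deriv f) s = l s ^ 2 * turning g s := ht.eq_of_nhds
  have e2 : deriv (turning (deriv f)) s =
      2 * l s * deriv l s * turning g s + l s ^ 2 * deriv (turning g) s := by
    have h1 : HasDerivAt (fun s => l s ^ 2 * turning g s) _ s :=
      (hld.pow 2).mul (ContDiff.hasDerivAt_deriv (contDiff_turning hg) s)
    rw [ht.deriv_eq, h1.deriv]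
    simp
  have e3 : deriv (deriv f) s = l s • deriv g s + deriv l s • g s := by
    have h1 : HasDerivAt (fun s => l s • g s) _ s := hld.smul hgd
    rw [h.deriv_eq, h1.deriv]
  have e4 : deriv f s = l s • g s := h.eq_of_nhds
  have e5 : radiusNum (fun _ => 1) (deriv f) s = l s ^ 3 * radiusNum l g s := by
    rw [radiusNum_one, e1, e2, e3, e4, radiusNum]
    simp [dot2]
    ring
  have e6 : sesDenom (fun _ => 1) (deriv f) s = l s ^ 6 * sesDenom l g s := by
    rw [sesDenom_one, e1, e5, sesDenom]
    ring
  rw [sesFormula, sesFormula, e1, e5, e6, e4, rot90_smul]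
  by_cases hd : sesDenom l g s = 0
  · simp [hd]
  apply plane_ext <;> simp [dot2] <;> field_simp

/-! ### Derivatives of the radius of curvature -/

theorem curvature_eq (f : ℝ → Plane) (s : ℝ) :
    curvature f s = turning (deriv f) s / ‖deriv f s‖ ^ 3 := rfl

theorem curvature_eq_zero_iff (h : deriv f s ≠ 0) : curvature f s = 0 ↔ turning (deriv f) s = 0 := by
  have : ‖deriv f s‖ ^ 3 ≠ 0 := pow_ne_zero _ (norm_ne_zero_iff.2 h)
  rw [curvature_eq, div_eq_zero_iff, or_iff_left this]

/-- The case distinction in the definition is superfluous: at a singular point the numerator is 0.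
-/
theorem radius_eq (f : ℝ → Plane) (s : ℝ) :
    radius f s = ‖deriv f s‖ ^ 3 / turning (deriv f) s := by
  rw [radius, curvature_eq]
  split_ifs with h
  · simp [h]
  · rw [one_div_div]

theorem hasDerivAt_norm_plane {v : ℝ → Plane} {v' : Plane} (hv : HasDerivAt v v' s) (h : v s ≠ 0) :
    HasDerivAt (fun s => ‖v s‖) (dot2 (v s) v' / ‖v s‖) s := by
  have e : ∀ v : Plane, ‖v‖ = √(dot2 v v) := fun v => by
    rw [← norm_sq_eq_dot2, Real.sqrt_sq (norm_nonneg _)]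
  have h1 := (hv.dot2 hv).sqrt (dot2_self_ne_zero h)
  simp only [← e] at h1
  refine h1.congr_deriv ?_
  have : ‖v s‖ ≠ 0 := norm_ne_zero_iff.2 h
  field_simp
  simp only [dot2]; ring

theorem eventually_regular_nonflat (hf : ContDiff ℝ ∞ f) (h : deriv f t ≠ 0)
    (hp : turning (deriv f) t ≠ 0) :
    ∀ᶠ s in 𝓝 t, deriv f s ≠ 0 ∧ turning (deriv f) s ≠ 0 :=
  ((ContDiff.deriv_top hf).continuous.continuousAt.eventually_ne h).and
    ((contDiff_turning (ContDiff.deriv_top hf)).continuous.continuousAt.eventually_ne hp)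

section

variable (hf : ContDiff ℝ ∞ f) (h : deriv f t ≠ 0) (hp : turning (deriv f) t ≠ 0)
include hf h hp

theorem hasDerivAt_radius : HasDerivAt (radius f) (‖deriv f t‖ *
    (radiusNum (fun _ => 1) (deriv f) t / turning (deriv f) t ^ 2)) t := by
  have hf' := ContDiff.deriv_top hf
  have hn : ‖deriv f t‖ ≠ 0 := norm_ne_zero_iff.2 h
  rw [show radius f = fun s => ‖deriv f s‖ ^ 3 / turning (deriv f) s from funext (radius_eq f)]
  refine (((hasDerivAt_norm_plane (ContDiff.hasDerivAt_deriv hf' t) h).pow 3).div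
    (ContDiff.hasDerivAt_deriv (contDiff_turning hf') t) hp).congr_deriv ?_
  rw [radiusNum_one, ← norm_sq_eq_dot2]
  simp
  field_simp

theorem radius₁_eq : radius₁ f t =
    radiusNum (fun _ => 1) (deriv f) t / turning (deriv f) t ^ 2 := by
  rw [radius₁, arcDeriv, (hasDerivAt_radius hf h hp).deriv,
    mul_div_cancel_left₀ _ (norm_ne_zero_iff.2 h)]

theorem hasDerivAt_radius₁ : HasDerivAt (radius₁ f) (‖deriv f t‖ *
    (radiusNum₂ (fun _ => 1) (deriv f) t / (turning (deriv f) t ^ 3 * ‖deriv f t‖))) t := by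
  have hf' := ContDiff.deriv_top hf
  have hn : ‖deriv f t‖ ≠ 0 := norm_ne_zero_iff.2 h
  have e : radius₁ f =ᶠ[𝓝 t]
      fun s => radiusNum (fun _ => 1) (deriv f) s / turning (deriv f) s ^ 2 :=
    (eventually_regular_nonflat hf h hp).mono fun s hs => radius₁_eq hf hs.1 hs.2
  refine (((ContDiff.hasDerivAt_deriv (contDiff_radiusNum contDiff_const hf') t).div
    ((ContDiff.hasDerivAt_deriv (contDiff_turning hf') t).pow 2)
    (pow_ne_zero 2 hp)).congr_of_eventuallyEq e).congr_deriv ?_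
  rw [radiusNum₂_one]
  simp
  field_simp

theorem radius₂_eq : radius₂ f t =
    radiusNum₂ (fun _ => 1) (deriv f) t / (turning (deriv f) t ^ 3 * ‖deriv f t‖) := by
  rw [radius₂, arcDeriv, (hasDerivAt_radius₁ hf h hp).deriv,
    mul_div_cancel_left₀ _ (norm_ne_zero_iff.2 h)]

theorem hasDerivAt_radius₂ : HasDerivAt (radius₂ f) (‖deriv f t‖ * radius₃ f t) t := by
  have hf' := ContDiff.deriv_top hf
  have hn : ‖deriv f t‖ ≠ 0 := norm_ne_zero_iff.2 h
  have e : radius₂ f =ᶠ[𝓝 t] fun s =>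
      radiusNum₂ (fun _ => 1) (deriv f) s / (turning (deriv f) s ^ 3 * ‖deriv f s‖) :=
    (eventually_regular_nonflat hf h hp).mono fun s hs => radius₂_eq hf hs.1 hs.2
  have h1 := ((ContDiff.hasDerivAt_deriv (contDiff_radiusNum₂ contDiff_const hf') t).div
    (((ContDiff.hasDerivAt_deriv (contDiff_turning hf') t).pow 3).mul
    (hasDerivAt_norm_plane (ContDiff.hasDerivAt_deriv hf' t) h))
    (mul_ne_zero (pow_ne_zero 3 hp) hn)).congr_of_eventuallyEq e
  refine h1.differentiableAt.hasDerivAt.congr_deriv ?_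
  rw [radius₃, arcDeriv, mul_div_cancel₀ _ hn]

/-- At a zero of E, differentiating ρ'' = E/(p³|f'|) leaves only the term with E'. -/
theorem radius₃_ne_zero_iff (h0 : radiusNum₂ (fun _ => 1) (deriv f) t = 0) :
    radius₃ f t ≠ 0 ↔ deriv (radiusNum₂ (fun _ => 1) (deriv f)) t ≠ 0 := by
  have hf' := ContDiff.deriv_top hf
  have hn : ‖deriv f t‖ ≠ 0 := norm_ne_zero_iff.2 h
  have e : radius₂ f =ᶠ[𝓝 t] fun s =>
      radiusNum₂ (fun _ => 1) (deriv f) s / (turning (deriv f) s ^ 3 * ‖deriv f s‖) :=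
    (eventually_regular_nonflat hf h hp).mono fun s hs => radius₂_eq hf hs.1 hs.2
  have h1 := ((ContDiff.hasDerivAt_deriv (contDiff_radiusNum₂ contDiff_const hf') t).div
    (((ContDiff.hasDerivAt_deriv (contDiff_turning hf') t).pow 3).mul
    (hasDerivAt_norm_plane (ContDiff.hasDerivAt_deriv hf' t) h))
    (mul_ne_zero (pow_ne_zero 3 hp) hn)).congr_of_eventuallyEq e
  have h2 := (hasDerivAt_radius₂ hf h hp).unique h1
  rw [h0, zero_mul, sub_zero] at h2
  have h3 : turning (deriv f) t ^ 3 * ‖deriv f t‖ ≠ 0 := mul_ne_zero (pow_ne_zero 3 hp) hn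
  rw [show radius₃ f t = (‖deriv f t‖)⁻¹ * (‖deriv f t‖ * radius₃ f t) by field_simp, h2]
  rw [not_iff_not]
  simp [h, hp]

theorem arcCondition_eq : 1 + radius₁ f t ^ 2 + 2 * radius f t * radius₂ f t =
    (sesDenom (fun _ => 1) (deriv f) t + 2 * dot2 (deriv f t) (deriv f t) *
      radiusNum₂ (fun _ => 1) (deriv f) t) / turning (deriv f) t ^ 4 := by
  have hn : ‖deriv f t‖ ≠ 0 := norm_ne_zero_iff.2 h
  rw [radius₁_eq hf h hp, radius₂_eq hf h hp, radius_eq, sesDenom_one, ← norm_sq_eq_dot2]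
  field_simp

end

/-- At singular and at flat points p = 0, so the correction term of `sesFormula` vanishes whatever
its denominator is, and the value is `f` as prescribed. Thus one expression describes the curve
everywhere. -/
theorem sesCurve_eq (hf : ContDiff ℝ ∞ f) (s : ℝ) :
    sesCurve f s = sesFormula f (fun _ => 1) (deriv f) s := by
  rw [sesCurve, sesFormula]
  split_ifs with h
  · have : turning (deriv f) s = 0 := by
      by_cases h0 : deriv f s = 0
      · simp [turning, h0, det2]
      · exact (curvature_eq_zero_iff h0).1 (h.resolve_left h0)
    simp [this]
  · push Not at h
    have hp := (curvature_eq_zero_iff h.1).not.1 h.2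
    have hn : ‖deriv f s‖ ≠ 0 := norm_ne_zero_iff.2 h.1
    have hd : sesDenom (fun _ => 1) (deriv f) s ≠ 0 := by
      rw [sesDenom_one]
      positivity
    have hd' : 1 + radius₁ f s ^ 2 = sesDenom (fun _ => 1) (deriv f) s / turning (deriv f) s ^ 4 := by
      rw [radius₁_eq hf h.1 hp, sesDenom_one]
      field_simp
    rw [hd', radius₁_eq hf h.1 hp, radius_eq, unitNormal, unitTangent, rot90_smul,
      ← norm_sq_eq_dot2]
    congr 1
    apply plane_ext <;> simp <;> field_simp <;> ring

variable {l : ℝ → ℝ} {g f γ : ℝ → Plane} {s t : ℝ}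

/-! ### Singularities of the singular evolutoids set -/

/-- With A = N² − l²p⁴ and B = 2lNp² this is A² + B² = (N² + l²p⁴)². -/
theorem dot2_sesDirection (l : ℝ → ℝ) (g : ℝ → Plane) (s : ℝ) :
    dot2 (sesDirection l g s) (sesDirection l g s) = dot2 (g s) (g s) * sesDenom l g s ^ 2 := by
  simp [sesDirection, dot2, sesDenom]; ring

theorem sesDirection_ne_zero (hg : g s ≠ 0) (hd : sesDenom l g s ≠ 0) :
    sesDirection l g s ≠ 0 := fun h => by
  have h1 := dot2_sesDirection l g s
  rw [h] at h1
  have h2 : dot2 (g s) (g s) * sesDenom l g s ^ 2 ≠ 0 :=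
    mul_ne_zero (dot2_self_ne_zero hg) (pow_ne_zero 2 hd)
  rw [← h1] at h2
  simp [dot2] at h2

/-- For V = A g − B `rot90 g` the frame gives det(V, V') = (A² + B²) p + q (BA' − AB'). Here A² + B²
= D² and BA' − AB' = 2DpE. -/
theorem turning_sesDirection (hl : ContDiff ℝ ∞ l) (hg : ContDiff ℝ ∞ g) (hgs : g s ≠ 0) :
    turning (sesDirection l g) s = sesDenom l g s * (turning g s *
      (sesDenom l g s + 2 * dot2 (g s) (g s) * radiusNum₂ l g s)) := by
  have hq := dot2_self_ne_zero hgs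
  have dl := ContDiff.hasDerivAt_deriv hl s
  have dg := ContDiff.hasDerivAt_deriv hg s
  have dp := ContDiff.hasDerivAt_deriv (contDiff_turning hg) s
  have dn := ContDiff.hasDerivAt_deriv (contDiff_radiusNum hl hg) s
  have dA : HasDerivAt (fun s => radiusNum l g s ^ 2 - l s ^ 2 * turning g s ^ 4)
      (2 * radiusNum l g s * deriv (radiusNum l g) s - (2 * l s * deriv l s * turning g s ^ 4 +
        l s ^ 2 * (4 * turning g s ^ 3 * deriv (turning g) s))) s :=
    ((dn.pow 2).sub ((dl.pow 2).mul (dp.pow 4))).congr_deriv (by simp)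
  have dB : HasDerivAt (fun s => 2 * l s * radiusNum l g s * turning g s ^ 2)
      ((2 * deriv l s * radiusNum l g s + 2 * l s * deriv (radiusNum l g) s) * turning g s ^ 2 +
        2 * l s * radiusNum l g s * (2 * turning g s * deriv (turning g) s)) s :=
    (((dl.const_mul 2).mul dn).mul (dp.pow 2)).congr_deriv (by simp)
  have dG : HasDerivAt (sesDirection l g) _ s := (dA.smul dg).sub (dB.smul dg.rot90)
  rw [turning, dG.deriv, sesDirection]
  have hframe : deriv g s = (dot2 (g s) (deriv g s) / dot2 (g s) (g s)) • g s +
      (turning g s / dot2 (g s) (g s)) • rot90 (g s) := eq_frame hgs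
  have hδ : turning g s / dot2 (g s) (g s) * dot2 (g s) (g s) = turning g s := div_mul_cancel₀ _ hq
  set δ := turning g s / dot2 (g s) (g s)
  have key : ∀ (A B A1 B1 β : ℝ) (v : Plane), det2 (A • v - B • rot90 v)
      (A • (β • v + δ • rot90 v) + A1 • v - (B • rot90 (β • v + δ • rot90 v) + B1 • rot90 v)) =
      (A ^ 2 + B ^ 2) * (δ * dot2 v v) + dot2 v v * (B * A1 - A * B1) := fun A B A1 B1 β v => by
    simp [det2, dot2]; ring
  rw [hframe, key, hδ, sesDenom, radiusNum₂]
  ring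

/-- A recognition criterion for cusps of the singular evolutoids set. -/
theorem hasCuspForm_sesFormula (hl : ContDiff ℝ ∞ l) (hg : ContDiff ℝ ∞ g)
    (hf : ∀ᶠ s in 𝓝 t, HasDerivAt f (l s • g s) s) (hgt : g t ≠ 0) (hd : sesDenom l g t ≠ 0)
    (h0 : l t * radiusNum₂ l g t = 0) (h1 : deriv (fun s => l s * radiusNum₂ l g s) t ≠ 0)
    (h2 : turning g t ≠ 0)
    (h3 : sesDenom l g t + 2 * dot2 (g t) (g t) * radiusNum₂ l g t ≠ 0) :
    HasCuspForm (sesFormula f l g) t := by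
  have hD := contDiff_sesDenom hl hg
  have hE := contDiff_radiusNum₂ hl hg
  have hS : IsOpen {s | sesDenom l g s ≠ 0} := isOpen_ne_fun hD.continuous continuous_const
  have hR : ContDiffOn ℝ ∞ (fun s => dot2 (g s) (g s) / sesDenom l g s ^ 2)
      {s | sesDenom l g s ≠ 0} :=
    (hg.dot2 hg).contDiffOn.div (hD.pow 2).contDiffOn fun x hx => pow_ne_zero 2 hx
  obtain ⟨R, hRc, hRe⟩ := exists_contDiff_eventuallyEq hS hd hR
  refine ⟨fun s => l s * radiusNum₂ l g s * R s, sesDirection l g, (hl.mul hE).mul hRc,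
    contDiff_sesDirection hl hg, ?_, ?_, ?_, ?_⟩
  · filter_upwards [hf, hRe, hS.mem_nhds hd, hg.continuous.continuousAt.eventually_ne hgt]
      with s hs hRs hds hgs
    refine (hasDerivAt_sesFormula hl hg hs hgs hds).congr_deriv ?_
    rw [hRs]
    congr 1
    ring
  · simp only [h0, zero_mul]
  · have hm : HasDerivAt (fun s => l s * radiusNum₂ l g s * R s) _ t :=
      (ContDiff.hasDerivAt_deriv (hl.mul hE) t).mul (ContDiff.hasDerivAt_deriv hRc t)
    rw [hm.deriv, h0, zero_mul, add_zero, hRe.eq_of_nhds]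
    exact mul_ne_zero h1 (div_ne_zero (dot2_self_ne_zero hgt) (pow_ne_zero 2 hd))
  · change turning (sesDirection l g) t ≠ 0
    rw [turning_sesDirection hl hg hgt]
    exact mul_ne_zero hd (mul_ne_zero h2 h3)

theorem HasCuspForm.deriv_eq_zero (h : HasCuspForm γ t) : deriv γ t = 0 := by
  obtain ⟨l, g, hl, hg, hd, h0, h1, h2⟩ := h
  rw [hd.self_of_nhds.deriv, h0, zero_smul]

theorem HasCuspForm.deriv_deriv_ne_zero (h : HasCuspForm γ t) : deriv (deriv γ) t ≠ 0 := by
  obtain ⟨l, g, hl, hg, hd, h0, h1, h2⟩ := h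
  have e : deriv γ =ᶠ[𝓝 t] fun s => l s • g s := hd.mono fun s hs => hs.deriv
  have h3 : HasDerivAt (fun s => l s • g s) _ t :=
    (ContDiff.hasDerivAt_deriv hl t).smul (ContDiff.hasDerivAt_deriv hg t)
  rw [e.deriv_eq, h3.deriv, h0, zero_smul, zero_add]
  refine smul_ne_zero h1 ?_
  intro h4
  simp [h4, det2] at h2

/-! ### Inflexions of curves with nonvanishing velocity `l • g` -/

theorem isNondegenerate_iff (hγ : ContDiff ℝ ∞ γ) :
    IsNondegenerate γ t ↔ deriv (turning (deriv γ)) t ≠ 0 := by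
  have h1 := ContDiff.deriv_top hγ
  have h2 := ContDiff.deriv_top h1
  have h3 := (ContDiff.hasDerivAt_deriv h1 t).det2 (ContDiff.hasDerivAt_deriv h2 t)
  rw [IsNondegenerate, show iteratedDeriv 3 γ = deriv (deriv (deriv γ)) by
    simp [iteratedDeriv_succ, iteratedDeriv_zero], show turning (deriv γ) =
    fun s => det2 (deriv γ s) (deriv (deriv γ) s) from rfl, h3.deriv, det2_self, zero_add]

theorem changesSignAt_of_deriv_ne_zero {h : ℝ → ℝ} {h' : ℝ} (hd : HasDerivAt h h' t) (h0 : h t = 0)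
    (hh : h' ≠ 0) : ChangesSignAt h t := by
  have key : ∀ {h : ℝ → ℝ} {h' : ℝ}, HasDerivAt h h' t → h t = 0 → 0 < h' →
      (∀ᶠ s in 𝓝[<] t, h s < 0) ∧ (∀ᶠ s in 𝓝[>] t, 0 < h s) := by
    intro h h' hd h0 hh
    have h1 := (hasDerivAt_iff_tendsto_slope.1 hd).eventually (lt_mem_nhds hh)
    constructor
    · filter_upwards [h1.filter_mono (nhdsWithin_mono t fun x (hx : x < t) => hx.ne),
        self_mem_nhdsWithin] with s hs hst
      rw [slope_def_field, h0, sub_zero] at hs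
      by_contra hc
      exact absurd hs (not_lt.2 (div_nonpos_of_nonneg_of_nonpos (not_lt.1 hc)
        (sub_nonpos.2 (le_of_lt hst))))
    · filter_upwards [h1.filter_mono (nhdsWithin_mono t fun x (hx : t < x) => hx.ne'),
        self_mem_nhdsWithin] with s hs hst
      rw [slope_def_field, h0, sub_zero] at hs
      by_contra hc
      exact absurd hs (not_lt.2 (div_nonpos_of_nonpos_of_nonneg (not_lt.1 hc)
        (sub_nonneg.2 (le_of_lt hst))))
  rcases hh.lt_or_gt with hh | hh
  · refine Or.inr ?_
    have := key hd.neg (by simp [h0]) (neg_pos.2 hh)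
    simpa using this
  · exact Or.inl (key hd h0 hh)

theorem ChangesSignAt.eq_zero {h : ℝ → ℝ} (hs : ChangesSignAt h t) (hc : ContinuousAt h t) :
    h t = 0 := by
  have hl := hc.tendsto.mono_left (nhdsWithin_le_nhds (s := Iio t))
  have hr := hc.tendsto.mono_left (nhdsWithin_le_nhds (s := Ioi t))
  rcases hs with ⟨h1, h2⟩ | ⟨h1, h2⟩
  · exact le_antisymm (le_of_tendsto hl (h1.mono fun _ => le_of_lt))
      (ge_of_tendsto hr (h2.mono fun _ => le_of_lt))
  · exact le_antisymm (le_of_tendsto hr (h2.mono fun _ => le_of_lt))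
      (ge_of_tendsto hl (h1.mono fun _ => le_of_lt))

theorem continuousAt_curvature (hγ : ContDiff ℝ ∞ γ) (h : deriv γ t ≠ 0) :
    ContinuousAt (curvature γ) t :=
  (contDiff_turning (ContDiff.deriv_top hγ)).continuous.continuousAt.div
    ((ContDiff.deriv_top hγ).continuous.norm.pow 3).continuousAt
    (pow_ne_zero 3 (norm_ne_zero_iff.2 h))

theorem isInflexion_or_isUndulation_iff (hγ : ContDiff ℝ ∞ γ) :
    IsInflexion γ t ∨ IsUndulation γ t ↔ deriv γ t ≠ 0 ∧ turning (deriv γ) t = 0 := by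
  constructor
  · rintro (⟨h1, h2⟩ | ⟨h1, h2, -⟩)
    · exact ⟨h1, (curvature_eq_zero_iff h1).1 (h2.eq_zero (continuousAt_curvature hγ h1))⟩
    · exact ⟨h1, (curvature_eq_zero_iff h1).1 h2⟩
  · rintro ⟨h1, h2⟩
    by_cases hc : ChangesSignAt (curvature γ) t
    · exact Or.inl ⟨h1, hc⟩
    · exact Or.inr ⟨h1, (curvature_eq_zero_iff h1).2 h2, hc⟩

theorem changesSignAt_curvature (hγ : ContDiff ℝ ∞ γ) (h : deriv γ t ≠ 0)
    (h0 : turning (deriv γ) t = 0) (h1 : deriv (turning (deriv γ)) t ≠ 0) :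
    ChangesSignAt (curvature γ) t := by
  have hγ' := ContDiff.deriv_top hγ
  have hn : ‖deriv γ t‖ ≠ 0 := norm_ne_zero_iff.2 h
  refine changesSignAt_of_deriv_ne_zero ((ContDiff.hasDerivAt_deriv (contDiff_turning hγ') t).div
    ((hasDerivAt_norm_plane (ContDiff.hasDerivAt_deriv hγ' t) h).pow 3) (pow_ne_zero 3 hn)) ?_ ?_
  · rw [(curvature_eq_zero_iff h).2 h0]
  · rw [h0, zero_mul, sub_zero]
    simp [h, h1]

variable {l : ℝ → ℝ} {g f γ γ' : ℝ → Plane} {s t : ℝ}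

/-! ### Germs -/

theorem curvature_congr (e : γ =ᶠ[𝓝 t] γ') : curvature γ =ᶠ[𝓝 t] curvature γ' := by
  filter_upwards [e.deriv, e.deriv.deriv] with s h1 h2
  rw [curvature, curvature, h1, h2]

theorem arcDeriv_congr {h h' : ℝ → ℝ} (e : γ =ᶠ[𝓝 t] γ') (eh : h =ᶠ[𝓝 t] h') :
    arcDeriv γ h =ᶠ[𝓝 t] arcDeriv γ' h' := by
  filter_upwards [e.deriv, eh.deriv] with s h1 h2
  rw [arcDeriv, arcDeriv, h1, h2]

theorem radius_congr (e : γ =ᶠ[𝓝 t] γ') : radius γ =ᶠ[𝓝 t] radius γ' := by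
  filter_upwards [e.deriv, curvature_congr e] with s h1 h2
  rw [radius, radius, h1, h2]

theorem radius₁_congr (e : γ =ᶠ[𝓝 t] γ') : radius₁ γ =ᶠ[𝓝 t] radius₁ γ' :=
  arcDeriv_congr e (radius_congr e)

theorem radius₂_congr (e : γ =ᶠ[𝓝 t] γ') : radius₂ γ =ᶠ[𝓝 t] radius₂ γ' :=
  arcDeriv_congr e (radius₁_congr e)

theorem radius₃_congr (e : γ =ᶠ[𝓝 t] γ') : radius₃ γ =ᶠ[𝓝 t] radius₃ γ' :=
  arcDeriv_congr e (radius₂_congr e)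

theorem sesCurve_congr (e : γ =ᶠ[𝓝 t] γ') : sesCurve γ =ᶠ[𝓝 t] sesCurve γ' := by
  filter_upwards [e, e.deriv, curvature_congr e, radius_congr e, radius₁_congr e]
    with s h1 h2 h3 h4 h5
  simp only [sesCurve, unitNormal, unitTangent, h1, h2, h3, h4, h5]

theorem evolutoid_congr (e : γ =ᶠ[𝓝 t] γ') (α : ℝ) :
    evolutoid γ α =ᶠ[𝓝 t] evolutoid γ' α := by
  filter_upwards [e, e.deriv, radius_congr e] with s h1 h2 h3
  simp only [evolutoid, unitTangent, h1, h2, h3]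

theorem changesSignAt_congr {h h' : ℝ → ℝ} (e : h =ᶠ[𝓝 t] h') :
    ChangesSignAt h t ↔ ChangesSignAt h' t := by
  have key : ∀ (s : Set ℝ) (p : ℝ → Prop), (∀ᶠ x in 𝓝[s] t, p (h x)) ↔ ∀ᶠ x in 𝓝[s] t, p (h' x) :=
    fun s p => eventually_congr ((e.filter_mono nhdsWithin_le_nhds).mono fun x hx => by
      simp only [hx])
  simp only [ChangesSignAt, key _ fun y => y < 0, key _ fun y => 0 < y]

theorem isInflexion_congr (e : γ =ᶠ[𝓝 t] γ') : IsInflexion γ t ↔ IsInflexion γ' t := by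
  rw [IsInflexion, IsInflexion, e.deriv_eq, changesSignAt_congr (curvature_congr e)]

theorem isUndulation_congr (e : γ =ᶠ[𝓝 t] γ') : IsUndulation γ t ↔ IsUndulation γ' t := by
  rw [IsUndulation, IsUndulation, e.deriv_eq, changesSignAt_congr (curvature_congr e),
    (curvature_congr e).eq_of_nhds]

theorem isNondegenerate_congr (e : γ =ᶠ[𝓝 t] γ') : IsNondegenerate γ t ↔ IsNondegenerate γ' t := by
  rw [IsNondegenerate, IsNondegenerate, e.deriv_eq, e.iteratedDeriv_eq]

theorem hasFiniteContact_congr (e : γ =ᶠ[𝓝 t] γ') :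
    HasFiniteContact γ t ↔ HasFiniteContact γ' t := by
  simp only [HasFiniteContact, e.deriv_eq, e.iteratedDeriv_eq]

theorem isFlat_congr (e : γ =ᶠ[𝓝 t] γ') : IsFlat γ t ↔ IsFlat γ' t := by
  rw [IsFlat, IsFlat, e.deriv_eq, (curvature_congr e).eq_of_nhds]

theorem isCusp_congr (e : γ =ᶠ[𝓝 t] γ') : IsCusp γ t ↔ IsCusp γ' t :=
  ⟨fun h => h.congr e, fun h => h.congr e.symm⟩

theorem HasCuspForm.congr (h : HasCuspForm γ t) (e : γ =ᶠ[𝓝 t] γ') : HasCuspForm γ' t := by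
  obtain ⟨l, g, hl, hg, hd, h'⟩ := h
  refine ⟨l, g, hl, hg, ?_, h'⟩
  filter_upwards [hd, e.eventuallyEq_nhds] with s h1 h2
  exact h1.congr_of_eventuallyEq h2.symm

theorem isCusp_iff_hasCuspForm {Γ : ℝ → Plane} (hΓ : ContDiff ℝ ∞ Γ) (e : Γ =ᶠ[𝓝 t] γ) :
    IsCusp γ t ↔ HasCuspForm γ t := by
  refine ⟨fun h => h.hasCuspForm (hΓ.continuous.continuousAt.congr e), fun h => ?_⟩
  exact ((h.congr e.symm).isCusp hΓ).congr e

/-! ### The singular evolutoids set near a regular point -/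

/-- The numerator of the curvature of the singular evolutoids set. -/
def sesTurning (g : ℝ → Plane) (s : ℝ) : ℝ :=
  turning g s * (sesDenom (fun _ => 1) g s +
    2 * dot2 (g s) (g s) * radiusNum₂ (fun _ => 1) g s)

theorem contDiff_sesTurning (hg : ContDiff ℝ ∞ g) : ContDiff ℝ ∞ (sesTurning g) :=
  (contDiff_turning hg).mul ((contDiff_sesDenom contDiff_const hg).add
    ((contDiff_const.mul (hg.dot2 hg)).mul (contDiff_radiusNum₂ contDiff_const hg)))

theorem exists_contDiff_sesCurve (hf : ContDiff ℝ ∞ f)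
    (hd : sesDenom (fun _ => 1) (deriv f) t ≠ 0) :
    ∃ Γ : ℝ → Plane, ContDiff ℝ ∞ Γ ∧ Γ =ᶠ[𝓝 t] sesCurve f := by
  have hf' := ContDiff.deriv_top hf
  have hD := contDiff_sesDenom contDiff_const hf' (l := fun _ => 1)
  have hS : IsOpen {s | sesDenom (fun _ => 1) (deriv f) s ≠ 0} :=
    isOpen_ne_fun hD.continuous continuous_const
  rw [show sesCurve f = sesFormula f (fun _ => 1) (deriv f) from funext (sesCurve_eq hf)]
  exact exists_contDiff_eventuallyEq hS hd fun s hs =>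
    (contDiffAt_sesFormula hf contDiff_const hf' hs).contDiffWithinAt

theorem sesDenom_one_ne_zero (hp : turning g t ≠ 0) : sesDenom (fun _ => 1) g t ≠ 0 := by
  rw [sesDenom_one]; positivity

section

variable (hf : ContDiff ℝ ∞ f) (h : deriv f t ≠ 0)
  (hd : sesDenom (fun _ => 1) (deriv f) t ≠ 0)
include hf h hd

theorem hasDerivAt_sesCurve : HasDerivAt (sesCurve f) ((dot2 (deriv f t) (deriv f t) *
    radiusNum₂ (fun _ => 1) (deriv f) t / sesDenom (fun _ => 1) (deriv f) t ^ 2) •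
    sesDirection (fun _ => 1) (deriv f) t) t := by
  rw [show sesCurve f = sesFormula f (fun _ => 1) (deriv f) from funext (sesCurve_eq hf)]
  have h1 : HasDerivAt f ((fun _ : ℝ => (1 : ℝ)) t • deriv f t) t := by
    simpa using ContDiff.hasDerivAt_deriv hf t
  simpa using hasDerivAt_sesFormula contDiff_const (ContDiff.deriv_top hf) h1 h hd

theorem deriv_sesCurve_eq_zero_iff :
    deriv (sesCurve f) t = 0 ↔ radiusNum₂ (fun _ => 1) (deriv f) t = 0 := by
  rw [(hasDerivAt_sesCurve hf h hd).deriv, smul_eq_zero, or_iff_left (sesDirection_ne_zero h hd),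
    div_eq_zero_iff, or_iff_left (pow_ne_zero 2 hd), mul_eq_zero,
    or_iff_right (dot2_self_ne_zero h)]

/-- The factor q/D² is replaced by a globally smooth function with the same germ, so that the
velocity can be differentiated further without tracking the domain D ≠ 0. -/
theorem deriv_sesCurve_eventuallyEq : ∃ k : ℝ → ℝ, ContDiff ℝ ∞ k ∧ k t ≠ 0 ∧
    deriv (sesCurve f) =ᶠ[𝓝 t] fun s => (k s * radiusNum₂ (fun _ => 1) (deriv f) s) •
      sesDirection (fun _ => 1) (deriv f) s := by
  have hf' := ContDiff.deriv_top hf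
  have hD := contDiff_sesDenom contDiff_const hf' (l := fun _ => 1)
  have hS : IsOpen {s | sesDenom (fun _ => 1) (deriv f) s ≠ 0} :=
    isOpen_ne_fun hD.continuous continuous_const
  have hR : ContDiffOn ℝ ∞
      (fun s => dot2 (deriv f s) (deriv f s) / sesDenom (fun _ => 1) (deriv f) s ^ 2)
      {s | sesDenom (fun _ => 1) (deriv f) s ≠ 0} :=
    (hf'.dot2 hf').contDiffOn.div (hD.pow 2).contDiffOn fun x hx => pow_ne_zero 2 hx
  obtain ⟨k, hk, e⟩ := exists_contDiff_eventuallyEq hS hd hR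
  refine ⟨k, hk, ?_, ?_⟩
  · rw [e.eq_of_nhds]
    exact div_ne_zero (dot2_self_ne_zero h) (pow_ne_zero 2 hd)
  · filter_upwards [e, hS.mem_nhds hd, hf'.continuous.continuousAt.eventually_ne h] with s h1 h2 h3
    rw [(hasDerivAt_sesCurve hf h3 h2).deriv, h1]
    congr 1
    ring

/-- The curvature of γ_SES has numerator k E² · `sesTurning` with k(t) ≠ 0. At regular points of
γ_SES also E ≠ 0, so the zeros of the curvature and their simplicity are those of `sesTurning`. -/
theorem turning_deriv_sesCurve : ∃ k : ℝ → ℝ, ContDiff ℝ ∞ k ∧ k t ≠ 0 ∧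
    turning (deriv (sesCurve f)) =ᶠ[𝓝 t] fun s =>
      k s * radiusNum₂ (fun _ => 1) (deriv f) s ^ 2 * sesTurning (deriv f) s := by
  have hf' := ContDiff.deriv_top hf
  have hD := contDiff_sesDenom contDiff_const hf' (l := fun _ => 1)
  have hE := contDiff_radiusNum₂ contDiff_const hf' (l := fun _ => 1)
  obtain ⟨k, hk, hkt, e⟩ := deriv_sesCurve_eventuallyEq hf h hd
  refine ⟨fun s => k s ^ 2 * sesDenom (fun _ => 1) (deriv f) s, (hk.pow 2).mul hD,
    mul_ne_zero (pow_ne_zero 2 hkt) hd, ?_⟩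
  filter_upwards [turning_smul_eventuallyEq e
    (Eventually.of_forall fun x => (hk.mul hE).differentiable (by simp) x)
    (contDiff_sesDirection contDiff_const hf'),
    hf'.continuous.continuousAt.eventually_ne h] with s h1 h2
  rw [h1, turning_sesDirection contDiff_const hf' h2, sesTurning]
  ring

theorem inflexion_or_undulation_sesCurve_iff :
    IsInflexion (sesCurve f) t ∨ IsUndulation (sesCurve f) t ↔
      radiusNum₂ (fun _ => 1) (deriv f) t ≠ 0 ∧ sesTurning (deriv f) t = 0 := by
  obtain ⟨Γ, hΓ, e⟩ := exists_contDiff_sesCurve hf hd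
  obtain ⟨k, hk, hkt, ek⟩ := turning_deriv_sesCurve hf h hd
  rw [← isInflexion_congr e, ← isUndulation_congr e, isInflexion_or_isUndulation_iff hΓ,
    e.deriv_eq, turning_congr e.deriv, ne_eq, deriv_sesCurve_eq_zero_iff hf h hd, ek.eq_of_nhds]
  refine and_congr_right fun h1 => ?_
  simp [hkt, h1]

theorem deriv_turning_sesCurve_ne_zero_iff (h1 : radiusNum₂ (fun _ => 1) (deriv f) t ≠ 0)
    (h2 : sesTurning (deriv f) t = 0) :
    deriv (turning (deriv (sesCurve f))) t ≠ 0 ↔ deriv (sesTurning (deriv f)) t ≠ 0 := by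
  have hf' := ContDiff.deriv_top hf
  have hE := contDiff_radiusNum₂ contDiff_const hf' (l := fun _ => 1)
  obtain ⟨k, hk, hkt, ek⟩ := turning_deriv_sesCurve hf h hd
  have h3 : HasDerivAt (fun s =>
      k s * radiusNum₂ (fun _ => 1) (deriv f) s ^ 2 * sesTurning (deriv f) s) _ t :=
    (ContDiff.hasDerivAt_deriv (hk.mul (hE.pow 2)) t).mul
      (ContDiff.hasDerivAt_deriv (contDiff_sesTurning hf') t)
  rw [ek.deriv_eq, h3.deriv, h2, mul_zero, zero_add]
  simp [hkt, h1]

theorem nondegenerate_sesCurve_iff (h1 : radiusNum₂ (fun _ => 1) (deriv f) t ≠ 0)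
    (h2 : sesTurning (deriv f) t = 0) :
    IsNondegenerate (sesCurve f) t ↔ deriv (sesTurning (deriv f)) t ≠ 0 := by
  obtain ⟨Γ, hΓ, e⟩ := exists_contDiff_sesCurve hf hd
  have e' : turning (deriv Γ) =ᶠ[𝓝 t] turning (deriv (sesCurve f)) :=
    e.deriv.eventuallyEq_nhds.mono fun s hs => turning_congr hs
  rw [← isNondegenerate_congr e, isNondegenerate_iff hΓ, e'.deriv_eq,
    deriv_turning_sesCurve_ne_zero_iff hf h hd h1 h2]

/-- A simple zero of the curvature is a change of sign. -/
theorem not_isUndulation_sesCurve (h3 : sesTurning (deriv f) t = 0 →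
    deriv (sesTurning (deriv f)) t ≠ 0) : ¬ IsUndulation (sesCurve f) t := by
  intro hu
  obtain ⟨h1, h2⟩ := (inflexion_or_undulation_sesCurve_iff hf h hd).1 (Or.inr hu)
  obtain ⟨Γ, hΓ, e⟩ := exists_contDiff_sesCurve hf hd
  have e' : turning (deriv Γ) =ᶠ[𝓝 t] turning (deriv (sesCurve f)) :=
    e.deriv.eventuallyEq_nhds.mono fun s hs => turning_congr hs
  have h4 : deriv (turning (deriv Γ)) t ≠ 0 := by
    rw [e'.deriv_eq]
    exact (deriv_turning_sesCurve_ne_zero_iff hf h hd h1 h2).2 (h3 h2)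
  rw [← isUndulation_congr e] at hu
  exact hu.2.2 (changesSignAt_curvature hΓ hu.1 ((curvature_eq_zero_iff hu.1).1 hu.2.1) h4)

/-- Where E = 0 the factor D + 2qE equals D ≠ 0, so the direction turns automatically and only the
simplicity of the zero of E has to be assumed. -/
theorem isCusp_sesCurve_of (hp : turning (deriv f) t ≠ 0)
    (h0 : radiusNum₂ (fun _ => 1) (deriv f) t = 0)
    (h1 : deriv (radiusNum₂ (fun _ => 1) (deriv f)) t ≠ 0) : IsCusp (sesCurve f) t := by
  have hf' := ContDiff.deriv_top hf
  obtain ⟨Γ, hΓ, e⟩ := exists_contDiff_sesCurve hf hd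
  rw [isCusp_iff_hasCuspForm hΓ e, show sesCurve f = sesFormula f (fun _ => 1) (deriv f) from
    funext (sesCurve_eq hf)]
  refine hasCuspForm_sesFormula contDiff_const hf' (Eventually.of_forall fun s => ?_) h hd ?_ ?_ hp ?_
  · simpa using ContDiff.hasDerivAt_deriv hf s
  · simp [h0]
  · simpa using h1
  · simpa [h0] using hd

/-- A cusp has nonzero second derivative, whereas a double zero of E would make the second
derivative of γ_SES vanish. -/
theorem deriv_radiusNum₂_ne_zero_of_isCusp (hc : IsCusp (sesCurve f) t) :
    deriv (radiusNum₂ (fun _ => 1) (deriv f)) t ≠ 0 := by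
  have hf' := ContDiff.deriv_top hf
  have hE := contDiff_radiusNum₂ contDiff_const hf' (l := fun _ => 1)
  obtain ⟨Γ, hΓ, e⟩ := exists_contDiff_sesCurve hf hd
  have hc' := (isCusp_iff_hasCuspForm hΓ e).1 hc
  have h0 := (deriv_sesCurve_eq_zero_iff hf h hd).1 hc'.deriv_eq_zero
  obtain ⟨k, hk, hkt, ek⟩ := deriv_sesCurve_eventuallyEq hf h hd
  intro h1
  apply hc'.deriv_deriv_ne_zero
  have h3 : HasDerivAt (fun s => (k s * radiusNum₂ (fun _ => 1) (deriv f) s) •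
      sesDirection (fun _ => 1) (deriv f) s) _ t :=
    ((ContDiff.hasDerivAt_deriv hk t).mul (ContDiff.hasDerivAt_deriv hE t)).smul
    (ContDiff.hasDerivAt_deriv (contDiff_sesDirection contDiff_const hf') t)
  rw [ek.deriv_eq, h3.deriv]
  simp [h0, h1]

end

/-! ### The singular evolutoids set near a cusp -/

/-- At the zero of l one finds N = l'qp ≠ 0, D = N² and E = −l'Np, so 2qE = −2N² and D + 2qE = −N² ≠
0. Moreover l E has a simple zero, so γ_SES again satisfies the cusp criterion. -/
theorem sesCurve_of_hasCuspForm (hf : ContDiff ℝ ∞ f) (hc : HasCuspForm f t) :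
    (∃ Γ : ℝ → Plane, ContDiff ℝ ∞ Γ ∧ Γ =ᶠ[𝓝 t] sesCurve f) ∧ IsCusp (sesCurve f) t := by
  have hc0 := hc.deriv_eq_zero
  obtain ⟨l, g, hl, hg, hd, h0, h1, h2⟩ := hc
  have hgt : g t ≠ 0 := fun h => h2 (by simp [h, det2])
  have hq := dot2_self_ne_zero hgt
  have hp : turning g t ≠ 0 := h2
  have hn : radiusNum l g t = deriv l t * (dot2 (g t) (g t) * turning g t) := by
    simp [radiusNum, h0]
  have hn0 : radiusNum l g t ≠ 0 := by
    rw [hn]; exact mul_ne_zero h1 (mul_ne_zero hq hp)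
  have hD : sesDenom l g t ≠ 0 := by
    simp [sesDenom, h0, hn0]
  have e : sesCurve f =ᶠ[𝓝 t] sesFormula f l g := by
    -- Since l'(t) ≠ 0, l has no other zero near t; off t the two factorizations of the velocity
    -- give the same curve, and at t both expressions equal f(t).
    have h3 := (ContDiff.hasDerivAt_deriv hl t).eventually_ne h1 (c := 0)
    rw [eventually_nhdsWithin_iff] at h3
    filter_upwards [h3, hd.eventually_nhds] with s h4 h5
    by_cases hst : s = t
    · rw [hst, sesCurve, if_pos (Or.inl hc0), sesFormula, h0]
      simp
    · rw [sesCurve_eq hf, sesFormula_one_eq hl hg (h5.mono fun x hx => hx.deriv) (h4 hst)]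
  have hS : IsOpen {s | sesDenom l g s ≠ 0} :=
    isOpen_ne_fun (contDiff_sesDenom hl hg).continuous continuous_const
  obtain ⟨Γ, hΓ, eΓ⟩ := exists_contDiff_eventuallyEq hS hD fun s hs =>
    (contDiffAt_sesFormula hf hl hg hs).contDiffWithinAt
  have eΓ' := eΓ.trans e.symm
  refine ⟨⟨Γ, hΓ, eΓ'⟩, (isCusp_iff_hasCuspForm hΓ eΓ').2 (HasCuspForm.congr ?_ e.symm)⟩
  have he : radiusNum₂ l g t = -(deriv l t * radiusNum l g t * turning g t) := by
    simp [radiusNum₂, h0]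
  refine hasCuspForm_sesFormula hl hg hd hgt hD (by rw [h0, zero_mul]) ?_ hp ?_
  · have h3 : HasDerivAt (fun s => l s * radiusNum₂ l g s) _ t :=
      (ContDiff.hasDerivAt_deriv hl t).mul
        (ContDiff.hasDerivAt_deriv (contDiff_radiusNum₂ hl hg) t)
    rw [h3.deriv, h0, zero_mul, add_zero, he]
    exact mul_ne_zero h1 (neg_ne_zero.2 (mul_ne_zero (mul_ne_zero h1 hn0) hp))
  · have : sesDenom l g t + 2 * dot2 (g t) (g t) * radiusNum₂ l g t =
        -(radiusNum l g t * (deriv l t * (dot2 (g t) (g t) * turning g t))) := by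
      rw [sesDenom, he, h0]
      linear_combination (radiusNum l g t) * hn
    rw [this, ← hn]
    exact neg_ne_zero.2 (mul_ne_zero hn0 hn0)

variable {l : ℝ → ℝ} {g f γ γ' : ℝ → Plane} {s t : ℝ}

/-! ### Flat points of finite contact -/

theorem iteratedDeriv_det2_const {F : ℝ → Plane} (hF : ContDiff ℝ ∞ F) (e : Plane) (k : ℕ) (s : ℝ) :
    iteratedDeriv k (fun s => det2 e (F s)) s = det2 e (iteratedDeriv k F s) := by
  induction k generalizing F with
  | zero => simp
  | succ k ih =>
    have h1 : deriv (fun s => det2 e (F s)) = fun s => det2 e (deriv F s) := funext fun s => by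
      rw [((hasDerivAt_const s e).det2 (ContDiff.hasDerivAt_deriv hF s)).deriv]
      simp [det2]
    rw [iteratedDeriv_succ', h1, ih (ContDiff.deriv_top hF), iteratedDeriv_succ']

/-- For e = f'(t), finite contact says that det(e, f') vanishes at t to a finite order i + 1, so its
derivative det(e, f'') has order i. In |e|² det(f', f'') = (e·f') det(e, f'') − det(e, f') (e·f'')
the first term has order exactly i and the second at least i + 1. -/
theorem exists_turning_eq_pow_mul (hf : ContDiff ℝ ∞ f) (h : deriv f t ≠ 0)
    (hc : HasFiniteContact f t) :
    ∃ (k : ℕ) (m : ℝ → ℝ), ContDiff ℝ ∞ m ∧ m t ≠ 0 ∧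
      ∀ s, turning (deriv f) s = (s - t) ^ k * m s := by
  obtain ⟨k, hk⟩ := hc
  have hf' := ContDiff.deriv_top hf
  have hf'' := ContDiff.deriv_top hf'
  set e := deriv f t with he
  have hq := dot2_self_ne_zero h
  have hH : ContDiff ℝ ∞ fun s => det2 e (deriv f s) := contDiff_const.det2 hf'
  have ha : ContDiff ℝ ∞ fun s => dot2 e (deriv f s) := contDiff_const.dot2 hf'
  rw [iteratedDeriv_succ', ← iteratedDeriv_det2_const hf'] at hk
  obtain ⟨j, B, hB, hBt, eB⟩ := exists_eq_pow_mul hH hk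
  obtain _ | i := j
  · have := eB t
    rw [← he, det2_self, pow_zero, one_mul] at this
    exact absurd this.symm hBt
  have hB' := ContDiff.deriv_top hB
  have hv : ContDiff ℝ ∞ fun s : ℝ => s - t := contDiff_id.sub contDiff_const
  refine ⟨i, fun s => (dot2 e (deriv f s) * ((i + 1) * B s + (s - t) * deriv B s) -
    (s - t) * B s * dot2 e (deriv (deriv f) s)) / dot2 e e, ?_, ?_, fun s => ?_⟩
  · exact ((ha.mul ((contDiff_const.mul hB).add (hv.mul hB'))).sub ((hv.mul hB).mul
      ((contDiff_const (c := e)).dot2 hf''))).div_const _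
  · have : (i : ℝ) + 1 ≠ 0 := by positivity
    simp [← he, hq, hBt, this]
  · have h1 : HasDerivAt (fun s => det2 e (deriv f s)) (det2 e (deriv (deriv f) s)) s :=
      ((hasDerivAt_const s e).det2 (ContDiff.hasDerivAt_deriv hf' s)).congr_deriv (by simp [det2])
    have h2 := ((((hasDerivAt_id s).sub_const t).pow (i + 1)).mul
      (ContDiff.hasDerivAt_deriv hB s))
    have h3 : det2 e (deriv (deriv f) s) = (s - t) ^ i * ((i + 1) * B s + (s - t) * deriv B s) := by
      rw [funext eB] at h1
      rw [h1.unique h2]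
      simp
      ring
    have h4 : ∀ x y : Plane,
        dot2 e e * det2 x y = dot2 e x * det2 e y - det2 e x * dot2 e y := fun x y => by
      simp [dot2, det2]; ring
    rw [mul_div_assoc', eq_div_iff hq, mul_comm, turning, h4, h3, eB]
    ring

/-- If p has order i + 1 at t, then N has order i, because N is −q p' up to a multiple of p.
Cancelling (s − t)^(2i) in numerator and denominator leaves f + (s − t) R with R smooth and R(t) =
f'(t)/(i + 1), so the velocity at t is (1 + 1/(i + 1)) f'(t). -/
theorem sesCurve_of_flat (hf : ContDiff ℝ ∞ f) (h : deriv f t ≠ 0) (hp : turning (deriv f) t = 0)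
    (hc : HasFiniteContact f t) :
    (∃ Γ : ℝ → Plane, ContDiff ℝ ∞ Γ ∧ Γ =ᶠ[𝓝 t] sesCurve f) ∧ deriv (sesCurve f) t ≠ 0 := by
  have hf' := ContDiff.deriv_top hf
  have hf'' := ContDiff.deriv_top hf'
  have hq := dot2_self_ne_zero h
  obtain ⟨k, m, hm, hmt, em⟩ := exists_turning_eq_pow_mul hf h hc
  obtain _ | i := k
  · have := em t
    rw [hp, pow_zero, one_mul] at this
    exact absurd this.symm hmt
  have hm' := ContDiff.deriv_top hm
  have hv : ContDiff ℝ ∞ fun s : ℝ => s - t := contDiff_id.sub contDiff_const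
  have hi : (i : ℝ) + 1 ≠ 0 := by positivity
  -- the numerator of the derivative of the radius, divided by a power of `s - t`
  let W : ℝ → ℝ := fun s => 3 * dot2 (deriv f s) (deriv (deriv f) s) * ((s - t) * m s) -
    dot2 (deriv f s) (deriv f s) * ((i + 1) * m s + (s - t) * deriv m s)
  have hW : ContDiff ℝ ∞ W := ((contDiff_const.mul (hf'.dot2 hf'')).mul (hv.mul hm)).sub
    ((hf'.dot2 hf').mul ((contDiff_const.mul hm).add (hv.mul hm')))
  have hWt : W t = -(dot2 (deriv f t) (deriv f t) * ((i + 1) * m t)) := by simp [W]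
  have hWt0 : W t ≠ 0 := by
    rw [hWt]; exact neg_ne_zero.2 (mul_ne_zero hq (mul_ne_zero hi hmt))
  have eW : ∀ s, radiusNum (fun _ => 1) (deriv f) s = (s - t) ^ i * W s := fun s => by
    have h2 : HasDerivAt (fun s => (s - t) ^ (i + 1) * m s) _ s :=
      ((((hasDerivAt_id s).sub_const t).pow (i + 1)).mul (ContDiff.hasDerivAt_deriv hm s))
    rw [radiusNum_one, show turning (deriv f) = fun s => (s - t) ^ (i + 1) * m s from funext em,
      h2.deriv]
    simp [W]
    ring
  let δ : ℝ → ℝ := fun s => (s - t) ^ (2 * i + 4) * m s ^ 4 + W s ^ 2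
  have hδ : ContDiff ℝ ∞ δ := ((hv.pow _).mul (hm.pow 4)).add (hW.pow 2)
  have hδt : δ t = W t ^ 2 := by simp [δ]
  have hδt0 : δ t ≠ 0 := by rw [hδt]; exact pow_ne_zero 2 hWt0
  have hS : IsOpen {s | δ s ≠ 0} := isOpen_ne_fun hδ.continuous continuous_const
  have hR0 : ContDiffOn ℝ ∞ (fun s => (dot2 (deriv f s) (deriv f s) * m s / δ s) •
      (((s - t) ^ (i + 2) * m s ^ 2) • rot90 (deriv f s) - W s • deriv f s)) {s | δ s ≠ 0} :=
    (((hf'.dot2 hf').mul hm).contDiffOn.div hδ.contDiffOn fun x hx => hx).smul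
      (((((hv.pow _).mul (hm.pow 2)).smul hf'.rot90).sub (hW.smul hf')).contDiffOn)
  obtain ⟨R, hR, eR⟩ := exists_contDiff_eventuallyEq hS hδt0 hR0
  have e : sesCurve f =ᶠ[𝓝 t] fun s => f s + (s - t) • R s := by
    filter_upwards [eR, hS.mem_nhds hδt0] with s h1 h2
    rw [sesCurve_eq hf]
    by_cases hst : s - t = 0
    · have : s = t := sub_eq_zero.1 hst
      rw [this, sesFormula, hp]
      simp
    · have hd : sesDenom (fun _ => 1) (deriv f) s = (s - t) ^ (2 * i) * δ s := by
        rw [sesDenom_one, em, eW]; ring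
      have h2' : δ s ≠ 0 := h2
      rw [sesFormula, h1, hd, em, eW]
      congr 1
      apply plane_ext <;> simp <;> field_simp <;> ring
  have hd : HasDerivAt (fun s => f s + (s - t) • R s) (deriv f t + R t) t := by
    have h1 : HasDerivAt (fun s => (s - t) • R s) _ t :=
      ((hasDerivAt_id t).sub_const t).smul (ContDiff.hasDerivAt_deriv hR t)
    refine ((ContDiff.hasDerivAt_deriv hf t).add h1).congr_deriv ?_
    simp
  refine ⟨⟨_, hf.add (hv.smul hR), e.symm⟩, ?_⟩
  have hRt : deriv f t + R t = (1 + 1 / ((i : ℝ) + 1)) • deriv f t := by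
    rw [eR.eq_of_nhds, add_smul, one_smul, hδt]
    congr 1
    rw [show ((t - t) ^ (i + 2) * m t ^ 2) • rot90 (deriv f t) = 0 by simp, zero_sub, smul_neg,
      smul_smul, ← neg_smul]
    congr 1
    rw [hWt]
    field_simp
  rw [e.deriv_eq, hd.deriv, hRt]
  exact smul_ne_zero (by positivity) h

/-! ### The numerator of the curvature in terms of the radius of curvature -/

theorem hasDerivAt_unitTangent (hf : ContDiff ℝ ∞ f) (h : deriv f t ≠ 0) : HasDerivAt (unitTangent f)
    ((turning (deriv f) t / ‖deriv f t‖ ^ 2) • rot90 (unitTangent f t)) t := by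
  have hf' := ContDiff.deriv_top hf
  have hn : ‖deriv f t‖ ≠ 0 := norm_ne_zero_iff.2 h
  have hdd := ContDiff.hasDerivAt_deriv hf' t
  have hframe : deriv (deriv f) t =
      (dot2 (deriv f t) (deriv (deriv f) t) / dot2 (deriv f t) (deriv f t)) • deriv f t +
        (turning (deriv f) t / dot2 (deriv f t) (deriv f t)) • rot90 (deriv f t) := eq_frame h
  have h1 : HasDerivAt (fun s => ‖deriv f s‖⁻¹ • deriv f s) _ t :=
    ((hasDerivAt_norm_plane hdd h).inv hn).smul hdd
  refine h1.congr_deriv ?_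
  rw [← norm_sq_eq_dot2] at hframe
  generalize dot2 (deriv f t) (deriv (deriv f) t) = b at hframe ⊢
  rw [unitTangent, rot90_smul, hframe]
  apply plane_ext <;> simp <;> field_simp <;> ring

theorem radius_ne_zero (h : deriv f t ≠ 0) (hp : turning (deriv f) t ≠ 0) : radius f t ≠ 0 := by
  rw [radius_eq]
  exact div_ne_zero (pow_ne_zero 3 (norm_ne_zero_iff.2 h)) hp

theorem radiusNum₂_ne_zero_of_sesTurning_eq_zero (hp : turning g t ≠ 0)
    (h0 : sesTurning g t = 0) : radiusNum₂ (fun _ => 1) g t ≠ 0 := fun h1 => by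
  rw [sesTurning, h1, mul_zero, add_zero] at h0
  exact mul_ne_zero hp (sesDenom_one_ne_zero hp) h0

section

variable (hf : ContDiff ℝ ∞ f) (h : deriv f t ≠ 0) (hp : turning (deriv f) t ≠ 0)
include hf h hp

theorem sesTurning_eq : sesTurning (deriv f) t =
    turning (deriv f) t ^ 5 * (1 + radius₁ f t ^ 2 + 2 * radius f t * radius₂ f t) := by
  rw [arcCondition_eq hf h hp, sesTurning]
  field_simp

/-- The arc-length derivative of 1 + ρ'² + 2ρρ'' is 4ρ'ρ'' + 2ρρ'''. Multiplying by ρ ≠ 0 and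
substituting 2ρρ'' = −(1 + ρ'²) turns it into −2(ρ' + ρ'³ − ρ²ρ'''). -/
theorem deriv_sesTurning_ne_zero_iff (h0 : sesTurning (deriv f) t = 0) :
    deriv (sesTurning (deriv f)) t ≠ 0 ↔
      radius₁ f t + radius₁ f t ^ 3 - radius f t ^ 2 * radius₃ f t ≠ 0 := by
  have hf' := ContDiff.deriv_top hf
  have hn : ‖deriv f t‖ ≠ 0 := norm_ne_zero_iff.2 h
  have hr := radius_ne_zero h hp
  have e : sesTurning (deriv f) =ᶠ[𝓝 t] fun s =>
      turning (deriv f) s ^ 5 * (1 + radius₁ f s ^ 2 + 2 * radius f s * radius₂ f s) :=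
    (eventually_regular_nonflat hf h hp).mono fun s hs => sesTurning_eq hf hs.1 hs.2
  have hA : 1 + radius₁ f t ^ 2 + 2 * radius f t * radius₂ f t = 0 := by
    rw [sesTurning_eq hf h hp] at h0
    exact (mul_eq_zero.1 h0).resolve_left (pow_ne_zero 5 hp)
  have d0 : HasDerivAt (radius f) (‖deriv f t‖ * radius₁ f t) t := by
    rw [radius₁_eq hf h hp]; exact hasDerivAt_radius hf h hp
  have d1 : HasDerivAt (radius₁ f) (‖deriv f t‖ * radius₂ f t) t := by
    rw [radius₂_eq hf h hp]; exact hasDerivAt_radius₁ hf h hp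
  have d2 := hasDerivAt_radius₂ hf h hp
  have dP := (ContDiff.hasDerivAt_deriv (contDiff_turning hf') t).pow 5
  have dA : HasDerivAt (fun s => 1 + radius₁ f s ^ 2 + 2 * radius f s * radius₂ f s)
      (‖deriv f t‖ * (4 * radius₁ f t * radius₂ f t + 2 * radius f t * radius₃ f t)) t :=
    (((d1.pow 2).const_add 1).add ((d0.const_mul 2).mul d2)).congr_deriv (by simp; ring)
  have key : radius f t * (4 * radius₁ f t * radius₂ f t + 2 * radius f t * radius₃ f t) =
      -2 * (radius₁ f t + radius₁ f t ^ 3 - radius f t ^ 2 * radius₃ f t) := by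
    linear_combination (2 * radius₁ f t) * hA
  have h1 : deriv (sesTurning (deriv f)) t = turning (deriv f) t ^ 5 *
      (‖deriv f t‖ * (4 * radius₁ f t * radius₂ f t + 2 * radius f t * radius₃ f t)) := by
    have h2 : HasDerivAt (fun s => turning (deriv f) s ^ 5 *
      (1 + radius₁ f s ^ 2 + 2 * radius f s * radius₂ f s)) _ t := dP.mul dA
    rw [e.deriv_eq, h2.deriv, hA, mul_zero, zero_add]
    rfl
  rw [h1, not_iff_not, mul_eq_zero, mul_eq_zero, or_iff_right (pow_ne_zero 5 hp), or_iff_right hn]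
  constructor
  · intro h3
    rw [h3, mul_zero] at key
    linarith
  · intro h3
    rw [h3, mul_zero] at key
    exact (mul_eq_zero.1 key).resolve_left hr

/-! ### Evolutoids -/

/-- By Frenet, and since ρκ = 1, turning the frame contributes sin α times the rotated normal.
Together with the tangent this equals cos α times the rotated tangent, and the growth of ρ adds ρ'
sin α times the same vector. -/
theorem hasDerivAt_evolutoid (α : ℝ) : HasDerivAt (evolutoid f α)
    ((‖deriv f t‖ * (Real.cos α + radius₁ f t * Real.sin α)) •
      (Real.cos α • unitTangent f t + Real.sin α • rot90 (unitTangent f t))) t := by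
  have hn : ‖deriv f t‖ ≠ 0 := norm_ne_zero_iff.2 h
  have d0 : HasDerivAt (radius f) (‖deriv f t‖ * radius₁ f t) t := by
    rw [radius₁_eq hf h hp]; exact hasDerivAt_radius hf h hp
  have dT := hasDerivAt_unitTangent hf h
  have df := ContDiff.hasDerivAt_deriv hf t
  have hT : deriv f t = ‖deriv f t‖ • unitTangent f t := by
    rw [unitTangent, smul_smul, mul_inv_cancel₀ hn, one_smul]
  have h1 : HasDerivAt (fun s => f s + (radius f s * Real.sin α) •
      (Real.cos α • unitTangent f s + Real.sin α • rot90 (unitTangent f s))) _ t :=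
    df.add ((d0.mul_const _).smul ((dT.fun_const_smul _).fun_add (dT.rot90.fun_const_smul _)))
  refine h1.congr_deriv ?_
  rw [radius_eq, rot90_smul, rot90_rot90]
  nth_rewrite 1 [hT]
  have hsc := Real.sin_sq_add_cos_sq α
  apply plane_ext
  · simp
    field_simp
    linear_combination (-(unitTangent f t) 0) * hsc
  · simp
    field_simp
    linear_combination (-(unitTangent f t) 1) * hsc

end

/-! ### Singular points of evolutoids, and statements (i) to (iv) on an open set. -/

variable {f : ℝ → Plane} {s t : ℝ} {I : Set ℝ}

theorem deriv_evolutoid_eq_zero_iff (hf : ContDiff ℝ ∞ f) (h : deriv f t ≠ 0)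
    (hp : turning (deriv f) t ≠ 0) (α : ℝ) :
    deriv (evolutoid f α) t = 0 ↔ Real.cos α + radius₁ f t * Real.sin α = 0 := by
  have hn : ‖deriv f t‖ ≠ 0 := norm_ne_zero_iff.2 h
  have hT : dot2 (unitTangent f t) (unitTangent f t) = 1 := by
    rw [← norm_sq_eq_dot2, unitTangent, norm_smul, norm_inv, norm_norm, inv_mul_cancel₀ hn, one_pow]
  have hsc := Real.sin_sq_add_cos_sq α
  have hv : Real.cos α • unitTangent f t + Real.sin α • rot90 (unitTangent f t) ≠ 0 := fun h0 => by
    have h1 : dot2 (Real.cos α • unitTangent f t + Real.sin α • rot90 (unitTangent f t))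
        (Real.cos α • unitTangent f t + Real.sin α • rot90 (unitTangent f t)) =
        (Real.sin α ^ 2 + Real.cos α ^ 2) * dot2 (unitTangent f t) (unitTangent f t) := by
      simp only [dot2, PiLp.add_apply, PiLp.smul_apply, smul_eq_mul, rot90_apply_zero,
        rot90_apply_one]
      ring
    rw [h0, hT, hsc] at h1
    simp [dot2] at h1
  rw [(hasDerivAt_evolutoid hf h hp α).deriv, smul_eq_zero, or_iff_left hv, mul_eq_zero,
    or_iff_right hn]

/-- The condition cos α = −ρ' sin α gives sin²α = 1/(1 + ρ'²), which eliminates α. -/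
theorem evolutoid_eq_sesCurve (h : deriv f t ≠ 0) (hp : turning (deriv f) t ≠ 0) {α : ℝ}
    (hα : Real.cos α + radius₁ f t * Real.sin α = 0) : evolutoid f α t = sesCurve f t := by
  have hsc := Real.sin_sq_add_cos_sq α
  have hs : (1 + radius₁ f t ^ 2)⁻¹ = Real.sin α ^ 2 := by
    refine inv_eq_of_mul_eq_one_right ?_
    linear_combination hsc - (Real.cos α - radius₁ f t * Real.sin α) * hα
  have hc : Real.cos α = -(radius₁ f t * Real.sin α) := by linarith
  have hk : ¬ (deriv f t = 0 ∨ curvature f t = 0) := by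
    rw [curvature_eq_zero_iff h]; tauto
  rw [evolutoid, sesCurve, if_neg hk, hs, rotate, hc, unitNormal]
  congr 1
  apply plane_ext <;> simp <;> ring

/-- The function cos α + ρ' sin α runs from 1 to −1 on [0, π]. -/
theorem exists_deriv_evolutoid_eq_zero (hf : ContDiff ℝ ∞ f) (h : deriv f t ≠ 0)
    (hp : turning (deriv f) t ≠ 0) :
    ∃ α ∈ Icc (0 : ℝ) Real.pi, deriv (evolutoid f α) t = 0 := by
  have hc : ContinuousOn (fun α => Real.cos α + radius₁ f t * Real.sin α) (Icc 0 Real.pi) := by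
    fun_prop
  obtain ⟨α, hα, h0⟩ := intermediate_value_Icc' Real.pi_pos.le hc (show (0 : ℝ) ∈ _ by simp)
  exact ⟨α, hα, (deriv_evolutoid_eq_zero_iff hf h hp α).2 h0⟩

theorem SES_eq_image (hI : IsOpen I) (hf : ContDiffOn ℝ ∞ f I) :
    SES f I = sesCurve f '' {t ∈ I | ¬ IsFlat f t} := by
  have cusp : ∀ t, deriv f t = 0 → ∀ α, evolutoid f α t = sesCurve f t := fun t h α => by
    simp [evolutoid, radius, h, sesCurve]
  ext x
  constructor
  · rintro ⟨α, hα, t, ht, hflat, hd, rfl⟩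
    refine ⟨t, ⟨ht, hflat⟩, ?_⟩
    by_cases h : deriv f t = 0
    · exact (cusp t h α).symm
    obtain ⟨F, hF, e⟩ := exists_contDiff_eventuallyEq hI ht hf
    have hF0 : deriv F t ≠ 0 := by rwa [e.deriv_eq]
    have hp : turning (deriv F) t ≠ 0 := fun h0 =>
      hflat ⟨h, by rw [← (curvature_congr e).eq_of_nhds, curvature_eq_zero_iff hF0, h0]⟩
    rw [← (evolutoid_congr e α).deriv_eq, deriv_evolutoid_eq_zero_iff hF hF0 hp] at hd
    rw [← (sesCurve_congr e).eq_of_nhds, ← (evolutoid_congr e α).eq_of_nhds,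
      evolutoid_eq_sesCurve hF0 hp hd]
  · rintro ⟨t, ⟨ht, hflat⟩, rfl⟩
    by_cases h : deriv f t = 0
    -- At a singular point of `f` the angle 0 serves as a witness: the corresponding evolutoid is
    -- `f` itself.
    · refine ⟨0, ⟨le_rfl, Real.pi_pos.le⟩, t, ht, hflat, ?_, cusp t h 0⟩
      rw [show evolutoid f 0 = f by funext s; simp [evolutoid], h]
    obtain ⟨F, hF, e⟩ := exists_contDiff_eventuallyEq hI ht hf
    have hF0 : deriv F t ≠ 0 := by rwa [e.deriv_eq]
    have hp : turning (deriv F) t ≠ 0 := fun h0 =>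
      hflat ⟨h, by rw [← (curvature_congr e).eq_of_nhds, curvature_eq_zero_iff hF0, h0]⟩
    obtain ⟨α, hα, hd⟩ := exists_deriv_evolutoid_eq_zero hF hF0 hp
    refine ⟨α, hα, t, ht, hflat, by rwa [← (evolutoid_congr e α).deriv_eq], ?_⟩
    rw [← (sesCurve_congr e).eq_of_nhds, ← (evolutoid_congr e α).eq_of_nhds,
      evolutoid_eq_sesCurve hF0 hp ((deriv_evolutoid_eq_zero_iff hF hF0 hp α).1 hd)]

theorem contDiffOn_sesCurve (hI : IsOpen I) (hf : ContDiffOn ℝ ∞ f I) (hcusp : AtMostCusps f I)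
    (hc : ∀ t ∈ I, deriv f t ≠ 0 → HasFiniteContact f t) : ContDiffOn ℝ ∞ (sesCurve f) I := by
  intro t ht
  obtain ⟨F, hF, e⟩ := exists_contDiff_eventuallyEq hI ht hf
  suffices ∃ Γ : ℝ → Plane, ContDiff ℝ ∞ Γ ∧ Γ =ᶠ[𝓝 t] sesCurve F by
    obtain ⟨Γ, hΓ, eΓ⟩ := this
    exact (hΓ.contDiffAt.congr_of_eventuallyEq
      (eΓ.trans (sesCurve_congr e)).symm).contDiffWithinAt
  by_cases h : deriv f t = 0
  · have h1 := ((isCusp_congr e).2 (hcusp t ht h)).hasCuspForm hF.continuous.continuousAt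
    exact (sesCurve_of_hasCuspForm hF h1).1
  have hF0 : deriv F t ≠ 0 := by rwa [e.deriv_eq]
  by_cases hp : turning (deriv F) t = 0
  · exact (sesCurve_of_flat hF hF0 hp ((hasFiniteContact_congr e).2 (hc t ht h))).1
  · exact exists_contDiff_sesCurve hF (sesDenom_one_ne_zero hp)

theorem sesCurve_singular (hI : IsOpen I) (hf : ContDiffOn ℝ ∞ f I) (ht : t ∈ I)
    (h : deriv f t ≠ 0) (hk : curvature f t ≠ 0) :
    (deriv (sesCurve f) t = 0 ↔ radius₂ f t = 0) ∧
      (deriv (sesCurve f) t = 0 → (IsCusp (sesCurve f) t ↔ radius₃ f t ≠ 0)) := by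
  obtain ⟨F, hF, e⟩ := exists_contDiff_eventuallyEq hI ht hf
  have es := sesCurve_congr e
  have hF0 : deriv F t ≠ 0 := by rwa [e.deriv_eq]
  have hp : turning (deriv F) t ≠ 0 := by
    rwa [← (curvature_congr e).eq_of_nhds, ne_eq, curvature_eq_zero_iff hF0] at hk
  have hd := sesDenom_one_ne_zero hp
  rw [← es.deriv_eq, ← isCusp_congr es, ← (radius₂_congr e).eq_of_nhds,
    ← (radius₃_congr e).eq_of_nhds, deriv_sesCurve_eq_zero_iff hF hF0 hd]
  refine ⟨?_, fun h0 => ?_⟩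
  · rw [radius₂_eq hF hF0 hp, div_eq_zero_iff, or_iff_left
      (mul_ne_zero (pow_ne_zero 3 hp) (norm_ne_zero_iff.2 hF0))]
  · rw [radius₃_ne_zero_iff hF hF0 hp h0]
    exact ⟨deriv_radiusNum₂_ne_zero_of_isCusp hF hF0 hd, isCusp_sesCurve_of hF hF0 hd hp h0⟩

theorem sesCurve_inflexion (hI : IsOpen I) (hf : ContDiffOn ℝ ∞ f I) (ht : t ∈ I)
    (h : deriv f t ≠ 0) (hk : curvature f t ≠ 0) :
    ((IsInflexion (sesCurve f) t ∨ IsUndulation (sesCurve f) t) ↔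
      1 + radius₁ f t ^ 2 + 2 * radius f t * radius₂ f t = 0) ∧
    (IsInflexion (sesCurve f) t → (IsNondegenerate (sesCurve f) t ↔
      radius₁ f t + radius₁ f t ^ 3 - radius f t ^ 2 * radius₃ f t ≠ 0)) := by
  obtain ⟨F, hF, e⟩ := exists_contDiff_eventuallyEq hI ht hf
  have es := sesCurve_congr e
  have hF0 : deriv F t ≠ 0 := by rwa [e.deriv_eq]
  have hp : turning (deriv F) t ≠ 0 := by
    rwa [← (curvature_congr e).eq_of_nhds, ne_eq, curvature_eq_zero_iff hF0] at hk
  have hd := sesDenom_one_ne_zero hp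
  rw [← isInflexion_congr es, ← isUndulation_congr es, ← isNondegenerate_congr es,
    ← (radius_congr e).eq_of_nhds, ← (radius₁_congr e).eq_of_nhds, ← (radius₂_congr e).eq_of_nhds,
    ← (radius₃_congr e).eq_of_nhds]
  refine ⟨?_, fun h0 => ?_⟩
  · rw [inflexion_or_undulation_sesCurve_iff hF hF0 hd]
    constructor
    · rintro ⟨-, h2⟩
      rw [sesTurning_eq hF hF0 hp] at h2
      exact (mul_eq_zero.1 h2).resolve_left (pow_ne_zero 5 hp)
    · intro h2
      have h3 : sesTurning (deriv F) t = 0 := by rw [sesTurning_eq hF hF0 hp, h2, mul_zero]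
      exact ⟨radiusNum₂_ne_zero_of_sesTurning_eq_zero hp h3, h3⟩
  · obtain ⟨h1, h2⟩ := (inflexion_or_undulation_sesCurve_iff hF hF0 hd).1 (Or.inl h0)
    rw [nondegenerate_sesCurve_iff hF hF0 hd h1 h2, deriv_sesTurning_ne_zero_iff hF hF0 hp h2]

theorem sesCurve_regular_of_isFlat (hI : IsOpen I) (hf : ContDiffOn ℝ ∞ f I) (ht : t ∈ I)
    (h : IsFlat f t) (hc : HasFiniteContact f t) : deriv (sesCurve f) t ≠ 0 := by
  obtain ⟨F, hF, e⟩ := exists_contDiff_eventuallyEq hI ht hf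
  obtain ⟨h1, h2⟩ := (isFlat_congr e).2 h
  rw [← (sesCurve_congr e).deriv_eq]
  exact (sesCurve_of_flat hF h1 ((curvature_eq_zero_iff h1).1 h2)
    ((hasFiniteContact_congr e).2 hc)).2

theorem sesCurve_cusp (hI : IsOpen I) (hf : ContDiffOn ℝ ∞ f I) (ht : t ∈ I)
    (h : IsCusp f t) : sesCurve f t = f t ∧ IsCusp (sesCurve f) t := by
  obtain ⟨F, hF, e⟩ := exists_contDiff_eventuallyEq hI ht hf
  have hc := ((isCusp_congr e).2 h).hasCuspForm hF.continuous.continuousAt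
  refine ⟨?_, (isCusp_congr (sesCurve_congr e)).1 (sesCurve_of_hasCuspForm hF hc).2⟩
  rw [sesCurve, if_pos (Or.inl (by rw [← e.deriv_eq, hc.deriv_eq_zero]))]

/-! ### Simple zeros in one-parameter families -/

/-- In a one-parameter family of functions with nonzero derivative with respect to the parameter,
functions with only simple zeros occur for arbitrarily small parameters. -/
theorem frequently_simple_zeros {G Gθ Ga : ℝ → ℝ → ℝ} {α β : ℝ} (hαβ : α < β)
    (hθ : ∀ θ a, HasDerivAt (fun θ => G θ a) (Gθ θ a) θ)
    (ha : ∀ θ a, HasDerivAt (fun a => G θ a) (Ga θ a) a)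
    (cθ : Continuous fun p : ℝ × ℝ => Gθ p.1 p.2) (ca : Continuous fun p : ℝ × ℝ => Ga p.1 p.2)
    (h0 : ∀ θ ∈ Icc α β, Ga θ 0 ≠ 0) :
    ∃ᶠ a in 𝓝 (0 : ℝ), ∀ θ ∈ Icc α β, G θ a = 0 → Gθ θ a ≠ 0 := by
  by_contra hcon
  rw [not_frequently] at hcon
  have hK : IsCompact (Icc α β) := isCompact_Icc
  -- a positive lower bound for the derivative with respect to the parameter
  obtain ⟨c, hc, hcb⟩ : ∃ c > 0, ∀ θ ∈ Icc α β, c < |Ga θ 0| := by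
    have h1 : ContinuousOn (fun θ => |Ga θ 0|) (Icc α β) :=
      (ca.comp (by fun_prop : Continuous fun θ : ℝ => (θ, (0 : ℝ)))).abs.continuousOn
    obtain ⟨θ₀, hθ₀, hmin⟩ := hK.exists_isMinOn (nonempty_Icc.2 hαβ.le) h1
    have h2 : 0 < |Ga θ₀ 0| := abs_pos.2 (h0 θ₀ hθ₀)
    exact ⟨|Ga θ₀ 0| / 2, half_pos h2, fun θ hθ =>
      (half_lt_self h2).trans_le (isMinOn_iff.1 hmin θ hθ)⟩
  have h1 : ∀ᶠ a in 𝓝 (0 : ℝ), ∀ θ ∈ Icc α β, c < |Ga θ a| := by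
    refine hK.eventually_forall_of_forall_eventually fun θ hθ => ?_
    have : Continuous fun p : ℝ × ℝ => |Ga p.2 p.1| := (ca.comp continuous_swap).abs
    exact this.continuousAt.eventually (lt_mem_nhds (hcb θ hθ))
  obtain ⟨ε, hε, hεb⟩ := Metric.eventually_nhds_iff_ball.1 (hcon.and h1)
  set δ := ε / 2 with hδ
  have hδ0 : 0 < δ := half_pos hε
  have hδε : δ < ε := half_lt_self hε
  have hmem : ∀ a ∈ Icc 0 δ, a ∈ Metric.ball (0 : ℝ) ε := fun a h => by
    rw [Metric.mem_ball, Real.dist_0_eq_abs, abs_of_nonneg h.1]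
    exact h.2.trans_lt hδε
  set L := β - α with hL
  have hL0 : 0 < L := sub_pos.2 hαβ
  -- Below, the bounds c δ/(N + 1) from below and η L/N = c δ/(4N) from above collide, since 4N ≤ N
  -- + 1 fails for N ≥ 1.
  set η := δ * c / (4 * L) with hη
  have hη0 : 0 < η := by positivity
  -- uniform continuity of the derivative along the curve
  obtain ⟨r, hr, hrb⟩ := Metric.uniformContinuousOn_iff.1
    ((hK.prod (isCompact_Icc (a := 0) (b := δ))).uniformContinuousOn_of_continuous
      cθ.continuousOn) η hη0
  obtain ⟨N, hN⟩ := exists_nat_gt (L / r)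
  have hNpos : (0 : ℝ) < N := (div_pos hL0 hr).trans hN
  have hLN : L / N < r := by
    rw [div_lt_iff₀ hNpos]; rw [div_lt_iff₀ hr] at hN; linarith
  -- There are N + 2 equally spaced parameters, one more than the N + 1 values of the floor function
  -- below (the value N occurs at θ = β).
  let p : ℕ → ℝ := fun j => δ * (j / (N + 1))
  have hp : ∀ j ∈ Finset.range (N + 2), p j ∈ Icc 0 δ := fun j hj => by
    have h2 : (j : ℝ) ≤ N + 1 := by
      exact_mod_cast Nat.lt_succ_iff.1 (Finset.mem_range.1 hj)
    refine ⟨by positivity, mul_le_of_le_one_right hδ0.le ?_⟩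
    rw [div_le_one (by positivity)]
    exact h2
  have hbad : ∀ j ∈ Finset.range (N + 2), ∃ θ ∈ Icc α β, G θ (p j) = 0 ∧ Gθ θ (p j) = 0 :=
    fun j hj => by
      have := (hεb _ (hmem _ (hp j hj))).1
      push Not at this
      exact this
  choose! θ hθK hθG hθd using hbad
  -- two of the bad parameters have nearby bad points
  obtain ⟨i, hi, j, hj, hij, hfl⟩ := Finset.exists_ne_map_eq_of_card_lt_of_maps_to
    (s := Finset.range (N + 2)) (t := Finset.range (N + 1))
    (f := fun j => ⌊(θ j - α) / L * N⌋₊) (by simp) (fun j hj => by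
      have h2 := hθK j hj
      simp only [Finset.coe_range, mem_Iio]
      refine Nat.lt_succ_of_le (Nat.floor_le_of_le ?_)
      refine mul_le_of_le_one_left hNpos.le ?_
      rw [div_le_one hL0]
      linarith [h2.2])
  have hclose : |θ i - θ j| < L / N := by
    have hi' := hθK i hi
    have hj' := hθK j hj
    have f1 : 0 ≤ (θ i - α) / L * N :=
      mul_nonneg (div_nonneg (sub_nonneg.2 hi'.1) hL0.le) hNpos.le
    have f2 : 0 ≤ (θ j - α) / L * N :=
      mul_nonneg (div_nonneg (sub_nonneg.2 hj'.1) hL0.le) hNpos.le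
    have g1 := Nat.floor_le f1
    have g2 := Nat.floor_le f2
    have g3 := Nat.lt_floor_add_one ((θ i - α) / L * N)
    have g4 := Nat.lt_floor_add_one ((θ j - α) / L * N)
    have hfl' : (⌊(θ i - α) / L * N⌋₊ : ℝ) = ⌊(θ j - α) / L * N⌋₊ := by exact_mod_cast hfl
    have e : θ i - θ j = ((θ i - α) / L * N - (θ j - α) / L * N) * (L / N) := by
      field_simp; ring
    rw [e, abs_mul, abs_of_pos (div_pos hL0 hNpos)]
    refine mul_lt_of_lt_one_left (div_pos hL0 hNpos) ?_
    rw [abs_lt]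
    constructor <;> linarith
  -- Since `G` and its θ-derivative vanish at (θ i, p i), the derivative is below η on the short
  -- segment to θ j, so `G` is still tiny there.
  have hGi : |G (θ j) (p i)| ≤ η * (L / N) := by
    have hseg : uIcc (θ i) (θ j) ⊆ Icc α β := uIcc_subset_Icc (hθK i hi) (hθK j hj)
    have h2 := (convex_uIcc (θ i) (θ j)).norm_image_sub_le_of_norm_hasDerivWithin_le
      (f := fun θ => G θ (p i)) (f' := fun θ => Gθ θ (p i)) (C := η)
      (fun x _ => (hθ x (p i)).hasDerivWithinAt) (fun x hx => by
        have h3 := hrb (x, p i) ⟨hseg hx, hp i hi⟩ (θ i, p i) ⟨hθK i hi, hp i hi⟩ (by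
          rw [Prod.dist_eq, dist_self, max_eq_left dist_nonneg, Real.dist_eq]
          have h4 := abs_sub_left_of_mem_uIcc hx
          rw [abs_sub_comm (θ j)] at h4
          exact (h4.trans_lt hclose).trans hLN)
        rw [Real.dist_eq, hθd i hi, sub_zero] at h3
        exact h3.le) left_mem_uIcc right_mem_uIcc
    rw [hθG i hi, sub_zero, Real.norm_eq_abs, Real.norm_eq_abs] at h2
    refine h2.trans (mul_le_mul_of_nonneg_left ?_ hη0.le)
    rw [abs_sub_comm]
    exact hclose.le
  have hpij : p i ≠ p j := fun h => hij (by
    have h2 := mul_left_cancel₀ hδ0.ne' h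
    rw [div_left_inj' (by positivity)] at h2
    exact_mod_cast h2)
  have hspace : δ / (N + 1) ≤ |p i - p j| := by
    have h2 : (1 : ℝ) ≤ |(i : ℝ) - j| := by
      have : (1 : ℤ) ≤ |(i : ℤ) - j| := Int.one_le_abs (sub_ne_zero.2 (by exact_mod_cast hij))
      exact_mod_cast this
    have e : p i - p j = δ / (N + 1) * (i - j) := by simp only [p]; field_simp
    have h3 : 0 < δ / ((N : ℝ) + 1) := by positivity
    rw [e, abs_mul, abs_of_pos h3]
    exact le_mul_of_one_le_right h3.le h2
  -- On the other hand `G (θ j)` vanishes at p j and moves with speed at least c in the parameter.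
  have hmvt : c * |p i - p j| ≤ |G (θ j) (p i)| := by
    have hseg : uIcc (p i) (p j) ⊆ Icc 0 δ := uIcc_subset_Icc (hp i hi) (hp j hj)
    have key : ∀ x y : ℝ, x < y → x ∈ Icc 0 δ → y ∈ Icc 0 δ →
        c * |x - y| ≤ |G (θ j) x - G (θ j) y| := fun x y hxy hx hy => by
      obtain ⟨ξ, hξ, e⟩ := exists_hasDerivAt_eq_slope (fun a => G (θ j) a) (fun a => Ga (θ j) a) hxy
        (fun a _ => (ha (θ j) a).continuousAt.continuousWithinAt) (fun a _ => ha (θ j) a)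
      have h2 := (hεb ξ (hmem ξ ⟨hx.1.trans hξ.1.le, hξ.2.le.trans hy.2⟩)).2 (θ j) (hθK j hj)
      rw [eq_div_iff (sub_ne_zero.2 hxy.ne')] at e
      rw [abs_sub_comm (G (θ j) x), ← e, abs_mul, abs_sub_comm x]
      exact mul_le_mul_of_nonneg_right h2.le (abs_nonneg _)
    rcases lt_or_gt_of_ne hpij with h2 | h2
    · have := key _ _ h2 (hp i hi) (hp j hj)
      rwa [hθG j hj, sub_zero] at this
    · have := key _ _ h2 (hp j hj) (hp i hi)
      rwa [hθG j hj, zero_sub, abs_neg, abs_sub_comm] at this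
  have hfin : c * (δ / (N + 1)) ≤ η * (L / N) :=
    (mul_le_mul_of_nonneg_left hspace hc.le).trans (hmvt.trans hGi)
  have e : η * (L / N) = c * δ / (4 * N) := by rw [hη]; field_simp
  rw [e, ← mul_div_assoc, div_le_div_iff₀ (by positivity) (by positivity)] at hfin
  have hcd : 0 < c * δ := mul_pos hc hδ0
  have hN1 : (1 : ℝ) ≤ N := by exact_mod_cast Nat.one_le_iff_ne_zero.2 (by
    rintro rfl; simp at hNpos)
  have := le_of_mul_le_mul_left hfin hcd
  linarith

/-! ### Jets of closed curves -/

namespace ClosedCurve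

theorem contDiff_lift (f : ClosedCurve) : ContDiff ℝ ∞ f.lift :=
  contMDiff_iff_contDiff.1 (f.contMDiff.comp contMDiff_circleExp)

theorem lift_periodic (f : ClosedCurve) : Function.Periodic f.lift (2 * Real.pi) := fun θ => by
  simp only [lift, Circle.periodic_exp θ]

theorem lift_add (f g : ClosedCurve) : (f + g).lift = f.lift + g.lift := rfl

theorem lift_smul (a : ℝ) (f : ClosedCurve) : (a • f).lift = a • f.lift := rfl

/-- The derivatives of the angular parameterization up to the order `k`. -/
def derivs (k : ℕ) (f : ClosedCurve) (θ : ℝ) : Fin (k + 1) → Plane :=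
  fun i => iteratedDeriv (i : ℕ) f.lift θ

theorem continuous_iteratedDeriv_lift (f : ClosedCurve) (i : ℕ) :
    Continuous (iteratedDeriv i f.lift) :=
  f.contDiff_lift.continuous_iteratedDeriv i (by exact_mod_cast le_top)

theorem continuous_derivs (k : ℕ) (f : ClosedCurve) : Continuous (derivs k f) :=
  continuous_pi fun i => f.continuous_iteratedDeriv_lift i

theorem hasDerivAt_derivs (k : ℕ) (f : ClosedCurve) (θ : ℝ) :
    HasDerivAt (derivs k f) (fun i => derivs (k + 1) f θ i.succ) θ := by
  refine hasDerivAt_pi.2 fun i => ?_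
  have h := (f.contDiff_lift.differentiable_iteratedDeriv (i : ℕ)
    (by exact_mod_cast WithTop.coe_lt_top _) θ).hasDerivAt
  rw [← iteratedDeriv_succ] at h
  exact h

theorem derivs_periodic (k : ℕ) (f : ClosedCurve) :
    Function.Periodic (derivs k f) (2 * Real.pi) := fun θ => by
  funext i
  have h := congrFun (iteratedDeriv_comp_add_const (i : ℕ) f.lift (2 * Real.pi)) θ
  rw [show (fun z => f.lift (z + 2 * Real.pi)) = f.lift from funext f.lift_periodic] at h
  exact h.symm

theorem derivs_add (k : ℕ) (f g : ClosedCurve) (θ : ℝ) :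
    derivs k (f + g) θ = derivs k f θ + derivs k g θ := by
  funext i
  have h (f : ClosedCurve) : ContDiffAt ℝ (i : ℕ) f.lift θ :=
    (f.contDiff_lift.of_le (by exact_mod_cast le_top)).contDiffAt
  simp only [derivs, lift_add, Pi.add_apply]
  exact iteratedDeriv_add (h f) (h g)

theorem derivs_smul (k : ℕ) (a : ℝ) (f : ClosedCurve) (θ : ℝ) :
    derivs k (a • f) θ = a • derivs k f θ := by
  funext i
  have h : ContDiffAt ℝ (i : ℕ) f.lift θ :=
    (f.contDiff_lift.of_le (by exact_mod_cast le_top)).contDiffAt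
  simp only [derivs, lift_smul, Pi.smul_apply]
  exact iteratedDeriv_const_smul h a

theorem derivs_sum (k : ℕ) {n : ℕ} (g : Fin n → ClosedCurve) (θ : ℝ) :
    derivs k (∑ j, g j) θ = ∑ j, derivs k (g j) θ := by
  induction n with
  | zero =>
    simpa using derivs_smul k 0 (0 : ClosedCurve) θ
  | succ n ih => rw [Fin.sum_univ_succ, Fin.sum_univ_succ, derivs_add, ih]

theorem derivs_family (k : ℕ) {n : ℕ} (f : ClosedCurve) (g : Fin n → ClosedCurve) (a : Fin n → ℝ)
    (θ : ℝ) : derivs k (f + ∑ j, a j • g j) θ = derivs k f θ + ∑ j, a j • derivs k (g j) θ := by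
  rw [derivs_add, derivs_sum]
  simp only [derivs_smul]

theorem forall_derivs {k : ℕ} {f : ClosedCurve} {U : Set (Fin (k + 1) → Plane)}
    (h : ∀ θ ∈ Icc 0 (2 * Real.pi), derivs k f θ ∈ U) (θ : ℝ) : derivs k f θ ∈ U := by
  obtain ⟨y, hy, e⟩ := (derivs_periodic k f).exists_mem_Ico₀ Real.two_pi_pos θ
  exact e ▸ h y (Ico_subset_Icc_self hy)

end ClosedCurve

/-! ### Stability under finite-dimensional perturbations. -/

open ClosedCurve

/-- A set of closed curves is stable if it is a neighbourhood of each of its elements in every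
finite-dimensional affine family through it. -/
def Stable (O : Set ClosedCurve) : Prop :=
  ∀ f ∈ O, ∀ (n : ℕ) (g : Fin n → ClosedCurve),
    ∀ᶠ a in 𝓝 (0 : Fin n → ℝ), f + ∑ j, a j • g j ∈ O

theorem Stable.inter {O O' : Set ClosedCurve} (h : Stable O) (h' : Stable O') : Stable (O ∩ O') :=
  fun f hf n g => (h f hf.1 n g).and (h' f hf.2 n g)

theorem Stable.union {O O' : Set ClosedCurve} (h : Stable O) (h' : Stable O') : Stable (O ∪ O') :=
  fun f hf n g => hf.elim (fun hf => (h f hf n g).mono fun _ => Or.inl)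
    fun hf => (h' f hf n g).mono fun _ => Or.inr

theorem Stable.biInter_finset {ι : Type*} (S : Finset ι) {O : ι → Set ClosedCurve}
    (h : ∀ i ∈ S, Stable (O i)) : Stable (⋂ i ∈ S, O i) := fun f hf n g => by
  rw [mem_iInter₂] at hf
  simp only [mem_iInter₂]
  exact (Filter.eventually_all_finset S).2 fun i hi => h i hi f (hf i hi) n g

theorem Stable.eventually {O : Set ClosedCurve} (h : Stable O) {f : ClosedCurve} (hf : f ∈ O)
    (g : ClosedCurve) : ∀ᶠ a in 𝓝 (0 : ℝ), f + a • g ∈ O := by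
  have h1 := h f hf 1 fun _ => g
  have h2 : Tendsto (fun a : ℝ => fun _ : Fin 1 => a) (𝓝 0) (𝓝 0) :=
    (continuous_pi fun _ => continuous_id).tendsto' _ _ rfl
  simpa using h2.eventually h1

/-- An open condition on the jets at the points of a compact set is stable. -/
theorem stable_forall_derivs {K : Set ℝ} (hK : IsCompact K) {k : ℕ}
    {U : Set (ℝ × (Fin (k + 1) → Plane))} (hU : IsOpen U) :
    Stable {f | ∀ θ ∈ K, (θ, derivs k f θ) ∈ U} := fun f hf n g => by
  refine hK.eventually_forall_of_forall_eventually fun θ hθ => ?_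
  have hc : Continuous fun z : (Fin n → ℝ) × ℝ => (z.2, derivs k (f + ∑ j, z.1 j • g j) z.2) := by
    simp only [derivs_family]
    have h1 (f : ClosedCurve) : Continuous fun z : (Fin n → ℝ) × ℝ => derivs k f z.2 :=
      (continuous_derivs k f).comp continuous_snd
    refine continuous_snd.prodMk ((h1 f).add (continuous_finsetSum _ fun j _ =>
      ((continuous_apply j).comp continuous_fst).smul (h1 (g j))))
  refine hc.continuousAt.eventually (hU.mem_nhds ?_)
  simpa using hf θ hθ

/-- By periodicity a basic open condition need only be checked over the compact interval [0, 2π].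
Stability is all that the density argument needs to know about the Whitney topology. -/
theorem stable_of_isOpen_whitneyTopology {O : Set ClosedCurve} (h : IsOpen[whitneyTopology] O) :
    Stable O := by
  induction h with
  | basic s hs =>
    obtain ⟨k, U, hU, rfl⟩ := hs
    have hU' : IsOpen ((fun z : ℝ × (Fin (k + 1) → Plane) => (Circle.exp z.1, z.2)) ⁻¹' U) :=
      hU.preimage ((Circle.exp.continuous.comp continuous_fst).prodMk continuous_snd)
    convert stable_forall_derivs (isCompact_Icc (a := 0) (b := 2 * Real.pi)) hU' using 1
    ext f
    refine ⟨fun h θ _ => h θ, fun h θ => ?_⟩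
    have hp : Function.Periodic (f.jet k) (2 * Real.pi) := fun θ =>
      Prod.ext (Circle.periodic_exp θ) (derivs_periodic k f θ)
    obtain ⟨y, hy, e⟩ := hp.exists_mem_Ico₀ Real.two_pi_pos θ
    exact e ▸ h y (Ico_subset_Icc_self hy)
  | univ => exact fun f _ n g => Eventually.of_forall fun _ => mem_univ _
  | inter s t _ _ hs ht => exact hs.inter ht
  | sUnion S _ ih =>
    rintro f ⟨s, hs, hf⟩ n g
    exact (ih s hs f hf n g).mono fun a ha => ⟨s, hs, ha⟩

/-- Finitely many stable conditions, each of which can be achieved by small perturbations from a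
stable assumption, can be achieved simultaneously. -/
theorem exists_mem_forall_of_finset {ι : Type*} {T P : ι → Set ClosedCurve}
    (hT : ∀ i, Stable (T i)) (hP : ∀ i, Stable (P i))
    (step : ∀ i O, Stable O → ∀ f ∈ O, f ∈ T i → ∃ f' ∈ O, f' ∈ P i) (S : Finset ι)
    {O : Set ClosedCurve} (hO : Stable O) {f : ClosedCurve} (hf : f ∈ O) (hfT : ∀ i ∈ S, f ∈ T i) :
    ∃ f' ∈ O, ∀ i ∈ S, f' ∈ P i := by
  classical
  induction S using Finset.induction_on generalizing O f with
  | empty => exact ⟨f, hf, by simp⟩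
  | insert i S _ ih =>
    -- The perturbation that achieves `P i` is kept inside the assumptions `T j` still to be used.
    -- Afterwards `P i` joins the stable set to be preserved.
    obtain ⟨f₁, ⟨h1, h2⟩, h3⟩ := step i (O ∩ ⋂ j ∈ S, T j)
      (hO.inter (Stable.biInter_finset S fun j _ => hT j)) f
      ⟨hf, mem_iInter₂.2 fun j hj => hfT j (Finset.mem_insert_of_mem hj)⟩
      (hfT i (Finset.mem_insert_self i S))
    obtain ⟨f₂, h4, h5⟩ := ih (hO.inter (hP i)) ⟨h1, h3⟩ (mem_iInter₂.1 h2)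
    refine ⟨f₂, h4.1, fun j hj => ?_⟩
    rcases Finset.mem_insert.1 hj with rfl | hj
    exacts [h4.2, h5 j hj]

/-! ### Differential expressions with only simple zeros -/

/-- The `5`-jets at which the differential expression `J` of order four does not vanish to second
order. -/
def simpleJets (J : (Fin 5 → Plane) → ℝ) : Set (Fin 6 → Plane) :=
  {z | J (fun i => z i.castSucc) = 0 → fderiv ℝ J (fun i => z i.castSucc) (fun i => z i.succ) ≠ 0}

variable {J : (Fin 5 → Plane) → ℝ}

theorem isOpen_simpleJets (hJ : ContDiff ℝ ∞ J) : IsOpen (simpleJets J) := by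
  have h1 : Continuous fun z : Fin 6 → Plane => J fun i => z i.castSucc :=
    hJ.continuous.comp (by fun_prop)
  have h2 : Continuous fun z : Fin 6 → Plane =>
      fderiv ℝ J (fun i => z i.castSucc) (fun i => z i.succ) :=
    ((hJ.continuous_fderiv (by simp)).comp
      (by fun_prop : Continuous fun z : Fin 6 → Plane => fun i : Fin 5 => z i.castSucc)).clm_apply
      (by fun_prop)
  have : simpleJets J = {z | J (fun i => z i.castSucc) ≠ 0} ∪
      {z | fderiv ℝ J (fun i => z i.castSucc) (fun i => z i.succ) ≠ 0} := by
    ext z; simp only [simpleJets, mem_ofPred_eq, mem_union, imp_iff_not_or, ne_eq]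
  rw [this]
  exact (isOpen_ne_fun h1 continuous_const).union (isOpen_ne_fun h2 continuous_const)

theorem stable_simpleJets (hJ : ContDiff ℝ ∞ J) {K : Set ℝ} (hK : IsCompact K) :
    Stable {f | ∀ θ ∈ K, derivs 5 f θ ∈ simpleJets J} :=
  stable_forall_derivs hK ((isOpen_simpleJets hJ).preimage continuous_snd)

/-- Along the line f + a g the expression J moves with nonzero speed in a, so simple zeros occur for
arbitrarily small a, among which some keep the curve in O. -/
theorem exists_simpleJets_Icc (hJ : ContDiff ℝ ∞ J) {O : Set ClosedCurve} (hO : Stable O)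
    {f : ClosedCurve} (hf : f ∈ O) (g : ClosedCurve) {α β : ℝ} (hαβ : α < β)
    (h : ∀ θ ∈ Icc α β, fderiv ℝ J (derivs 4 f θ) (derivs 4 g θ) ≠ 0) :
    ∃ f' ∈ O, ∀ θ ∈ Icc α β, derivs 5 f' θ ∈ simpleJets J := by
  have hd (y : Fin 5 → Plane) : HasFDerivAt J (fderiv ℝ J y) y :=
    ((hJ.differentiable (by simp)) y).hasFDerivAt
  have c1 (k : ℕ) (f : ClosedCurve) : Continuous fun p : ℝ × ℝ => derivs k f p.1 :=
    (continuous_derivs k f).comp continuous_fst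
  have c2 : Continuous fun p : ℝ × ℝ => fderiv ℝ J (derivs 4 f p.1 + p.2 • derivs 4 g p.1) :=
    (hJ.continuous_fderiv (by simp)).comp ((c1 4 f).add (continuous_snd.smul (c1 4 g)))
  have c3 (f : ClosedCurve) : Continuous fun p : ℝ × ℝ => fun i : Fin 5 =>
      derivs 5 f p.1 i.succ := continuous_pi fun i => (continuous_apply i.succ).comp (c1 5 f)
  have key := frequently_simple_zeros (G := fun θ a => J (derivs 4 f θ + a • derivs 4 g θ))
    (Gθ := fun θ a => fderiv ℝ J (derivs 4 f θ + a • derivs 4 g θ)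
      ((fun i => derivs 5 f θ i.succ) + a • fun i => derivs 5 g θ i.succ))
    (Ga := fun θ a => fderiv ℝ J (derivs 4 f θ + a • derivs 4 g θ) (derivs 4 g θ)) hαβ
    (fun θ a => (hd _).comp_hasDerivAt θ ((hasDerivAt_derivs 4 f θ).add
      ((hasDerivAt_derivs 4 g θ).const_smul a)))
    (fun θ a => (hd _).comp_hasDerivAt a ((((hasDerivAt_id a).smul_const (derivs 4 g θ)).const_add
      (derivs 4 f θ)).congr_deriv (one_smul _ _)))
    (c2.clm_apply ((c3 f).add (continuous_snd.smul (c3 g)))) (c2.clm_apply (c1 4 g))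
    (fun θ hθ => by simpa using h θ hθ)
  obtain ⟨a, h1, h2⟩ := (key.and_eventually (hO.eventually hf g)).exists
  refine ⟨_, h2, fun θ hθ => ?_⟩
  have e1 : derivs 5 (f + a • g) θ = derivs 5 f θ + a • derivs 5 g θ := by
    rw [derivs_add, derivs_smul]
  rw [e1]
  exact h1 θ hθ

/-- If at every point of `[0, 2π]` where the differential expression `J` vanishes, its value can be
changed to first order by a perturbation of `f`, then `f` can be perturbed so that `J` has only
simple zeros. -/
theorem exists_simpleJets (hJ : ContDiff ℝ ∞ J) {O : Set ClosedCurve} (hO : Stable O)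
    {f : ClosedCurve} (hf : f ∈ O) (h : ∀ θ, J (derivs 4 f θ) = 0 →
      ∃ g : ClosedCurve, fderiv ℝ J (derivs 4 f θ) (derivs 4 g θ) ≠ 0) :
    ∃ f' ∈ O, ∀ θ ∈ Icc 0 (2 * Real.pi), derivs 5 f' θ ∈ simpleJets J := by
  have hg (θ : ℝ) : ∃ g : ClosedCurve, J (derivs 4 f θ) ≠ 0 ∨
      fderiv ℝ J (derivs 4 f θ) (derivs 4 g θ) ≠ 0 := by
    by_cases h0 : J (derivs 4 f θ) = 0
    · exact (h θ h0).imp fun g => Or.inr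
    · exact ⟨0, Or.inl h0⟩
  choose g hg using hg
  have c1 : Continuous fun θ => J (derivs 4 f θ) := hJ.continuous.comp (continuous_derivs 4 f)
  have c2 (g : ClosedCurve) : Continuous fun θ => fderiv ℝ J (derivs 4 f θ) (derivs 4 g θ) :=
    ((hJ.continuous_fderiv (by simp)).comp (continuous_derivs 4 f)).clm_apply (continuous_derivs 4 g)
  have hr (τ : ℝ) : ∃ r > 0, (∀ θ ∈ Icc (τ - r) (τ + r), J (derivs 4 f θ) ≠ 0) ∨
      ∀ θ ∈ Icc (τ - r) (τ + r), fderiv ℝ J (derivs 4 f θ) (derivs 4 (g τ) θ) ≠ 0 := by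
    rcases hg τ with h0 | h0
    · obtain ⟨r, hr, h1⟩ := (nhds_basis_Icc_pos τ).eventually_iff.1
        (c1.continuousAt.eventually_ne h0)
      exact ⟨r, hr, Or.inl h1⟩
    · obtain ⟨r, hr, h1⟩ := (nhds_basis_Icc_pos τ).eventually_iff.1
        ((c2 (g τ)).continuousAt.eventually_ne h0)
      exact ⟨r, hr, Or.inr h1⟩
  choose r hr0 hr using hr
  obtain ⟨S, -, hS⟩ := (isCompact_Icc (a := 0) (b := 2 * Real.pi)).elim_nhds_subcover
    (fun τ => Icc (τ - r τ) (τ + r τ)) fun τ _ => (nhds_basis_Icc_pos τ).mem_of_mem (hr0 τ)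
  -- On each interval of the finite cover either J has no zero, or the direction `g τ` moves J to
  -- first order. Both alternatives are stable, so they are still available after the perturbations
  -- made for the other intervals.
  obtain ⟨f', h1, h2⟩ := exists_mem_forall_of_finset
    (T := fun τ => {f | ∀ θ ∈ Icc (τ - r τ) (τ + r τ), J (derivs 4 f θ) ≠ 0} ∪
      {f | ∀ θ ∈ Icc (τ - r τ) (τ + r τ), fderiv ℝ J (derivs 4 f θ) (derivs 4 (g τ) θ) ≠ 0})
    (P := fun τ => {f | ∀ θ ∈ Icc (τ - r τ) (τ + r τ), derivs 5 f θ ∈ simpleJets J})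
    (fun τ => (stable_forall_derivs isCompact_Icc (U := {z | J z.2 ≠ 0})
        (isOpen_ne_fun (hJ.continuous.comp continuous_snd) continuous_const)).union
      (stable_forall_derivs isCompact_Icc
        (U := {z | fderiv ℝ J z.2 (derivs 4 (g τ) z.1) ≠ 0})
        (isOpen_ne_fun (((hJ.continuous_fderiv (by simp)).comp continuous_snd).clm_apply
          ((continuous_derivs 4 (g τ)).comp continuous_fst)) continuous_const)))
    (fun τ => stable_simpleJets hJ isCompact_Icc)
    (fun τ O hO f hf hT => by
      rcases hT with hT | hT
      · exact ⟨f, hf, fun θ hθ h0 => (hT θ hθ h0).elim⟩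
      · exact exists_simpleJets_Icc hJ hO hf (g τ) (by linarith [hr0 τ]) hT)
    S hO hf fun τ _ => hr τ
  refine ⟨f', h1, fun θ hθ => ?_⟩
  obtain ⟨τ, hτ, hθτ⟩ := mem_iUnion₂.1 (hS hθ)
  exact h2 τ hτ θ hθτ

/-! ### Generic curves -/

/-- The singularities and inflexions of the singular evolutoids set are non-degenerate if the
differential expressions which describe them have only simple zeros. -/
theorem sesCurve_generic {f : ℝ → Plane} (hf : ContDiff ℝ ∞ f) (h : ∀ t, deriv f t ≠ 0)
    (h0 : ∀ t, turning (deriv f) t = 0 → deriv (turning (deriv f)) t ≠ 0)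
    (h1 : ∀ t, radiusNum₂ (fun _ => 1) (deriv f) t = 0 →
      deriv (radiusNum₂ (fun _ => 1) (deriv f)) t ≠ 0)
    (h2 : ∀ t, sesDenom (fun _ => 1) (deriv f) t +
        2 * dot2 (deriv f t) (deriv f t) * radiusNum₂ (fun _ => 1) (deriv f) t = 0 →
      deriv (fun s => sesDenom (fun _ => 1) (deriv f) s +
        2 * dot2 (deriv f s) (deriv f s) * radiusNum₂ (fun _ => 1) (deriv f) s) t ≠ 0) :
    AtMostCusps f univ ∧ ContDiff ℝ ∞ (sesCurve f) ∧ AtMostCusps (sesCurve f) univ ∧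
      (∀ t, ¬ IsUndulation (sesCurve f) t) ∧
      ∀ t, IsInflexion (sesCurve f) t → IsNondegenerate (sesCurve f) t := by
  have hg : ContDiff ℝ ∞ (deriv f) := ContDiff.deriv_top hf
  have hone : ContDiff ℝ ∞ fun _ : ℝ => (1 : ℝ) := contDiff_const
  have hq (t : ℝ) : dot2 (deriv f t) (deriv f t) ≠ 0 := dot2_self_ne_zero (h t)
  -- At a flat point N = −qp', hence D = q²p'², E = 2qp'² and D + 2qE = 5q²p'². All three are
  -- nonzero because p has a simple zero.
  have hN (t : ℝ) (hp : turning (deriv f) t = 0) : radiusNum (fun _ => 1) (deriv f) t =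
      -(dot2 (deriv f t) (deriv f t) * deriv (turning (deriv f)) t) := by
    rw [radiusNum_one, hp]; ring
  have hd (t : ℝ) : sesDenom (fun _ => 1) (deriv f) t ≠ 0 := by
    by_cases hp : turning (deriv f) t = 0
    · rw [sesDenom_one, hN t hp, hp]
      have := pow_ne_zero 2 (mul_ne_zero (hq t) (h0 t hp))
      simpa using this
    · exact sesDenom_one_ne_zero hp
  have hE1 (t : ℝ) (hp : turning (deriv f) t = 0) : radiusNum₂ (fun _ => 1) (deriv f) t =
      2 * dot2 (deriv f t) (deriv f t) * deriv (turning (deriv f)) t ^ 2 := by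
    rw [radiusNum₂_one, hN t hp, hp]; ring
  have hE2 (t : ℝ) (hp : turning (deriv f) t = 0) : sesDenom (fun _ => 1) (deriv f) t +
      2 * dot2 (deriv f t) (deriv f t) * radiusNum₂ (fun _ => 1) (deriv f) t ≠ 0 := by
    rw [hE1 t hp, sesDenom_one, hN t hp, hp]
    have h3 := pow_ne_zero 2 (mul_ne_zero (hq t) (h0 t hp))
    intro h4
    exact h3 (by linear_combination h4 / 5)
  have cE1 : ContDiff ℝ ∞ (radiusNum₂ (fun _ => 1) (deriv f)) := contDiff_radiusNum₂ hone hg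
  have cE2 : ContDiff ℝ ∞ fun s => sesDenom (fun _ => 1) (deriv f) s +
      2 * dot2 (deriv f s) (deriv f s) * radiusNum₂ (fun _ => 1) (deriv f) s :=
    (contDiff_sesDenom hone hg).add ((contDiff_const.mul (hg.dot2 hg)).mul cE1)
  have hT (t : ℝ) (hz : sesTurning (deriv f) t = 0) : deriv (sesTurning (deriv f)) t ≠ 0 := by
    have hder : HasDerivAt (sesTurning (deriv f)) _ t :=
      (((contDiff_turning hg).differentiable (by simp)) t).hasDerivAt.mul
        ((cE2.differentiable (by simp)) t).hasDerivAt
    rw [hder.deriv]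
    rcases mul_eq_zero.1 hz with hp | hp
    · simpa [hp] using ⟨h0 t hp, hE2 t hp⟩
    · have hp0 : turning (deriv f) t ≠ 0 := fun hp0 => hE2 t hp0 hp
      simpa [hp] using ⟨hp0, h2 t hp⟩
  refine ⟨fun t _ h' => (h t h').elim, ?_, fun t _ h' => ?_,
    fun t => not_isUndulation_sesCurve hf (h t) (hd t) (hT t), fun t ht => ?_⟩
  · rw [show sesCurve f = sesFormula f (fun _ => 1) (deriv f) from funext (sesCurve_eq hf)]
    exact contDiff_iff_contDiffAt.2 fun t => contDiffAt_sesFormula hf hone hg (hd t)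
  · have hz := (deriv_sesCurve_eq_zero_iff hf (h t) (hd t)).1 h'
    refine isCusp_sesCurve_of hf (h t) (hd t) (fun hp => ?_) hz (h1 t hz)
    exact mul_ne_zero (mul_ne_zero two_ne_zero (hq t)) (pow_ne_zero 2 (h0 t hp)) (hE1 t hp ▸ hz)
  · obtain ⟨h3, h4⟩ := (inflexion_or_undulation_sesCurve_iff hf (h t) (hd t)).1 (Or.inl ht)
    exact (nondegenerate_sesCurve_iff hf (h t) (hd t) h3 h4).2 (hT t h4)

/-! ### Perturbations of closed curves -/

/-- The restriction to the circle of a smooth map on the complex plane. -/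
def ClosedCurve.ofComplex (p : ℂ → Plane) (hp : ContDiff ℝ ∞ p) : ClosedCurve :=
  haveI := finrank_real_complex_fact'
  ⟨fun z => p z, hp.contMDiff.comp (contMDiff_coe_sphere (E := ℂ) (n := 1))⟩

theorem ClosedCurve.lift_ofComplex (p : ℂ → Plane) (hp : ContDiff ℝ ∞ p) (θ : ℝ) :
    (ofComplex p hp).lift θ = p (Real.cos θ + Real.sin θ * Complex.I) := by
  have : ((Circle.exp θ : Circle) : ℂ) = Real.cos θ + Real.sin θ * Complex.I := by
    rw [Circle.coe_exp, Complex.exp_mul_I, Complex.ofReal_cos, Complex.ofReal_sin]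
  exact congrArg p this

open ClosedCurve

/-- A closed curve whose derivatives at a given point up to order four, except the value, are
prescribed multiples of `v`. -/
theorem exists_derivs_eq (τ B C : ℝ) (v : Plane) : ∃ g : ClosedCurve,
    derivs 4 g τ 1 = 0 ∧ derivs 4 g τ 2 = (-(B + 4 * C)) • v ∧ derivs 4 g τ 3 = 0 ∧
      derivs 4 g τ 4 = (B + 16 * C) • v := by
  -- On the circle c = cos(θ − τ) and 2c² − 1 = cos 2(θ − τ). Odd derivatives of both vanish at τ,
  -- and the two frequencies allow independent control of the second and fourth derivatives.
  let c : ℂ → ℝ := fun w => w.re * Real.cos τ + w.im * Real.sin τ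
  have hc : ContDiff ℝ ∞ c := (Complex.reCLM.contDiff.mul contDiff_const).add
    (Complex.imCLM.contDiff.mul contDiff_const)
  let g := ofComplex (fun w => (B * c w + C * (2 * c w ^ 2 - 1)) • v)
    (((contDiff_const.mul hc).add (contDiff_const.mul ((contDiff_const.mul (hc.pow 2)).sub
      contDiff_const))).smul contDiff_const)
  have hlift : g.lift = fun θ => (B * Real.cos (θ - τ) + C * Real.cos (2 * (θ - τ))) • v := by
    funext θ
    have h1 : c (Real.cos θ + Real.sin θ * Complex.I) = Real.cos (θ - τ) := by
      simp [c, Real.cos_sub, -Complex.ofReal_cos, -Complex.ofReal_sin]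
    rw [lift_ofComplex]
    simp only [h1, Real.cos_two_mul]
  have hcos (k : ℝ) (θ : ℝ) : HasDerivAt (fun θ => Real.cos (k * (θ - τ)))
      (-(k * Real.sin (k * (θ - τ)))) θ :=
    (((hasDerivAt_id θ).sub_const τ).const_mul k).cos.congr_deriv (by simp; ring)
  have hsin (k : ℝ) (θ : ℝ) : HasDerivAt (fun θ => Real.sin (k * (θ - τ)))
      (k * Real.cos (k * (θ - τ))) θ :=
    (((hasDerivAt_id θ).sub_const τ).const_mul k).sin.congr_deriv (by simp; ring)
  have dcos (B C : ℝ) : deriv (fun θ => (B * Real.cos (1 * (θ - τ)) + C * Real.cos (2 * (θ - τ))) • v)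
      = fun θ => ((-B) * Real.sin (1 * (θ - τ)) + (-(2 * C)) * Real.sin (2 * (θ - τ))) • v := by
    funext θ
    exact (((((hcos 1 θ).const_mul B).add ((hcos 2 θ).const_mul C)).smul_const v).congr_deriv
      (by congr 1; ring)).deriv
  have dsin (B C : ℝ) : deriv (fun θ => (B * Real.sin (1 * (θ - τ)) + C * Real.sin (2 * (θ - τ))) • v)
      = fun θ => (B * Real.cos (1 * (θ - τ)) + (2 * C) * Real.cos (2 * (θ - τ))) • v := by
    funext θ
    exact (((((hsin 1 θ).const_mul B).add ((hsin 2 θ).const_mul C)).smul_const v).congr_deriv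
      (by congr 1; ring)).deriv
  have hlift' : g.lift = fun θ => (B * Real.cos (1 * (θ - τ)) + C * Real.cos (2 * (θ - τ))) • v := by
    rw [hlift]; simp only [one_mul]
  have i1 := (congrArg deriv hlift').trans (dcos _ _)
  rw [← iteratedDeriv_one] at i1
  have i2 := (congrArg deriv i1).trans (dsin _ _)
  rw [← iteratedDeriv_succ] at i2
  have i3 := (congrArg deriv i2).trans (dcos _ _)
  rw [← iteratedDeriv_succ] at i3
  have i4 := (congrArg deriv i3).trans (dsin _ _)
  rw [← iteratedDeriv_succ] at i4
  refine ⟨g, ?_, ?_, ?_, ?_⟩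
  · exact (congrFun i1 τ).trans (by simp)
  · exact (congrFun i2 τ).trans (by simp; congr 1; ring)
  · exact (congrFun i3 τ).trans (by simp)
  · exact (congrFun i4 τ).trans (by simp; congr 1; ring)

/-- Immersions are obtained by arbitrarily small perturbations. -/
theorem exists_immersion {O : Set ClosedCurve} (hO : Stable O) {f : ClosedCurve} (hf : f ∈ O) :
    ∃ f' ∈ O, ∀ θ, deriv f'.lift θ ≠ 0 := by
  let e : Fin 2 → Plane := fun i => EuclideanSpace.single i 1
  let gc : Fin 2 → ClosedCurve := fun i => ofComplex (fun w => w.re • e i)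
    (Complex.reCLM.contDiff.smul contDiff_const)
  let gs : Fin 2 → ClosedCurve := fun i => ofComplex (fun w => w.im • e i)
    (Complex.imCLM.contDiff.smul contDiff_const)
  have hgc (i : Fin 2) : (gc i).lift = fun θ => Real.cos θ • e i := by
    funext θ
    exact (lift_ofComplex _ _ θ).trans (by simp [-Complex.ofReal_cos, -Complex.ofReal_sin])
  have hgs (i : Fin 2) : (gs i).lift = fun θ => Real.sin θ • e i := by
    funext θ
    exact (lift_ofComplex _ _ θ).trans (by simp [-Complex.ofReal_cos, -Complex.ofReal_sin])
  have hdf : ContDiff ℝ ∞ (deriv f.lift) := ContDiff.deriv_top f.contDiff_lift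
  -- The perturbed curve is f + cos θ (a₀, a₁) + sin θ (a₂, a₃). For given θ, singularity fixes the
  -- component −sin θ (a₀, a₁) + cos θ (a₂, a₃) = −f'(θ), while the orthogonal combination is free.
  -- Thus the bad parameters lie in the image of a 3-dimensional space in ℝ⁴.
  let Ψ : ℝ × ℝ × ℝ → Fin 4 → ℝ := fun z =>
    ![Real.cos z.1 * z.2.1 + Real.sin z.1 * deriv f.lift z.1 0,
      Real.cos z.1 * z.2.2 + Real.sin z.1 * deriv f.lift z.1 1,
      Real.sin z.1 * z.2.1 - Real.cos z.1 * deriv f.lift z.1 0,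
      Real.sin z.1 * z.2.2 - Real.cos z.1 * deriv f.lift z.1 1]
  have hΨ : ContDiff ℝ 1 Ψ := by
    have d (i : Fin 2) : ContDiff ℝ 1 fun z : ℝ × ℝ × ℝ => deriv f.lift z.1 i :=
      ((hdf.of_le (by exact_mod_cast le_top)).plane_apply i).comp contDiff_fst
    have d0 := d 0
    have d1 := d 1
    rw [contDiff_pi]
    intro i
    fin_cases i
    · exact (contDiff_fst.cos.mul contDiff_snd.fst).add (contDiff_fst.sin.mul d0)
    · exact (contDiff_fst.cos.mul contDiff_snd.snd).add (contDiff_fst.sin.mul d1)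
    · exact (contDiff_fst.sin.mul contDiff_snd.fst).sub (contDiff_fst.cos.mul d0)
    · exact (contDiff_fst.sin.mul contDiff_snd.snd).sub (contDiff_fst.cos.mul d1)
  have hdense : Dense (range Ψ)ᶜ := hΨ.dense_compl_range_of_finrank_lt_finrank (by simp)
  obtain ⟨a, ha, haO⟩ := (mem_closure_iff_frequently.1 (hdense 0)).and_eventually
    (hO f hf 4 ![gc 0, gc 1, gs 0, gs 1]) |>.exists
  refine ⟨_, haO, fun θ h0 => ha ⟨(θ, Real.cos θ * a 0 + Real.sin θ * a 2,
    Real.cos θ * a 1 + Real.sin θ * a 3), ?_⟩⟩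
  have hlift : (f + ∑ j, a j • ![gc 0, gc 1, gs 0, gs 1] j).lift = fun θ => f.lift θ +
      (Real.cos θ • (a 0 • e 0 + a 1 • e 1) + Real.sin θ • (a 2 • e 0 + a 3 • e 1)) := by
    rw [Fin.sum_univ_four]
    simp only [lift_add, lift_smul, Matrix.cons_val, hgc, hgs]
    funext θ
    simp only [Pi.add_apply, Pi.smul_apply]
    module
  have hder := ((ContDiff.hasDerivAt_deriv f.contDiff_lift θ)).add
    (((Real.hasDerivAt_cos θ).smul_const (a 0 • e 0 + a 1 • e 1)).add
      ((Real.hasDerivAt_sin θ).smul_const (a 2 • e 0 + a 3 • e 1)))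
  have h1 := (hder.congr_of_eventuallyEq (EventuallyEq.of_eq hlift)).deriv.symm.trans h0
  have hx := congrArg (· 0) h1
  have hy := congrArg (· 1) h1
  simp [e] at hx hy
  have hs := Real.sin_sq_add_cos_sq θ
  funext i
  fin_cases i
  all_goals simp [Ψ]
  · linear_combination Real.sin θ * hx + a 0 * hs
  · linear_combination Real.sin θ * hy + a 1 * hs
  · linear_combination -Real.cos θ * hx + a 2 * hs
  · linear_combination -Real.cos θ * hy + a 3 * hs

open ClosedCurve

/-! ### Differential expressions of a curve as functions of its jets -/

/-- The determinant `det (f', f'')`. -/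
def turningJet (x : Fin 5 → Plane) : ℝ := det2 (x 1) (x 2)

/-- The numerator of `ρ'`. -/
def radiusNumJet (x : Fin 5 → Plane) : ℝ :=
  3 * dot2 (x 1) (x 2) * turningJet x - dot2 (x 1) (x 1) * det2 (x 1) (x 3)

/-- The numerator of `ρ''`. -/
def radiusNum₂Jet (x : Fin 5 → Plane) : ℝ :=
  (3 * (dot2 (x 2) (x 2) + dot2 (x 1) (x 3)) * turningJet x + dot2 (x 1) (x 2) * det2 (x 1) (x 3)
    - dot2 (x 1) (x 1) * (det2 (x 2) (x 3) + det2 (x 1) (x 4))) * turningJet x -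
  2 * radiusNumJet x * det2 (x 1) (x 3)

/-- The numerator of `1 + ρ'² + 2ρρ''`. -/
def inflexionJet (x : Fin 5 → Plane) : ℝ :=
  turningJet x ^ 4 + radiusNumJet x ^ 2 + 2 * dot2 (x 1) (x 1) * radiusNum₂Jet x

theorem contDiff_coord (i : Fin 5) : ContDiff ℝ ∞ fun x : Fin 5 → Plane => x i :=
  contDiff_apply ℝ Plane i

theorem contDiff_turningJet : ContDiff ℝ ∞ turningJet := (contDiff_coord 1).det2 (contDiff_coord 2)

theorem contDiff_radiusNumJet : ContDiff ℝ ∞ radiusNumJet :=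
  ((contDiff_const.mul ((contDiff_coord 1).dot2 (contDiff_coord 2))).mul contDiff_turningJet).sub
    (((contDiff_coord 1).dot2 (contDiff_coord 1)).mul ((contDiff_coord 1).det2 (contDiff_coord 3)))

theorem contDiff_radiusNum₂Jet : ContDiff ℝ ∞ radiusNum₂Jet := by
  have hd (i j : Fin 5) := (contDiff_coord i).dot2 (contDiff_coord j)
  have hp (i j : Fin 5) := (contDiff_coord i).det2 (contDiff_coord j)
  exact (((((contDiff_const.mul ((hd 2 2).add (hd 1 3))).mul contDiff_turningJet).add
    ((hd 1 2).mul (hp 1 3))).sub ((hd 1 1).mul ((hp 2 3).add (hp 1 4)))).mul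
    contDiff_turningJet).sub ((contDiff_const.mul contDiff_radiusNumJet).mul (hp 1 3))

theorem contDiff_inflexionJet : ContDiff ℝ ∞ inflexionJet :=
  ((contDiff_turningJet.pow 4).add (contDiff_radiusNumJet.pow 2)).add
    ((contDiff_const.mul ((contDiff_coord 1).dot2 (contDiff_coord 1))).mul contDiff_radiusNum₂Jet)

/-- The perturbations used leave the lower derivatives unchanged and J is affine in the remaining
ones, so its directional derivative can be read off as a coefficient. -/
theorem fderiv_eq_of_affine {J : (Fin 5 → Plane) → ℝ} (hJ : ContDiff ℝ ∞ J) {x y : Fin 5 → Plane}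
    {c : ℝ} (h : ∀ a : ℝ, J (x + a • y) = J x + a * c) : fderiv ℝ J x y = c := by
  have h1 : HasDerivAt (fun a : ℝ => x + a • y) y 0 :=
    (((hasDerivAt_id (0 : ℝ)).smul_const y).const_add x).congr_deriv (one_smul _ _)
  have h2 : HasFDerivAt J (fderiv ℝ J x) (x + (0 : ℝ) • y) := by
    rw [zero_smul, add_zero]
    exact (hJ.differentiable (by simp) x).hasFDerivAt
  have h3 : HasDerivAt (fun a : ℝ => J (x + a • y)) c 0 := by
    simp only [h]
    exact (((hasDerivAt_id (0 : ℝ)).mul_const c).const_add (J x)).congr_deriv (one_mul _)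
  exact (h2.comp_hasDerivAt 0 h1).unique h3

theorem fderiv_turningJet {x y : Fin 5 → Plane} (h1 : y 1 = 0) :
    fderiv ℝ turningJet x y = det2 (x 1) (y 2) :=
  fderiv_eq_of_affine contDiff_turningJet fun a => by
    simp [turningJet, h1, det2]; ring

theorem fderiv_radiusNum₂Jet {x y : Fin 5 → Plane} (h1 : y 1 = 0) (h2 : y 2 = 0) (h3 : y 3 = 0) :
    fderiv ℝ radiusNum₂Jet x y = -(dot2 (x 1) (x 1) * turningJet x * det2 (x 1) (y 4)) :=
  fderiv_eq_of_affine contDiff_radiusNum₂Jet fun a => by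
    simp [radiusNum₂Jet, radiusNumJet, turningJet, h1, h2, h3, det2]; ring

theorem fderiv_inflexionJet {x y : Fin 5 → Plane} (h1 : y 1 = 0) (h2 : y 2 = 0) (h3 : y 3 = 0) :
    fderiv ℝ inflexionJet x y =
      -(2 * dot2 (x 1) (x 1) ^ 2 * turningJet x * det2 (x 1) (y 4)) :=
  fderiv_eq_of_affine contDiff_inflexionJet fun a => by
    simp [inflexionJet, radiusNum₂Jet, radiusNumJet, turningJet, h1, h2, h3, det2]; ring

theorem det2_rot90_self (v : Plane) : det2 v (rot90 v) = dot2 v v := by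
  simp [det2, rot90, dot2]

/-! ### The expressions along a closed curve -/

variable (f : ClosedCurve) (θ : ℝ)

theorem turning_lift : turning (deriv f.lift) θ = turningJet (derivs 4 f θ) := by
  simp [turning, turningJet, derivs, iteratedDeriv_succ]

theorem hasDerivAt_iteratedDeriv_lift (i : ℕ) :
    HasDerivAt (iteratedDeriv i f.lift) (iteratedDeriv (i + 1) f.lift θ) θ := by
  rw [iteratedDeriv_succ]
  exact (f.contDiff_lift.differentiable_iteratedDeriv i
    (by exact_mod_cast WithTop.coe_lt_top _) θ).hasDerivAt

theorem deriv_turning_lift : deriv (turning (deriv f.lift)) θ =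
    det2 (derivs 4 f θ 1) (derivs 4 f θ 3) := by
  have h := (hasDerivAt_iteratedDeriv_lift f θ 1).det2 (hasDerivAt_iteratedDeriv_lift f θ 2)
  rw [show turning (deriv f.lift) = fun θ =>
    det2 (iteratedDeriv 1 f.lift θ) (iteratedDeriv 2 f.lift θ) from funext (turning_lift f), h.deriv,
    det2_self]
  simp [derivs]

theorem radiusNum_lift : radiusNum (fun _ => 1) (deriv f.lift) θ = radiusNumJet (derivs 4 f θ) := by
  rw [radiusNum_one, deriv_turning_lift, turning_lift]
  simp [radiusNumJet, derivs, iteratedDeriv_succ]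

theorem radiusNum₂_lift :
    radiusNum₂ (fun _ => 1) (deriv f.lift) θ = radiusNum₂Jet (derivs 4 f θ) := by
  have h (i : ℕ) := hasDerivAt_iteratedDeriv_lift f θ i
  have hN := ((((h 1).dot2 (h 2)).const_mul 3).mul ((h 1).det2 (h 2))).sub
    (((h 1).dot2 (h 1)).mul ((h 1).det2 (h 3)))
  have e : radiusNum (fun _ => 1) (deriv f.lift) = fun θ => radiusNumJet (derivs 4 f θ) :=
    funext (radiusNum_lift f)
  rw [radiusNum₂_one, radiusNum_lift, deriv_turning_lift, turning_lift, e]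
  have hN' : HasDerivAt (fun θ => radiusNumJet (derivs 4 f θ)) _ θ := hN
  rw [hN'.deriv]
  simp [radiusNum₂Jet, radiusNumJet, turningJet, derivs, det2, dot2, -mul_eq_mul_right_iff,
    -mul_eq_mul_left_iff]
  ring

theorem sesDenom_lift : sesDenom (fun _ => 1) (deriv f.lift) θ +
    2 * dot2 (deriv f.lift θ) (deriv f.lift θ) * radiusNum₂ (fun _ => 1) (deriv f.lift) θ =
      inflexionJet (derivs 4 f θ) := by
  rw [sesDenom_one, radiusNum_lift, radiusNum₂_lift, turning_lift]
  simp [inflexionJet, derivs]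

variable {f θ}

theorem deriv_ne_zero_of_mem_simpleJets {J : (Fin 5 → Plane) → ℝ} (hJ : ContDiff ℝ ∞ J)
    (h : derivs 5 f θ ∈ simpleJets J) (h0 : J (derivs 4 f θ) = 0) :
    deriv (fun θ => J (derivs 4 f θ)) θ ≠ 0 := by
  change deriv (J ∘ derivs 4 f) θ ≠ 0
  rw [((hJ.differentiable (by simp) _).hasFDerivAt.comp_hasDerivAt θ (hasDerivAt_derivs 4 f θ)).deriv]
  exact h h0

/-! ### Density of generic closed curves. -/

/-- Closed curves whose singular evolutoids set has only generic singularities are dense. -/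
theorem dense_generic : @Dense ClosedCurve whitneyTopology
    {f | AtMostCusps f.lift univ ∧ ContDiff ℝ ∞ (sesCurve f.lift) ∧
      AtMostCusps (sesCurve f.lift) univ ∧ (∀ θ : ℝ, ¬ IsUndulation (sesCurve f.lift) θ) ∧
      (∀ θ : ℝ, IsInflexion (sesCurve f.lift) θ → IsNondegenerate (sesCurve f.lift) θ)} := by
  refine fun f => (@mem_closure_iff _ whitneyTopology _ _).2 fun O hO hf => ?_
  have hK : IsCompact (Icc 0 (2 * Real.pi)) := isCompact_Icc
  have s0 := stable_of_isOpen_whitneyTopology hO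
  obtain ⟨f₀, hf₀, himm⟩ := exists_immersion s0 hf
  -- Regularity is recorded as an open condition on jets, so that the later perturbations preserve
  -- it.
  have hR : IsOpen {z : Fin 6 → Plane | z 1 ≠ 0} := isOpen_ne_fun (continuous_apply 1) continuous_const
  have s1 := s0.inter (stable_forall_derivs hK (hR.preimage continuous_snd))
  have reg {f : ClosedCurve} (h : ∀ θ ∈ Icc 0 (2 * Real.pi),
      (θ, derivs 5 f θ) ∈ Prod.snd ⁻¹' {z : Fin 6 → Plane | z 1 ≠ 0}) (θ : ℝ) :
      deriv f.lift θ ≠ 0 := by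
    have := forall_derivs (k := 5) (f := f) (U := {z : Fin 6 → Plane | z 1 ≠ 0}) h θ
    rw [← iteratedDeriv_one]
    exact this
  have pos {f : ClosedCurve} {θ : ℝ} (h : deriv f.lift θ ≠ 0) :
      dot2 (derivs 4 f θ 1) (derivs 4 f θ 1) ≠ 0 := by
    rw [← iteratedDeriv_one] at h
    exact dot2_self_ne_zero h
  obtain ⟨f₁, hf₁, hz₁⟩ := exists_simpleJets contDiff_turningJet s1 (f := f₀)
    ⟨hf₀, fun θ _ => by
      have := himm θ
      rw [← iteratedDeriv_one] at this
      exact this⟩ fun θ _ => by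
    -- These coefficients make the second derivative of g the rotated velocity, which moves det(f',
    -- f'') by |f'|².
    obtain ⟨g, g1, g2, -, -⟩ := exists_derivs_eq θ (-1) 0 (rot90 (derivs 4 f₀ θ 1))
    refine ⟨g, ?_⟩
    rw [fderiv_turningJet g1, g2]
    simpa [det2_rot90_self] using pos (himm θ)
  have s2 := s1.inter (stable_simpleJets contDiff_turningJet hK)
  have turn {f : ClosedCurve} (h : ∀ θ ∈ Icc 0 (2 * Real.pi), derivs 5 f θ ∈ simpleJets turningJet)
      {θ : ℝ} (h0 : turningJet (derivs 4 f θ) = 0) : det2 (derivs 4 f θ 1) (derivs 4 f θ 3) ≠ 0 := by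
    have h1 := deriv_ne_zero_of_mem_simpleJets contDiff_turningJet (forall_derivs h θ) h0
    rw [← deriv_turning_lift]
    rwa [show turning (deriv f.lift) = fun θ => turningJet (derivs 4 f θ) from
      funext (turning_lift f)]
  obtain ⟨f₂, hf₂, hz₂⟩ := exists_simpleJets contDiff_radiusNum₂Jet s2 (f := f₁)
    ⟨hf₁, hz₁⟩ fun θ h0 => by
    have hq := pos (reg hf₁.2 θ)
    -- If p vanished, E would be 2qp'², which is nonzero because p already has only simple zeros. So
    -- p ≠ 0, and the coefficient of the fourth derivative in E does not vanish.
    have hp : turningJet (derivs 4 f₁ θ) ≠ 0 := fun hp => by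
      refine mul_ne_zero hq (pow_ne_zero 2 (turn hz₁ hp)) ?_
      simp only [radiusNum₂Jet, radiusNumJet, hp] at h0
      linear_combination h0 / 2
    -- The coefficients −4 and 1 cancel the second derivative and leave 12 times the rotated
    -- velocity in the fourth, so that only the top-order term is perturbed.
    obtain ⟨g, g1, g2, g3, g4⟩ := exists_derivs_eq θ (-4) 1 (rot90 (derivs 4 f₁ θ 1))
    refine ⟨g, ?_⟩
    rw [fderiv_radiusNum₂Jet g1 (by simpa using g2) g3, g4, det2_smul_right, det2_rot90_self]
    exact neg_ne_zero.2 (mul_ne_zero (mul_ne_zero hq hp) (mul_ne_zero (by norm_num) hq))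
  have s3 := s2.inter (stable_simpleJets contDiff_radiusNum₂Jet hK)
  obtain ⟨f₃, ⟨⟨⟨hf₃, hr⟩, ht⟩, hz⟩, hi⟩ := exists_simpleJets contDiff_inflexionJet s3 (f := f₂)
    ⟨hf₂, hz₂⟩ fun θ h0 => by
    have hq := pos (reg hf₂.1.2 θ)
    have hp : turningJet (derivs 4 f₂ θ) ≠ 0 := fun hp => by
      refine pow_ne_zero 2 (mul_ne_zero hq (turn hf₂.2 hp)) ?_
      simp only [inflexionJet, radiusNum₂Jet, radiusNumJet, hp] at h0
      linear_combination h0 / 5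
    obtain ⟨g, g1, g2, g3, g4⟩ := exists_derivs_eq θ (-4) 1 (rot90 (derivs 4 f₂ θ 1))
    refine ⟨g, ?_⟩
    rw [fderiv_inflexionJet g1 (by simpa using g2) g3, g4, det2_smul_right, det2_rot90_self]
    exact neg_ne_zero.2 (mul_ne_zero (mul_ne_zero (mul_ne_zero two_ne_zero (pow_ne_zero 2 hq)) hp)
      (mul_ne_zero (by norm_num) hq))
  have simple {J : (Fin 5 → Plane) → ℝ} (hJ : ContDiff ℝ ∞ J)
      (h : ∀ θ ∈ Icc 0 (2 * Real.pi), derivs 5 f₃ θ ∈ simpleJets J) {F : ℝ → ℝ}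
      (hF : ∀ θ, F θ = J (derivs 4 f₃ θ)) (θ : ℝ) (h0 : F θ = 0) : deriv F θ ≠ 0 := by
    rw [funext hF]
    exact deriv_ne_zero_of_mem_simpleJets hJ (forall_derivs h θ) (hF θ ▸ h0)
  exact ⟨f₃, hf₃, sesCurve_generic f₃.contDiff_lift (reg hr)
    (simple contDiff_turningJet ht (turning_lift f₃))
    (simple contDiff_radiusNum₂Jet hz (radiusNum₂_lift f₃))
    (simple contDiff_inflexionJet hi (sesDenom_lift f₃))⟩

end Evolutoid

end

/-! ### Assembly of the statements. -/

theorem mainTheorem3 :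
    (∀ (I : Set ℝ) (f : ℝ → Evolutoid.Plane), IsOpen I → ContDiffOn ℝ ∞ f I →
      Evolutoid.AtMostCusps f I →
      -- (i)
      ((∀ t ∈ I, deriv f t ≠ 0 → Evolutoid.HasFiniteContact f t) →
        ContDiffOn ℝ ∞ (Evolutoid.sesCurve f) I) ∧
      Evolutoid.SES f I = Evolutoid.sesCurve f '' {t ∈ I | ¬ Evolutoid.IsFlat f t} ∧
      -- (ii)
      (∀ t ∈ I, deriv f t ≠ 0 → Evolutoid.curvature f t ≠ 0 →
        (deriv (Evolutoid.sesCurve f) t = 0 ↔ Evolutoid.radius₂ f t = 0) ∧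
        (deriv (Evolutoid.sesCurve f) t = 0 →
          (Evolutoid.IsCusp (Evolutoid.sesCurve f) t ↔ Evolutoid.radius₃ f t ≠ 0))) ∧
      -- (ii) at a point of zero curvature, where `ρ` is infinite
      (∀ t ∈ I, Evolutoid.IsFlat f t → Evolutoid.HasFiniteContact f t →
        deriv (Evolutoid.sesCurve f) t ≠ 0) ∧
      -- (iii)
      (∀ t ∈ I, Evolutoid.IsCusp f t →
        Evolutoid.sesCurve f t = f t ∧ Evolutoid.IsCusp (Evolutoid.sesCurve f) t) ∧
      -- (iv)
      (∀ t ∈ I, deriv f t ≠ 0 → Evolutoid.curvature f t ≠ 0 →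
        ((Evolutoid.IsInflexion (Evolutoid.sesCurve f) t ∨
            Evolutoid.IsUndulation (Evolutoid.sesCurve f) t) ↔
          1 + Evolutoid.radius₁ f t ^ 2 + 2 * Evolutoid.radius f t * Evolutoid.radius₂ f t = 0) ∧
        (Evolutoid.IsInflexion (Evolutoid.sesCurve f) t →
          (Evolutoid.IsNondegenerate (Evolutoid.sesCurve f) t ↔
            Evolutoid.radius₁ f t + Evolutoid.radius₁ f t ^ 3
              - Evolutoid.radius f t ^ 2 * Evolutoid.radius₃ f t ≠ 0)))) ∧
    -- (v)
    @Dense Evolutoid.ClosedCurve Evolutoid.whitneyTopology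
      {f | Evolutoid.AtMostCusps f.lift univ ∧
        ContDiff ℝ ∞ (Evolutoid.sesCurve f.lift) ∧
        Evolutoid.AtMostCusps (Evolutoid.sesCurve f.lift) univ ∧
        (∀ θ : ℝ, ¬ Evolutoid.IsUndulation (Evolutoid.sesCurve f.lift) θ) ∧
        (∀ θ : ℝ, Evolutoid.IsInflexion (Evolutoid.sesCurve f.lift) θ →
          Evolutoid.IsNondegenerate (Evolutoid.sesCurve f.lift) θ)} :=
  ⟨fun _ _ hI hf hcusp =>
    ⟨fun hc => Evolutoid.contDiffOn_sesCurve hI hf hcusp hc, Evolutoid.SES_eq_image hI hf,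
      fun _ ht h hk => Evolutoid.sesCurve_singular hI hf ht h hk,
      fun _ ht hflat hc => Evolutoid.sesCurve_regular_of_isFlat hI hf ht hflat hc,
      fun _ ht hc => Evolutoid.sesCurve_cusp hI hf ht hc,
      fun _ ht h hk => Evolutoid.sesCurve_inflexion hI hf ht h hk⟩,
    Evolutoid.dense_generic⟩
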